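/- Let $G_N=N^{-1/2}G$, where $G$ is an $N\times N$ matrix of i.i.d. standard complex normal random variables (density $\pi^{-1}e^{-|z|^2}$ on $\mathbb C$). Let $k_2$ be a non-negative integer and let $\gamma\ge k_2$ be real. For $u_2\in\mathbb C$ put $z_2=u_2/\sqrt N$. Then for every $N\ge 1$ and every $u_2\in\mathbb C$ the random variable $|\det G_N|^{2\gamma}|\det(G_N-z_2)|^{2k_2}$ is integrable and, uniformly for $u_2$ in compact subsets of $\mathbb C$, as $N\to\infty$, $$\mathbb E\left(|\det G_N|^{2\gamma}\,|\det(G_N-z_2)|^{2k_2}\right)=e^{-\gamma N+k_2N(|z_2|^2-1)+\frac{\gamma^2}{2}\log N+\frac{k_2^2}{2}\log N}\;e^{-2\gamma k_2\log|z_2|}\;\frac{(2\pi)^{(\gamma+k_2)/2}}{G(1+\gamma)\,G(1+k_2)}\;F_{\gamma,k_2}\!\left(N|z_2|^2\right)\,(1+o(1)).$$ Here $G(\cdot)$ is the Barnes $G$-function, and $F_{\gamma,k}(x)=\mathbb P(\lambda_{\max}<x)$ is the distribution function of the largest eigenvalue of the Laguerre unitary ensemble of size $k$ with real parameter $\gamma-k$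 (that is, with $\gamma$ degrees of freedom), whose $k$ eigenvalues have joint density on $[0,\infty)^{k}$ proportional to $\prod_{j=1}^{k}t_j^{\gamma-k}e^{-t_j}\prod_{1\le i<j\le k}(t_j-t_i)^2$; for $k=0$, $F_{\gamma,0}=1$. For each $N\ge1$ the right-hand side without the factor $1+o(1)$, defined for $u_2\ne0$, extends to a continuous function of $u_2\in\mathbb C$, and at $u_2=0$ it is understood as the value of this extension. -/

import Mathlib

open Real Filter MeasureTheory
open scoped Topology

/-- The standard complex normal distribution `𝒩_ℂ(0, 1)` (mean `0`, `𝔼|g|² = 1`), with density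
`π⁻¹ exp(-|z|²)` with respect to Lebesgue measure on `ℂ`. -/
noncomputable def stdComplexNormal : Measure ℂ :=
  volume.withDensity fun z => ENNReal.ofReal (π⁻¹ * Real.exp (-‖z‖ ^ 2))

/-- The law of the complex Ginibre matrix `G_N = N^{-1/2} G`, where `G` is an `N × N` matrix with
i.i.d. standard complex normal entries; a matrix is represented by the array of its entries. -/
noncomputable def ginibre (N : ℕ) : Measure (Fin N → Fin N → ℂ) :=
  (Measure.pi fun _ : Fin N => Measure.pi fun _ : Fin N => stdComplexNormal).map
    fun X => (((√(N : ℝ))⁻¹ : ℝ) : ℂ) • X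

/-- The random variable `|det(G - z₁)|^{2 k₁} |det(G - z₂)|^{2 k₂}`, with real `k₁` and
integer `k₂`, of the matrix `G` with the given array of entries. -/
noncomputable def charPolyProduct {N : ℕ} (k₁ : ℝ) (k₂ : ℕ) (z₁ z₂ : ℂ)
    (G : Fin N → Fin N → ℂ) : ℝ :=
  ‖(Matrix.of G - z₁ • (1 : Matrix (Fin N) (Fin N) ℂ)).det‖ ^ (2 * k₁) *
    ‖(Matrix.of G - z₂ • (1 : Matrix (Fin N) (Fin N) ℂ)).det‖ ^ (2 * k₂)

/-- `𝔼(|det(G_N - z₁)|^{2 k₁} |det(G_N - z₂)|^{2 k₂})` for a complex Ginibre matrix `G_N`. -/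
noncomputable def twoChargeCorrelator (N : ℕ) (k₁ : ℝ) (k₂ : ℕ) (z₁ z₂ : ℂ) : ℝ :=
  ∫ G, charPolyProduct k₁ k₂ z₁ z₂ G ∂(ginibre N)

/-- The unnormalised eigenvalue density `∏ t_j^α e^{-t_j} ∏_{i<j} (t_j - t_i)²` of the Laguerre
unitary ensemble of size `k` with real parameter `α`. -/
noncomputable def lueWeight (k : ℕ) (α : ℝ) (t : Fin k → ℝ) : ℝ :=
  (∏ i, t i ^ α * Real.exp (-t i)) * (∏ i, ∏ j ∈ Finset.Ioi i, (t j - t i)) ^ 2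

/-- The unnormalised eigenvalue measure of the Laguerre unitary ensemble on `[0, ∞)^k`. -/
noncomputable def lueMeasure (k : ℕ) (α : ℝ) : Measure (Fin k → ℝ) :=
  (volume.restrict {t | ∀ i, 0 ≤ t i}).withDensity fun t => ENNReal.ofReal (lueWeight k α t)

/-- The joint law of the eigenvalues of the Laguerre unitary ensemble `LUE_{k,p}` of size `k` with
`p` degrees of freedom, that is, with parameter `α = p - k`; here `p` may be any real number with
`p > k - 1`. -/
noncomputable def lueLaw (k : ℕ) (p : ℝ) : Measure (Fin k → ℝ) :=
  (lueMeasure k (p - k) Set.univ)⁻¹ • lueMeasure k (p - k)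

/-- `F_{p,k}(x) = ℙ(λ_max < x)`, the distribution function of the largest eigenvalue
of `LUE_{k,p}`. -/
noncomputable def lueMaxCDF (p : ℝ) (k : ℕ) (x : ℝ) : ℝ :=
  (lueLaw k p).real {t | ∀ i, t i < x}

/-- The Barnes `G`-function on the real line, by its Weierstrass product
`G(1 + z) = (2π)^{z/2} e^{-z(z+1)/2 - γ z²/2} ∏_{k ≥ 1} (1 + z/k)^k e^{-z + z²/(2k)}`,
where `γ` is the Euler–Mascheroni constant. -/
noncomputable def barnesG (x : ℝ) : ℝ :=
  (2 * π) ^ ((x - 1) / 2) *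
    Real.exp (-((x - 1) * x) / 2 - Real.eulerMascheroniConstant * (x - 1) ^ 2 / 2) *
    ∏' k : ℕ, ((1 + (x - 1) / (k + 1 : ℝ)) ^ (k + 1) *
      Real.exp (-(x - 1) + (x - 1) ^ 2 / (2 * (k + 1 : ℝ))))

/-- The leading asymptotic expression for the correlator of two charges at distinct points
`z₁ ≠ z₂`. -/
noncomputable def twoChargeAsymptotic (N : ℕ) (k₁ : ℝ) (k₂ : ℕ) (z₁ z₂ : ℂ) : ℝ :=
  Real.exp (k₁ * N * (‖z₁‖ ^ 2 - 1) + k₂ * N * (‖z₂‖ ^ 2 - 1) +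
      k₁ ^ 2 / 2 * Real.log N + (k₂ : ℝ) ^ 2 / 2 * Real.log N) *
    Real.exp (-2 * k₁ * k₂ * Real.log ‖z₂ - z₁‖) *
    ((2 * π) ^ ((k₁ + k₂) / 2) / (barnesG (1 + k₁) * barnesG (1 + k₂))) *
    lueMaxCDF k₁ k₂ (N * ‖z₂ - z₁‖ ^ 2)

/-! After rescaling by `√N` the two charges sit at `0` and at a fixed `u`, and the correlator is
exactly computable for every `N`. The product of characteristic polynomials depends only on the
spectrum, so Ginibre's eigenvalue density turns it into an `N`-fold integral of `∏ |x i|^(2γ) |x i -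
u|^(2k)` against a squared Vandermonde. Andréief's identity makes this a Gram determinant of the
functions `(z - u)^(k + a)`, `a < N`, in the rotation-invariant weight `|z|^(2γ)`.

Monomials are orthogonal for that weight, so the Gram matrix of all the powers `(z - u)^a`, `a < k +
N`, is (Pascal) × (diagonal) × (Pascal)ᴴ, with an explicit inverse. The required `N × N` determinant
is a corner minor, and Jacobi's complementary minor identity exchanges it for a `k × k` minor of the
inverse (`det_gram_shifted_monomial`). From then on `N` enters the determinant only as the length of
a sum.

Row operations with generalised binomial coefficients turn the entries of the `k × k` matrix into
Beta integrals against a truncated exponential series (`det_dualKernel`,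
`sum_choose_mul_pow_div_Gamma`). As `N → ∞` the series becomes `exp (x s)`, with `x = |u|^2`.
Andréief read backwards and the substitution `s = 1 - t / x` identify the limiting determinant with
the LUE distribution function times `x^(-γk) exp (k x)` and a constant
(`det_limitKernel_eq_lueMaxCDF`). This determinant is continuous and positive also at `x = 0`, so it
supplies the extension to colliding charges. The remaining prefactor is a product of Gamma values,
whose asymptotics come from the Weierstrass product of the Barnes function and Stirling's formula
(`tendsto_correlator_const`).

Ginibre's density is proved here by induction on the size. An entry of the matrix is traded for an
eigenvalue `l` through a rational function of degree `n + 1`, the first column is traded for the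
eigenvector `(1, v)`, and the deflated `n × n` matrix is again Gaussian, now with the additional
weight `|det (l - M)|^2` (`lintegral_deflation`, `lintegral_gaussianWeight_deflation`). This uses
only one-variable and linear changes of variables. All constants independent of the test function
are fixed at the end by testing on the constant `1`. -/

open scoped ENNReal

/-! ### Change of variables under rational functions of one complex variable. -/

section AreaFormula

/-- A countable disjoint measurable cover of a set on which a map has nonvanishing strict
derivative, by sets on which the map is injective. -/
lemma exists_disjoint_injOn_cover {f f' : ℂ → ℂ} {S : Set ℂ} (hS : MeasurableSet S)
    (hf : ∀ x ∈ S, HasStrictDerivAt f (f' x) x) (hf0 : ∀ x ∈ S, f' x ≠ 0) :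
    ∃ A : ℕ → Set ℂ, (∀ i, MeasurableSet (A i)) ∧ Pairwise (Function.onFun Disjoint A) ∧
      (⋃ i, A i) = S ∧ ∀ i, Set.InjOn f (A i) := by
  classical
  have key : ∀ x : ℂ, ∃ U : Set ℂ, IsOpen U ∧ (x ∈ S → x ∈ U) ∧ Set.InjOn f U := by
    intro x
    by_cases hx : x ∈ S
    · have h := (hf x hx).hasStrictFDerivAt_equiv (hf0 x hx)
      exact ⟨_, h.toOpenPartialHomeomorph.open_source, fun _ => h.mem_toOpenPartialHomeomorph_source,
        h.toOpenPartialHomeomorph.injOn⟩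
    · exact ⟨∅, isOpen_empty, fun h => (hx h).elim, Set.injOn_empty _⟩
  choose U hUo hUm hUi using key
  obtain ⟨t, -, htc, ht⟩ := TopologicalSpace.countable_cover_nhdsWithin (s := S) (f := U)
    (fun x hx => mem_nhdsWithin_of_mem_nhds ((hUo x).mem_nhds (hUm x hx)))
  obtain ⟨V, hV, hVi, hVo⟩ : ∃ V : ℕ → Set ℂ, S ⊆ ⋃ i, V i ∧ (∀ i, Set.InjOn f (V i)) ∧
      ∀ i, IsOpen (V i) := by
    rcases t.eq_empty_or_nonempty with rfl | hne
    · exact ⟨fun _ => ∅, by simpa using ht, fun _ => Set.injOn_empty _, fun _ => isOpen_empty⟩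
    · obtain ⟨u, rfl⟩ := htc.exists_eq_range hne
      exact ⟨fun i => U (u i), by simpa using ht, fun i => hUi _, fun i => hUo _⟩
  refine ⟨fun i => disjointed V i ∩ S, fun i => ?_, ?_, ?_, fun i => ?_⟩
  · exact (MeasurableSet.disjointed (fun i => (hVo i).measurableSet) i).inter hS
  · intro i j hij
    exact (disjoint_disjointed V hij).mono Set.inter_subset_left Set.inter_subset_left
  · rw [← Set.iUnion_inter, iUnion_disjointed]
    exact Set.inter_eq_right.2 hV
  · exact (hVi i).mono (Set.inter_subset_left.trans (disjointed_subset V i))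

lemma abs_det_restrictScalars_smulRight (c : ℂ) :
    ENNReal.ofReal |(((ContinuousLinearMap.toSpanSingleton ℂ c : ℂ →L[ℂ] ℂ)).restrictScalars ℝ).det|
      = ‖c‖ₑ ^ 2 := by
  have : ((ContinuousLinearMap.toSpanSingleton ℂ c : ℂ →L[ℂ] ℂ).restrictScalars ℝ).det
      = ‖c‖ ^ 2 := by
    rw [ContinuousLinearMap.det]
    have h := LinearMap.det_restrictScalars (R := ℝ) (S := ℂ) (A := ℂ) (f :=
      (ContinuousLinearMap.toSpanSingleton ℂ c : ℂ →L[ℂ] ℂ).toLinearMap)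
    have h2 : LinearMap.det (ContinuousLinearMap.toSpanSingleton ℂ c : ℂ →L[ℂ] ℂ).toLinearMap = c := by
      rw [LinearMap.det_ring]; simp
    rw [h2] at h
    rw [← Complex.normSq_eq_norm_sq, ← Algebra.norm_complex_apply, ← h]
    rfl
  rw [this, abs_of_nonneg (by positivity), ENNReal.ofReal_pow (norm_nonneg _), ofReal_norm]

/-- Area formula with constant multiplicity `m` for a holomorphic map of one variable. -/
lemma lintegral_comp_of_card_fiber {f f' : ℂ → ℂ} {S : Set ℂ} (hS : MeasurableSet S)
    (hf : ∀ x ∈ S, HasStrictDerivAt f (f' x) x) (hf0 : ∀ x ∈ S, f' x ≠ 0) (m : ℕ)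
    (hm : ∀ᵐ a : ℂ, ∃ F : Finset ℂ, F.card = m ∧ ∀ x, x ∈ F ↔ x ∈ S ∧ f x = a)
    {g : ℂ → ℝ≥0∞} (hg : Measurable g) :
    ∫⁻ x in S, ‖f' x‖ₑ ^ 2 * g (f x) = m * ∫⁻ a, g a := by
  classical
  obtain ⟨A, hAm, hAd, hAu, hAi⟩ := exists_disjoint_injOn_cover hS hf hf0
  have hd : ∀ i, ∀ x ∈ A i, HasFDerivWithinAt f
      ((ContinuousLinearMap.toSpanSingleton ℂ (f' x) : ℂ →L[ℂ] ℂ).restrictScalars ℝ) (A i) x := by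
    intro i x hx
    have hxS : x ∈ S := hAu ▸ Set.mem_iUnion_of_mem i hx
    exact ((hf x hxS).hasDerivAt.hasFDerivAt.restrictScalars ℝ).hasFDerivWithinAt
  have him : ∀ i, MeasurableSet (f '' A i) := fun i =>
    measurable_image_of_fderivWithin (hAm i) (hd i) (hAi i)
  have h1 : ∫⁻ x in S, ‖f' x‖ₑ ^ 2 * g (f x) = ∑' i, ∫⁻ a in f '' A i, g a := by
    rw [← hAu, lintegral_iUnion hAm hAd]
    refine tsum_congr fun i => ?_
    rw [lintegral_image_eq_lintegral_abs_det_fderiv_mul volume (hAm i) (hd i) (hAi i)]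
    simp_rw [abs_det_restrictScalars_smulRight]
  have h2 : ∀ i, ∫⁻ a in f '' A i, g a = ∫⁻ a, (f '' A i).indicator g a := fun i =>
    (lintegral_indicator (him i) g).symm
  rw [h1]
  simp_rw [h2]
  rw [← lintegral_tsum (fun i => (hg.indicator (him i)).aemeasurable), ← lintegral_const_mul _ hg]
  refine lintegral_congr_ae ?_
  filter_upwards [hm] with a ha
  obtain ⟨F, hFc, hF⟩ := ha
  have h3 : ∀ i, (f '' A i).indicator g a = ∑ x ∈ F, (A i).indicator (fun _ => g a) x := by
    intro i
    by_cases h : a ∈ f '' A i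
    · obtain ⟨y, hy, rfl⟩ := h
      have hyS : y ∈ S := hAu ▸ Set.mem_iUnion_of_mem i hy
      rw [Set.indicator_of_mem (Set.mem_image_of_mem f hy), Finset.sum_eq_single y]
      · rw [Set.indicator_of_mem hy]
      · intro z hz hzy
        refine Set.indicator_of_notMem (fun hzA => hzy ?_) _
        exact hAi i hzA hy ((hF z).1 hz).2
      · intro h; exact (h ((hF y).2 ⟨hyS, rfl⟩)).elim
    · rw [Set.indicator_of_notMem h, Finset.sum_eq_zero]
      intro z hz
      refine Set.indicator_of_notMem (fun hzA => h ⟨z, hzA, ((hF z).1 hz).2⟩) _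
  simp_rw [h3]
  rw [Summable.tsum_finsetSum (fun _ _ => ENNReal.summable)]
  have h4 : ∀ x ∈ F, ∑' i, (A i).indicator (fun _ => g a) x = g a := by
    intro x hx
    have hxS : x ∈ ⋃ i, A i := hAu ▸ ((hF x).1 hx).1
    obtain ⟨i, hi⟩ := Set.mem_iUnion.1 hxS
    rw [tsum_eq_single i, Set.indicator_of_mem hi]
    intro j hj
    exact Set.indicator_of_notMem (fun h => Set.disjoint_left.1 (hAd hj) h hi) _
  rw [Finset.sum_congr rfl h4, Finset.sum_const, hFc, nsmul_eq_mul]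

-- The fibre over `a` is the root set of the monic polynomial `P - a Q`, because `P` and `Q` have no
-- common root. At a double root the Wronskian `P' Q - P Q'` vanishes. The Wronskian is not zero, so
-- only its finitely many roots produce exceptional values `a`.
open Polynomial in
lemma ae_card_fiber_ratio {P Q : ℂ[X]} (hP : P.Monic) (hQ : Q.Monic)
    (hdeg : P.natDegree = Q.natDegree + 1) (hcop : IsCoprime P Q) :
    ∃ E : Finset ℂ, ∀ a ∉ E, (P - C a * Q).Separable ∧
      ∃ F : Finset ℂ, F.card = P.natDegree ∧
      ∀ x, x ∈ F ↔ (Q.eval x ≠ 0 ∧ (derivative P * Q - P * derivative Q).eval x ≠ 0) ∧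
        P.eval x / Q.eval x = a := by
  classical
  set W := derivative P * Q - P * derivative Q with hW
  have hW0 : W ≠ 0 := by
    intro h
    -- The two products contribute `deg P = deg Q + 1` and `deg Q`, so the top coefficient is their
    -- difference.
    have h1 : W.coeff (2 * Q.natDegree) = 1 := by
      have e1 : (derivative P * Q).coeff (Q.natDegree + Q.natDegree)
          = (derivative P).coeff Q.natDegree * Q.coeff Q.natDegree :=
        coeff_mul_add_eq_of_natDegree_le ((natDegree_derivative_le P).trans (by omega)) le_rfl
      have e2 : (P * derivative Q).coeff (Q.natDegree + Q.natDegree) = Q.natDegree := by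
        rcases Nat.eq_zero_or_pos Q.natDegree with h0 | h0
        · have : Q = 1 := hQ.natDegree_eq_zero.1 h0
          simp [this]
        · have := coeff_mul_add_eq_of_natDegree_le (f := P) (g := derivative Q)
            (df := Q.natDegree + 1) (dg := Q.natDegree - 1) hdeg.le (natDegree_derivative_le Q)
          rw [show Q.natDegree + 1 + (Q.natDegree - 1) = Q.natDegree + Q.natDegree by omega] at this
          rw [this, ← hdeg, coeff_natDegree, hP.leadingCoeff, coeff_derivative,
            Nat.sub_add_cancel h0, coeff_natDegree, hQ.leadingCoeff]
          push_cast [Nat.cast_sub h0]; ring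
      rw [hW, two_mul, coeff_sub, e1, e2, coeff_derivative, ← hdeg, coeff_natDegree,
        coeff_natDegree, hP.leadingCoeff, hQ.leadingCoeff]
      ring
    rw [h] at h1; simp at h1
  have hlt : Q.degree < P.degree := by
    rw [degree_eq_natDegree hP.ne_zero, degree_eq_natDegree hQ.ne_zero, hdeg]
    exact_mod_cast Nat.lt_succ_self _
  -- The exceptional values are the critical values of `P / Q`.
  refine ⟨W.roots.toFinset.image (fun x => P.eval x / Q.eval x), fun a ha => ?_⟩
  have hdl : (C a * Q).degree < P.degree :=
    (degree_mul_le _ _).trans_lt ((add_le_add_left degree_C_le _).trans_lt (by simpa using hlt))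
  have hmon : (P - C a * Q).Monic := hP.sub_of_left hdl
  have hnd : (P - C a * Q).natDegree = P.natDegree := by
    apply natDegree_eq_of_degree_eq
    exact degree_sub_eq_left_of_degree_lt hdl
  have hQne : ∀ x, (P - C a * Q).eval x = 0 → Q.eval x ≠ 0 := by
    intro x hx hq
    have hp : P.eval x = 0 := by simpa [hq] using hx
    obtain ⟨u, v, huv⟩ := hcop
    have := congrArg (eval x) huv
    simp [hp, hq] at this
  have hWne : ∀ x, (P - C a * Q).eval x = 0 → W.eval x ≠ 0 := by
    intro x hx hw
    apply ha
    simp only [Finset.mem_image, Multiset.mem_toFinset, mem_roots hW0, IsRoot]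
    refine ⟨x, hw, ?_⟩
    rw [div_eq_iff (hQne x hx)]
    simpa [sub_eq_zero] using hx
  have hder : ∀ x, (P - C a * Q).eval x = 0 →
      (derivative (P - C a * Q)).eval x * Q.eval x = W.eval x := by
    intro x hx
    have : P.eval x = a * Q.eval x := by simpa [sub_eq_zero] using hx
    simp only [hW, derivative_sub, derivative_mul, derivative_C, eval_sub, eval_mul,
      eval_C, this, zero_mul, zero_add]
    ring
  have hsep : (P - C a * Q).Separable := by
    rw [Polynomial.separable_def, isCoprime_iff_aeval_ne_zero_of_isAlgClosed ℂ ℂ]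
    intro x
    simp only [coe_aeval_eq_eval]
    by_contra! h
    exact hWne x h.1 (by rw [← hder x h.1, h.2, zero_mul])
  refine ⟨hsep, (P - C a * Q).roots.toFinset, ?_, fun x => ?_⟩
  · rw [Multiset.toFinset_card_of_nodup (nodup_roots hsep), ← hnd]
    exact (IsAlgClosed.splits _).natDegree_eq_card_roots.symm
  · rw [Multiset.mem_toFinset, mem_roots hmon.ne_zero, IsRoot]
    constructor
    · intro h
      refine ⟨⟨hQne x h, hWne x h⟩, ?_⟩
      rw [div_eq_iff (hQne x h)]
      simpa [sub_eq_zero] using h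
    · rintro ⟨⟨h1, -⟩, h2⟩
      rw [div_eq_iff h1] at h2
      simp [h2]

open Polynomial in
/-- A rational function `P / Q` of degree `deg P = deg Q + 1` covers the plane `deg P` times. -/
lemma lintegral_comp_ratio {P Q : ℂ[X]} (hP : P.Monic) (hQ : Q.Monic)
    (hdeg : P.natDegree = Q.natDegree + 1) (hcop : IsCoprime P Q) {g : ℂ → ℝ≥0∞}
    (hg : Measurable g) :
    ∫⁻ x, ‖(derivative P * Q - P * derivative Q).eval x / Q.eval x ^ 2‖ₑ ^ 2 *
      g (P.eval x / Q.eval x) = P.natDegree * ∫⁻ a, g a := by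
  classical
  obtain ⟨E, hE⟩ := ae_card_fiber_ratio hP hQ hdeg hcop
  set W := derivative P * Q - P * derivative Q with hW
  set S : Set ℂ := {x | Q.eval x ≠ 0 ∧ W.eval x ≠ 0} with hS
  have hSm : MeasurableSet S :=
    ((isOpen_compl_singleton.preimage Q.continuous).inter
      (isOpen_compl_singleton.preimage W.continuous)).measurableSet
  have h := lintegral_comp_of_card_fiber (f := fun x => P.eval x / Q.eval x)
    (f' := fun x => W.eval x / Q.eval x ^ 2) hSm
    (fun x hx => by
      have := (P.hasStrictDerivAt x).fun_div (Q.hasStrictDerivAt x) hx.1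
      convert! this using 1
      simp [hW])
    (fun x hx => div_ne_zero hx.2 (pow_ne_zero _ hx.1)) P.natDegree
    (by
      filter_upwards [E.finite_toSet.countable.ae_notMem volume] with a ha
      exact (hE a ha).2) hg
  rw [← h]
  symm
  -- Outside `S` the Jacobian factor is zero: either the Wronskian vanishes, or `Q` does and
  -- division by zero returns `0`.
  refine setLIntegral_eq_of_support_subset ?_
  intro x hx
  by_contra hxS
  apply hx
  have : W.eval x / Q.eval x ^ 2 = 0 := by
    by_contra h0
    rw [div_eq_zero_iff, not_or] at h0
    exact hxS ⟨fun h => h0.2 (by simp [h]), h0.1⟩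
  simp [this]

end AreaFormula

/-! ### Bordered matrices and their characteristic polynomials. -/

section BorderedMatrix

open Matrix Polynomial

/-- The bijection splitting off the first index. -/
def finSuccSumEquiv (n : ℕ) : Fin (n + 1) ≃ Unit ⊕ Fin n where
  toFun := Fin.cases (Sum.inl ()) Sum.inr
  invFun := Sum.elim (fun _ => 0) Fin.succ
  left_inv i := by cases i using Fin.cases <;> rfl
  right_inv i := by rcases i with _ | _ <;> rfl

/-- The matrix with corner `a`, first row `r`, first column `b` and remaining block `D`. -/
def bordered {R : Type*} {n : ℕ} (a : R) (r b : Fin n → R) (D : Matrix (Fin n) (Fin n) R) :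
    Matrix (Fin (n + 1)) (Fin (n + 1)) R :=
  (fromBlocks (of fun _ _ => a) (replicateRow Unit r) (replicateCol Unit b) D).submatrix
    (finSuccSumEquiv n) (finSuccSumEquiv n)

variable {n : ℕ}

/-- The array of entries of the bordered matrix. -/
def borderedArray {R : Type*} {n : ℕ} (a : R) (r b : Fin n → R) (D : Fin n → Fin n → R) :
    Fin (n + 1) → Fin (n + 1) → R :=
  Fin.cons (Fin.cons a r) (fun i => Fin.cons (b i) (D i))

lemma of_borderedArray {R : Type*} (a : R) (r b : Fin n → R) (D : Fin n → Fin n → R) :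
    of (borderedArray a r b D) = bordered a r b (of D) := by
  refine Matrix.ext fun i j => ?_
  cases i using Fin.cases <;> cases j using Fin.cases <;> rfl

/-- A column operation with the adjugate clears the first column below the corner at the price of a
factor `det D`, which is cancelled. The hypothesis on `det D` costs nothing for characteristic
matrices, whose determinant is monic. -/
lemma det_bordered {R : Type*} [CommRing R] [IsDomain R] (a : R) (r b : Fin n → R)
    (D : Matrix (Fin n) (Fin n) R) (hD : D.det ≠ 0) :
    (bordered a r b D).det = a * D.det - r ⬝ᵥ D.adjugate *ᵥ b := by
  rw [bordered, det_submatrix_equiv_self]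
  refine mul_right_cancel₀ hD ?_
  have h1 : (fromBlocks (of fun _ _ : Unit => D.det) 0
      (-(D.adjugate * replicateCol Unit b)) (1 : Matrix (Fin n) (Fin n) R)).det = D.det := by
    rw [det_fromBlocks_zero₁₂]; simp
  rw [← h1, ← det_mul, fromBlocks_multiply, h1]
  have h2 : replicateCol Unit b * (of fun _ _ : Unit => D.det) +
      D * -(D.adjugate * replicateCol Unit b) = 0 := by
    rw [Matrix.mul_neg, ← Matrix.mul_assoc, mul_adjugate]
    ext i j
    simp [Matrix.mul_apply, mul_comm]
  rw [h2]
  simp only [Matrix.mul_zero, Matrix.mul_one, zero_add]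
  rw [det_fromBlocks_zero₂₁, det_unique]
  congr 1
  simp [Matrix.mul_apply, dotProduct, mulVec, sub_eq_add_neg]

lemma charmatrix_bordered {R : Type*} [CommRing R] (a : R) (r b : Fin n → R)
    (D : Matrix (Fin n) (Fin n) R) :
    charmatrix (bordered a r b D) =
      bordered (X - C a) (fun i => - C (r i)) (fun i => - C (b i)) (charmatrix D) := by
  refine Matrix.ext fun i j => ?_
  cases i using Fin.cases <;> cases j using Fin.cases <;>
    simp [bordered, charmatrix_apply, finSuccSumEquiv, Matrix.diagonal_apply, Fin.succ_ne_zero,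
      (Fin.succ_ne_zero _).symm]

lemma charpoly_bordered {R : Type*} [CommRing R] [IsDomain R] (a : R) (r b : Fin n → R)
    (D : Matrix (Fin n) (Fin n) R) :
    (bordered a r b D).charpoly = (X - C a) * D.charpoly -
      (fun i => C (r i)) ⬝ᵥ (charmatrix D).adjugate *ᵥ (fun i => C (b i)) := by
  rw [Matrix.charpoly, charmatrix_bordered, det_bordered _ _ _ _ (D.charpoly_monic.ne_zero)]
  have h : (fun i => -C (r i)) ⬝ᵥ (charmatrix D).adjugate *ᵥ (fun i => -C (b i)) =
      (fun i => C (r i)) ⬝ᵥ (charmatrix D).adjugate *ᵥ (fun i => C (b i)) := by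
    rw [show (fun i => -C (r i)) = -(fun i => C (r i)) from rfl,
      show (fun i => -C (b i)) = -(fun i => C (b i)) from rfl, mulVec_neg, neg_dotProduct_neg]
  rw [h]; rfl

/-- Since the corner enters affinely, `l` is an eigenvalue exactly when `a` solves `P l = a * Q l`.
This is how the rational function `P / Q` arises, with `Q` the characteristic polynomial of the
block. -/
lemma charpoly_bordered_eq_sub {R : Type*} [CommRing R] [IsDomain R] (a : R) (r b : Fin n → R)
    (D : Matrix (Fin n) (Fin n) R) :
    (bordered a r b D).charpoly = (bordered 0 r b D).charpoly - C a * D.charpoly := by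
  rw [charpoly_bordered, charpoly_bordered]; simp; ring

lemma eval_adjugate_charmatrix {R : Type*} [CommRing R] (D : Matrix (Fin n) (Fin n) R) (l : R) :
    (evalRingHom l).mapMatrix (charmatrix D).adjugate = (scalar (Fin n) l - D).adjugate := by
  rw [RingHom.map_adjugate]
  congr 1
  ext i j
  simp [charmatrix_apply, Matrix.diagonal_apply]
  split_ifs <;> simp

lemma eval_charpoly_bordered {R : Type*} [CommRing R] [IsDomain R] (a : R) (r b : Fin n → R)
    (D : Matrix (Fin n) (Fin n) R) (l : R) :
    (bordered a r b D).charpoly.eval l = (l - a) * D.charpoly.eval l -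
      r ⬝ᵥ (scalar (Fin n) l - D).adjugate *ᵥ b := by
  rw [charpoly_bordered, ← eval_adjugate_charmatrix]
  simp [dotProduct, mulVec, eval_finsetSum]

/-- Differentiate `(X - D) adj (X - D) = χ` at `l`. If the adjugate vanished there, `(l - D)` times
a matrix would equal the scalar `χ'(l)`; taking determinants gives `χ'(l) = 0`, so the root would
not be simple. -/
lemma adjugate_ne_zero_of_separable {K : Type*} [Field K] (D : Matrix (Fin n) (Fin n) K)
    (hD : D.charpoly.Separable) {l : K} (hl : D.charpoly.eval l = 0) :
    (scalar (Fin n) l - D).adjugate ≠ 0 := by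
  intro h0
  have hn : n ≠ 0 := by
    rintro rfl
    simp [charpoly_isEmpty] at hl
  set E := (charmatrix D).adjugate with hE
  have hE0 : ∀ i j, (E i j).eval l = 0 := by
    intro i j
    have := congrFun₂ (eval_adjugate_charmatrix D l) i j
    rw [h0] at this
    simpa using this
  have hmul : ∀ i j, ∑ k, charmatrix D i k * E k j = (D.charpoly • (1 : Matrix (Fin n) (Fin n) K[X])) i j := by
    intro i j
    rw [← Matrix.mul_apply, hE, mul_adjugate]; rfl
  have hmat : (scalar (Fin n) l - D) * (of fun i j => (derivative (E i j)).eval l) =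
      ((derivative D.charpoly).eval l) • (1 : Matrix (Fin n) (Fin n) K) := by
    ext i j
    have := congrArg (fun p => (derivative p).eval l) (hmul i j)
    simp only [derivative_sum, derivative_mul, eval_finsetSum, eval_add, eval_mul, hE0,
      mul_zero, zero_add] at this
    rw [Matrix.mul_apply]
    calc _ = ∑ k, eval l (charmatrix D i k) * eval l (derivative (E k j)) := by
            refine Finset.sum_congr rfl fun k _ => ?_
            congr 1
            simp [charmatrix_apply, Matrix.diagonal_apply]
            split_ifs <;> simp
      _ = _ := by
            rw [this]
            by_cases hij : i = j <;> simp [hij]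
  have hdet := congrArg det hmat
  rw [det_mul, ← eval_charpoly, hl, zero_mul, det_smul, det_one, mul_one] at hdet
  have hd0 : (derivative D.charpoly).eval l = 0 := by
    simpa [hn] using hdet.symm
  obtain ⟨u, v, huv⟩ := hD
  have := congrArg (eval l) huv
  simp [hl, hd0] at this

end BorderedMatrix

/-! ### Almost every matrix has simple spectrum. -/

section Generic

open Matrix Polynomial

variable {n : ℕ}

instance sFinite_volume_prod_volume (n : ℕ) :
    SFinite ((volume : Measure (Fin n → Fin n → ℂ)).prod (volume : Measure (Fin n → ℂ))) :=
  Measure.prod.instSFinite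

/-- The volume-preserving assembly of a matrix from its four blocks. -/
lemma measurePreserving_bordered (n : ℕ) :
    MeasurePreserving (β := Fin (n + 1) → Fin (n + 1) → ℂ)
      (fun p : ((Fin n → Fin n → ℂ) × (Fin n → ℂ)) × ((Fin n → ℂ) × ℂ) =>
        borderedArray p.2.2 p.2.1 p.1.2 p.1.1) volume volume := by
  have h1 := (volume_preserving_piFinSuccAbove (fun _ : Fin (n + 1) => ℂ) 0).symm
  have h2 := (volume_preserving_piFinSuccAbove (fun _ : Fin (n + 1) => Fin (n + 1) → ℂ) 0).symm
  have h3 : MeasurePreserving (fun (x : Fin n → ℂ × (Fin n → ℂ)) (i : Fin n) =>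
      (MeasurableEquiv.piFinSuccAbove (fun _ : Fin (n + 1) => ℂ) 0).symm (x i)) :=
    measurePreserving_pi _ _ (fun _ => h1)
  have h4 := (volume_measurePreserving_arrowProdEquivProdArrow ℂ (Fin n → ℂ) (Fin n)).symm
  have hA : MeasurePreserving (β := Fin (n + 1) → ℂ) (fun p : (Fin n → ℂ) × ℂ =>
      (MeasurableEquiv.piFinSuccAbove (fun _ : Fin (n + 1) => ℂ) 0).symm (p.2, p.1))
      ((volume : Measure (Fin n → ℂ)).prod (volume : Measure ℂ)) volume :=
    h1.comp Measure.measurePreserving_swap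
  have hB : MeasurePreserving (β := Fin n → Fin (n + 1) → ℂ)
      (fun (p : (Fin n → Fin n → ℂ) × (Fin n → ℂ)) (i : Fin n) =>
        (MeasurableEquiv.piFinSuccAbove (fun _ : Fin (n + 1) => ℂ) 0).symm (p.2 i, p.1 i))
      ((volume : Measure (Fin n → Fin n → ℂ)).prod (volume : Measure (Fin n → ℂ))) volume := (h3.comp h4).comp Measure.measurePreserving_swap
  have h6 := (h2.comp (hA.prod hB)).comp Measure.measurePreserving_swap
  have e : ∀ p : ((Fin n → Fin n → ℂ) × (Fin n → ℂ)) × ((Fin n → ℂ) × ℂ),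
      ((MeasurableEquiv.piFinSuccAbove (fun _ : Fin (n + 1) => Fin (n + 1) → ℂ) 0).symm ∘
        Prod.map (fun p : (Fin n → ℂ) × ℂ =>
          (MeasurableEquiv.piFinSuccAbove (fun _ : Fin (n + 1) => ℂ) 0).symm (p.2, p.1))
        fun (p : (Fin n → Fin n → ℂ) × (Fin n → ℂ)) (i : Fin n) =>
          (MeasurableEquiv.piFinSuccAbove (fun _ : Fin (n + 1) => ℂ) 0).symm (p.2 i, p.1 i)) p.swap
        = borderedArray p.2.2 p.2.1 p.1.2 p.1.1 := by
    intro p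
    ext i j
    cases i using Fin.cases <;> cases j using Fin.cases <;> rfl
  rw [← funext e]
  exact h6

lemma continuous_borderedArray :
    Continuous (fun p : ((Fin n → Fin n → ℂ) × (Fin n → ℂ)) × ((Fin n → ℂ) × ℂ) =>
      borderedArray p.2.2 p.2.1 p.1.2 p.1.1) := by
  refine continuous_pi fun i => continuous_pi fun j => ?_
  cases i using Fin.cases <;> cases j using Fin.cases <;>
    simp [borderedArray] <;> fun_prop

lemma lintegral_matrix_succ {G : (Fin (n + 1) → Fin (n + 1) → ℂ) → ℝ≥0∞} (hG : Measurable G) :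
    ∫⁻ M, G M = ∫⁻ D : Fin n → Fin n → ℂ, ∫⁻ b : Fin n → ℂ, ∫⁻ r : Fin n → ℂ, ∫⁻ a : ℂ,
      G (borderedArray a r b D) := by
  have hm := measurePreserving_bordered n
  simp only [Measure.volume_eq_prod] at hm
  have hGm := hG.comp hm.measurable
  have h1 := lintegral_prod (μ := (volume : Measure (Fin n → Fin n → ℂ)).prod
    (volume : Measure (Fin n → ℂ))) (ν := (volume : Measure (Fin n → ℂ)).prod (volume : Measure ℂ))
    _ hGm.aemeasurable
  rw [← hm.lintegral_comp hG]
  refine h1.trans ?_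
  rw [lintegral_prod _ hGm.lintegral_prod_right'.aemeasurable]
  refine lintegral_congr fun D => lintegral_congr fun b => ?_
  exact lintegral_prod _ (hGm.comp measurable_prodMk_left).aemeasurable

lemma ae_matrix_succ {p : (Fin (n + 1) → Fin (n + 1) → ℂ) → Prop} (hp : MeasurableSet {M | p M})
    (h : ∀ᵐ D : Fin n → Fin n → ℂ, ∀ᵐ b : Fin n → ℂ, ∀ᵐ r : Fin n → ℂ, ∀ᵐ a : ℂ,
      p (borderedArray a r b D)) : ∀ᵐ M, p M := by
  classical
  rw [ae_iff]
  have h1 := lintegral_indicator_one (μ := volume) hp.compl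
  have hG : Measurable ({M | p M}ᶜ.indicator (1 : (Fin (n + 1) → Fin (n + 1) → ℂ) → ℝ≥0∞)) :=
    measurable_one.indicator hp.compl
  change volume {M | p M}ᶜ = 0
  rw [← h1, lintegral_matrix_succ hG]
  rw [lintegral_congr_ae (g := fun _ => 0), lintegral_zero]
  filter_upwards [h] with D hD
  rw [lintegral_congr_ae (g := fun _ => 0), lintegral_zero]
  filter_upwards [hD] with b hb
  rw [lintegral_congr_ae (g := fun _ => 0), lintegral_zero]
  filter_upwards [hb] with r hr
  rw [lintegral_congr_ae (g := fun _ => 0), lintegral_zero]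
  filter_upwards [hr] with a ha
  exact Set.indicator_of_notMem (not_not_intro ha) _

lemma continuous_coeff_charpoly (i : ℕ) :
    Continuous fun M : Matrix (Fin n) (Fin n) ℂ => M.charpoly.coeff i := by
  have : (fun M : Matrix (Fin n) (Fin n) ℂ => M.charpoly.coeff i) = fun M =>
      MvPolynomial.eval (fun p : Fin n × Fin n => M p.1 p.2) ((charpoly.univ ℂ (Fin n)).coeff i) := by
    ext M
    exact (charpoly.univ_coeff_eval₂Hom (Fin n) (RingHom.id ℂ)
      (fun p : Fin n × Fin n => M p.1 p.2) i).symm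
  rw [this]
  exact MvPolynomial.continuous_eval _ |>.comp (by fun_prop)

lemma continuous_eval_derivative_charpoly :
    Continuous fun p : Matrix (Fin n) (Fin n) ℂ × ℂ => (derivative p.1.charpoly).eval p.2 := by
  have : (fun p : Matrix (Fin n) (Fin n) ℂ × ℂ => (derivative p.1.charpoly).eval p.2) =
      fun p : Matrix (Fin n) (Fin n) ℂ × ℂ =>
      ∑ i ∈ Finset.range (n + 1), (p.1.charpoly.coeff (i + 1) * (i + 1)) * p.2 ^ i := by
    ext p
    rw [eval_eq_sum_range' (n := n + 1)]
    · simp [coeff_derivative]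
    · exact (natDegree_derivative_le _).trans_lt (by simp)
  rw [this]
  refine continuous_finsetSum _ fun i _ => ?_
  exact (((continuous_coeff_charpoly (n := n) (i + 1)).comp continuous_fst).mul
    continuous_const).mul (continuous_snd.pow i)

lemma continuous_eval_charpoly :
    Continuous fun p : Matrix (Fin n) (Fin n) ℂ × ℂ => p.1.charpoly.eval p.2 := by
  simp_rw [eval_charpoly, scalar_apply]
  refine Continuous.matrix_det ?_
  exact (Continuous.matrix_diagonal (by fun_prop)).sub continuous_fst

/-- Separability is nonvanishing of the resultant of `χ` and `χ'`, taken with the fixed degrees `n`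
and `n - 1` so that it is continuous in the entries. It provides the measurability needed to apply
Tonelli to the null set. -/
lemma isOpen_separable_charpoly :
    IsOpen {M : Fin n → Fin n → ℂ | (of M).charpoly.Separable} := by
  have : {M : Fin n → Fin n → ℂ | (of M).charpoly.Separable} =
      (fun M : Matrix (Fin n) (Fin n) ℂ => resultant M.charpoly (derivative M.charpoly) n (n - 1)) ⁻¹'
        {0}ᶜ := by
    ext M
    have h := isUnit_resultant_iff_isCoprime (g := derivative (of M).charpoly) (of M).charpoly_monic
    rw [natDegree_derivative, charpoly_natDegree_eq_dim, Fintype.card_fin, isUnit_iff_ne_zero] at h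
    exact h.symm
  rw [this]
  refine isOpen_compl_singleton.preimage ?_
  unfold resultant
  refine Continuous.matrix_det (continuous_matrix fun i j => ?_)
  simp only [sylvester, of_apply, coeff_derivative]
  induction j using Fin.addCases <;> simp only [Fin.addCases_left, Fin.addCases_right] <;>
    split_ifs <;> first | exact continuous_const | skip
  · exact (continuous_coeff_charpoly _).mul continuous_const
  · exact continuous_coeff_charpoly _

lemma ae_dotProduct_ne_zero {v : Fin n → ℂ} (hv : v ≠ 0) : ∀ᵐ r : Fin n → ℂ, r ⬝ᵥ v ≠ 0 := by
  let L : (Fin n → ℂ) →ₗ[ℝ] ℂ :=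
    { toFun := fun r => r ⬝ᵥ v
      map_add' := fun _ _ => add_dotProduct _ _ _
      map_smul' := fun c r => smul_dotProduct c r v }
  have h := Measure.addHaar_submodule (volume : Measure (Fin n → ℂ)) (LinearMap.ker L) (by
    intro htop
    apply hv
    ext i
    have : Pi.single i (1 : ℂ) ∈ LinearMap.ker L := htop ▸ Submodule.mem_top
    have h2 : (Pi.single i (1 : ℂ) : Fin n → ℂ) ⬝ᵥ v = 0 := this
    simpa using h2)
  rw [ae_iff]
  simp only [ne_eq, not_not]
  exact h

lemma ae_mulVec_ne_zero {A : Matrix (Fin n) (Fin n) ℂ} (hA : A ≠ 0) :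
    ∀ᵐ b : Fin n → ℂ, A *ᵥ b ≠ 0 := by
  obtain ⟨i, hi⟩ : ∃ i, A i ≠ 0 := by
    by_contra! h
    exact hA (funext h)
  filter_upwards [ae_dotProduct_ne_zero hi] with b hb h
  apply hb
  rw [dotProduct_comm]
  exact congrFun h i

/-- At an eigenvalue `l` of `D` the bordered polynomial reduces to `-r · adj (l - D) b`. As the
adjugate is nonzero, this vanishes only for `b` or `r` in a proper subspace, and there are finitely
many `l`. -/
lemma ae_isCoprime_charpoly {D : Matrix (Fin n) (Fin n) ℂ} (hD : D.charpoly.Separable) :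
    ∀ᵐ b : Fin n → ℂ, ∀ᵐ r : Fin n → ℂ, IsCoprime (bordered 0 r b D).charpoly D.charpoly := by
  classical
  have h1 : ∀ᵐ b : Fin n → ℂ, ∀ l ∈ (D.charpoly.roots.toFinset : Set ℂ),
      (scalar (Fin n) l - D).adjugate *ᵥ b ≠ 0 := by
    rw [ae_ball_iff (Finset.countable_toSet _)]
    intro l hl
    refine ae_mulVec_ne_zero (adjugate_ne_zero_of_separable D hD ?_)
    simpa [D.charpoly_monic.ne_zero] using hl
  filter_upwards [h1] with b hb
  have h2 : ∀ᵐ r : Fin n → ℂ, ∀ l ∈ (D.charpoly.roots.toFinset : Set ℂ),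
      r ⬝ᵥ (scalar (Fin n) l - D).adjugate *ᵥ b ≠ 0 := by
    rw [ae_ball_iff (Finset.countable_toSet _)]
    intro l hl
    exact ae_dotProduct_ne_zero (hb l hl)
  filter_upwards [h2] with r hr
  rw [isCoprime_iff_aeval_ne_zero_of_isAlgClosed ℂ ℂ]
  intro l
  simp only [coe_aeval_eq_eval]
  by_contra! h
  have hl : l ∈ (D.charpoly.roots.toFinset : Set ℂ) := by
    simpa [D.charpoly_monic.ne_zero] using h.2
  have h3 := h.1
  rw [eval_charpoly_bordered, h.2] at h3
  exact hr l hl (by simpa using h3)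

/-- Induction on the size: for a generic block and generic borders the two polynomials are coprime,
and then all but finitely many corners give distinct eigenvalues. -/
lemma ae_separable_charpoly : ∀ n : ℕ, ∀ᵐ M : Fin n → Fin n → ℂ, (of M).charpoly.Separable
  | 0 => by
    refine Eventually.of_forall fun M => ?_
    rw [charpoly_isEmpty]
    exact separable_one
  | n + 1 => by
    refine ae_matrix_succ (isOpen_separable_charpoly (n := n + 1)).measurableSet ?_
    filter_upwards [ae_separable_charpoly n] with D hD
    filter_upwards [ae_isCoprime_charpoly hD] with b hb
    filter_upwards [hb] with r hr
    obtain ⟨E, hE⟩ := ae_card_fiber_ratio (bordered 0 r b (of D)).charpoly_monic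
      (of D).charpoly_monic (by simp) hr
    filter_upwards [E.finite_toSet.countable.ae_notMem volume] with a ha
    have := (hE a ha).1
    rwa [of_borderedArray, charpoly_bordered_eq_sub]

end Generic

/-! ### Splitting off one eigenvalue and its eigenvector. -/

section Deflation

open Matrix Polynomial

variable {n : ℕ}

lemma bordered_mul {R : Type*} [CommRing R] (a a' : R) (r b r' b' : Fin n → R)
    (D D' : Matrix (Fin n) (Fin n) R) :
    bordered a r b D * bordered a' r' b' D' =
      bordered (a * a' + r ⬝ᵥ b') (a • r' + r ᵥ* D') (a' • b + D *ᵥ b')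
        (vecMulVec b r' + D * D') := by
  rw [bordered, bordered, submatrix_mul_equiv, fromBlocks_multiply, bordered]
  congr 1
  congr 1 <;> ext i j <;>
    simp [Matrix.mul_apply, dotProduct, mulVec, vecMul, vecMulVec_apply, mul_comm]

lemma bordered_one {R : Type*} [CommRing R] :
    bordered (1 : R) 0 0 (1 : Matrix (Fin n) (Fin n) R) = 1 := by
  refine Matrix.ext fun i j => ?_
  cases i using Fin.cases <;> cases j using Fin.cases <;>
    simp [bordered, finSuccSumEquiv, Matrix.one_apply, Fin.succ_ne_zero, (Fin.succ_ne_zero _).symm]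

/-- The unipotent matrix whose first column is `(1, v)`. -/
def unipotentUnit {R : Type*} [CommRing R] (v : Fin n → R) :
    (Matrix (Fin (n + 1)) (Fin (n + 1)) R)ˣ where
  val := bordered 1 0 v 1
  inv := bordered 1 0 (-v) 1
  val_inv := by rw [bordered_mul, ← bordered_one]; simp
  inv_val := by rw [bordered_mul, ← bordered_one]; simp

/-- The right side is the general bordered matrix with eigenvector `(1, v)`: its corner and first
column are expressed through `l`, `v`, `r` and the lower block `D + v rᵀ`. These are the new
coordinates for integration. -/
lemma unipotent_conj {R : Type*} [CommRing R] (l : R) (r v : Fin n → R)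
    (D : Matrix (Fin n) (Fin n) R) :
    (unipotentUnit v).val * bordered l r 0 D * (unipotentUnit v)⁻¹.val =
      bordered (l - r ⬝ᵥ v) r ((scalar (Fin n) l - (D + vecMulVec v r)) *ᵥ v)
        (D + vecMulVec v r) := by
  change bordered 1 0 v 1 * bordered l r 0 D * bordered 1 0 (-v) 1 = _
  rw [bordered_mul, bordered_mul]
  congr 1
  · simp [sub_eq_add_neg]
  · simp
  · simp only [sub_mulVec, add_mulVec, mulVec_neg, Matrix.one_mulVec, Matrix.one_mul]
    ext i
    simp [scalar_apply]
    ring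
  · simp [add_comm]

lemma charpoly_bordered_zero {R : Type*} [CommRing R] [IsDomain R] (l : R) (r : Fin n → R)
    (D : Matrix (Fin n) (Fin n) R) :
    (bordered l r 0 D).charpoly = (X - C l) * D.charpoly := by
  rw [charpoly_bordered]
  have : (fun i => C ((0 : Fin n → R) i)) = (0 : Fin n → R[X]) := by ext; simp
  rw [this, mulVec_zero, dotProduct_zero, sub_zero]

lemma eval_deflated {K : Type*} [Field K] (l : K) (r v : Fin n → K) (D : Matrix (Fin n) (Fin n) K)
    (hl : D.charpoly.eval l ≠ 0) :
    (bordered 0 r ((scalar (Fin n) l - D) *ᵥ v) D).charpoly.eval l / D.charpoly.eval l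
      = l - r ⬝ᵥ v := by
  rw [eval_charpoly_bordered, mulVec_mulVec, adjugate_mul, ← eval_charpoly, smul_mulVec,
    one_mulVec, dotProduct_smul, div_eq_iff hl, smul_eq_mul]
  ring

/-- With corner `l - r · v` the bordered matrix is conjugate to a block triangular one, so its
characteristic polynomial is `(X - l)` times that of the deflated matrix. Differentiating at `l`
evaluates `P' - a Q'`, hence the Jacobian of `l ↦ P l / Q l`. -/
lemma eval_wronskian_deflated {K : Type*} [Field K] (l : K) (r v : Fin n → K)
    (D : Matrix (Fin n) (Fin n) K) (hl : D.charpoly.eval l ≠ 0) :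
    (derivative (bordered 0 r ((scalar (Fin n) l - D) *ᵥ v) D).charpoly * D.charpoly -
        (bordered 0 r ((scalar (Fin n) l - D) *ᵥ v) D).charpoly * derivative D.charpoly).eval l
      = (D - vecMulVec v r).charpoly.eval l * D.charpoly.eval l := by
  have h1 := eval_deflated l r v D hl
  set b := (scalar (Fin n) l - D) *ᵥ v with hb
  have h2 : (bordered (l - r ⬝ᵥ v) r b D).charpoly = (X - C l) * (D - vecMulVec v r).charpoly := by
    have := unipotent_conj l r v (D - vecMulVec v r)
    rw [sub_add_cancel] at this
    rw [hb, ← this, coe_units_inv, charpoly_units_conj, charpoly_bordered_zero]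
  have h3 := congrArg (fun p => (derivative p).eval l) h2
  simp only [charpoly_bordered_eq_sub (l - r ⬝ᵥ v), derivative_sub, derivative_mul, eval_sub,
    eval_mul, eval_add, eval_C, derivative_C, derivative_X, eval_X, sub_self, zero_mul, add_zero,
    zero_add, one_mul, sub_zero] at h3
  rw [div_eq_iff hl] at h1
  rw [eval_sub, eval_mul, eval_mul, h1, ← h3]
  ring

lemma lintegral_comp_mulVec (A : Matrix (Fin n) (Fin n) ℂ) (hA : A.det ≠ 0)
    {g : (Fin n → ℂ) → ℝ≥0∞} (hg : Measurable g) :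
    ∫⁻ b, g b = ‖A.det‖ₑ ^ 2 * ∫⁻ v, g (A *ᵥ v) := by
  set f : (Fin n → ℂ) →ₗ[ℝ] (Fin n → ℂ) := (Matrix.toLin' A).restrictScalars ℝ with hf
  have hdet : LinearMap.det f = ‖A.det‖ ^ 2 := by
    rw [hf, LinearMap.det_restrictScalars, LinearMap.det_toLin', Algebra.norm_complex_apply,
      Complex.normSq_eq_norm_sq]
  have hne : ‖A.det‖ ^ 2 ≠ 0 := by positivity
  have hmap := Measure.map_linearMap_addHaar_eq_smul_addHaar (volume : Measure (Fin n → ℂ))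
    (f := f) (by rw [hdet]; exact hne)
  have hfm : Measurable f := f.continuous_of_finiteDimensional.measurable
  have h1 : ∫⁻ v, g (A *ᵥ v) = ∫⁻ v, g v ∂(Measure.map f volume) := by
    rw [lintegral_map hg hfm]; rfl
  rw [h1, hmap, lintegral_smul_measure, hdet, smul_eq_mul, ← mul_assoc, abs_inv,
    abs_of_nonneg (by positivity), ← ofReal_norm, ← ENNReal.ofReal_pow (norm_nonneg _),
    ← ENNReal.ofReal_mul (by positivity), mul_inv_cancel₀ hne, ENNReal.ofReal_one, one_mul]

lemma lintegral_rotate_three {α β γ : Type*} [MeasureSpace α] [MeasureSpace β] [MeasureSpace γ]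
    [SFinite (volume : Measure α)] [SFinite (volume : Measure β)] [SFinite (volume : Measure γ)]
    {H : α → β → γ → ℝ≥0∞} (hH : Measurable fun p : α × β × γ => H p.1 p.2.1 p.2.2) :
    ∫⁻ a, ∫⁻ b, ∫⁻ c, H a b c = ∫⁻ c, ∫⁻ a, ∫⁻ b, H a b c := by
  have h1 : ∀ a, ∫⁻ b, ∫⁻ c, H a b c = ∫⁻ c, ∫⁻ b, H a b c := fun a =>
    lintegral_lintegral_swap (hH.comp (f := fun p : β × γ => (a, p.1, p.2)) (by fun_prop)).aemeasurable
  have m2 : Measurable fun p : α × γ => ∫⁻ b, H p.1 b p.2 :=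
    Measurable.lintegral_prod_right' (f := fun q : (α × γ) × β => H q.1.1 q.2 q.1.2)
      (hH.comp (f := fun q : (α × γ) × β => (q.1.1, q.2, q.1.2)) (by fun_prop))
  simp_rw [h1]
  exact lintegral_lintegral_swap m2.aemeasurable

lemma lintegral_rotate_four {α β γ δ : Type*} [MeasureSpace α] [MeasureSpace β] [MeasureSpace γ]
    [MeasureSpace δ] [SFinite (volume : Measure α)] [SFinite (volume : Measure β)]
    [SFinite (volume : Measure γ)] [SFinite (volume : Measure δ)]
    {H : α → β → γ → δ → ℝ≥0∞} (hH : Measurable fun p : α × β × γ × δ => H p.1 p.2.1 p.2.2.1 p.2.2.2) :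
    ∫⁻ a, ∫⁻ b, ∫⁻ c, ∫⁻ d, H a b c d = ∫⁻ d, ∫⁻ a, ∫⁻ b, ∫⁻ c, H a b c d := by
  have h1 : ∀ a, ∫⁻ b, ∫⁻ c, ∫⁻ d, H a b c d = ∫⁻ d, ∫⁻ b, ∫⁻ c, H a b c d := fun a =>
    lintegral_rotate_three (hH.comp (f := fun p : β × γ × δ => (a, p.1, p.2.1, p.2.2)) (by fun_prop))
  have m2 : Measurable fun p : (α × β × δ) => ∫⁻ c, H p.1 p.2.1 c p.2.2 :=
    Measurable.lintegral_prod_right' (f := fun q : (α × β × δ) × γ => H q.1.1 q.1.2.1 q.2 q.1.2.2)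
      (hH.comp (f := fun q : (α × β × δ) × γ => (q.1.1, q.1.2.1, q.2, q.1.2.2)) (by fun_prop))
  have m3 : Measurable fun p : (α × δ) => ∫⁻ b, ∫⁻ c, H p.1 b c p.2 :=
    Measurable.lintegral_prod_right' (f := fun q : (α × δ) × β => ∫⁻ c, H q.1.1 q.2 c q.1.2)
      (m2.comp (f := fun q : (α × δ) × β => (q.1.1, q.2, q.1.2)) (by fun_prop))
  simp_rw [h1]
  exact lintegral_lintegral_swap m3.aemeasurable

lemma measurable_borderedArray {α : Type*} [MeasurableSpace α] {a : α → ℂ} {r b : α → Fin n → ℂ}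
    {D : α → Fin n → Fin n → ℂ} (ha : Measurable a) (hr : Measurable r) (hb : Measurable b)
    (hD : Measurable D) : Measurable fun x => borderedArray (a x) (r x) (b x) (D x) :=
  continuous_borderedArray.measurable.comp ((hD.prodMk hb).prodMk (hr.prodMk ha))

lemma measurable_eval_charpoly {α : Type*} [MeasurableSpace α] {M : α → Fin n → Fin n → ℂ}
    {l : α → ℂ} (hM : Measurable M) (hl : Measurable l) :
    Measurable fun x => (of (M x)).charpoly.eval (l x) := by
  have h : Continuous fun p : (Fin n → Fin n → ℂ) × ℂ => (of p.1).charpoly.eval p.2 :=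
    continuous_eval_charpoly
  exact h.measurable.comp (hM.prodMk hl)

lemma measurable_eval_derivative_charpoly {α : Type*} [MeasurableSpace α]
    {M : α → Fin n → Fin n → ℂ} {l : α → ℂ} (hM : Measurable M) (hl : Measurable l) :
    Measurable fun x => (derivative (of (M x)).charpoly).eval (l x) := by
  have h : Continuous fun p : (Fin n → Fin n → ℂ) × ℂ => (derivative (of p.1).charpoly).eval p.2 :=
    continuous_eval_derivative_charpoly
  exact h.measurable.comp (hM.prodMk hl)

/-- The factor `n + 1` counts the eigenvalues: almost every corner is attained by each of them once.
-/
lemma card_mul_lintegral_bordered {D : Fin n → Fin n → ℂ} {b r : Fin n → ℂ}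
    (h : IsCoprime (bordered 0 r b (of D)).charpoly (of D).charpoly)
    {F : (Fin (n + 1) → Fin (n + 1) → ℂ) → ℝ≥0∞} (hF : Measurable F) :
    (n + 1 : ℕ) * ∫⁻ a, F (borderedArray a r b D) =
      ∫⁻ l, ‖(derivative (bordered 0 r b (of D)).charpoly * (of D).charpoly -
          (bordered 0 r b (of D)).charpoly * derivative (of D).charpoly).eval l /
            (of D).charpoly.eval l ^ 2‖ₑ ^ 2 *
        F (borderedArray ((bordered 0 r b (of D)).charpoly.eval l / (of D).charpoly.eval l) r b D) := by
  have := lintegral_comp_ratio (bordered 0 r b (of D)).charpoly_monic (of D).charpoly_monic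
    (by simp) h (g := fun a => F (borderedArray a r b D))
    (hF.comp (measurable_borderedArray measurable_id measurable_const measurable_const
      measurable_const))
  rw [this]
  simp

lemma ae_eval_charpoly_ne_zero (M : Matrix (Fin n) (Fin n) ℂ) : ∀ᵐ l : ℂ, M.charpoly.eval l ≠ 0 := by
  classical
  filter_upwards [M.charpoly.roots.toFinset.finite_toSet.countable.ae_notMem volume] with l hl h
  exact hl (by simpa [M.charpoly_monic.ne_zero] using h)

/-- Integration over matrices through one eigenvalue `l`, its normalised eigenvector `(1, v)`, and
the deflated matrix. -/
lemma lintegral_deflation {F : (Fin (n + 1) → Fin (n + 1) → ℂ) → ℝ≥0∞} (hF : Measurable F) :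
    (n + 1 : ℕ) * ∫⁻ M, F M = ∫⁻ l : ℂ, ∫⁻ v : Fin n → ℂ, ∫⁻ r : Fin n → ℂ,
      ∫⁻ M : Fin n → Fin n → ℂ, ‖(of M).charpoly.eval l‖ₑ ^ 2 *
        F (of.symm ((unipotentUnit v).val * bordered l r 0 (of M) * (unipotentUnit v)⁻¹.val)) := by
  -- the integrand after the substitution of `l` for the corner
  set K : (Fin n → Fin n → ℂ) → (Fin n → ℂ) → (Fin n → ℂ) → ℂ → ℝ≥0∞ := fun D b r l =>
    ‖((derivative (of (borderedArray 0 r b D)).charpoly).eval l * (of D).charpoly.eval l -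
          (of (borderedArray 0 r b D)).charpoly.eval l * (derivative (of D).charpoly).eval l) /
            (of D).charpoly.eval l ^ 2‖ₑ ^ 2 *
        F (borderedArray ((of (borderedArray 0 r b D)).charpoly.eval l / (of D).charpoly.eval l) r b D)
    with hK
  have hKm : Measurable fun p : (Fin n → Fin n → ℂ) × (Fin n → ℂ) × (Fin n → ℂ) × ℂ =>
      K p.1 p.2.1 p.2.2.1 p.2.2.2 := by
    have hA : Measurable fun p : (Fin n → Fin n → ℂ) × (Fin n → ℂ) × (Fin n → ℂ) × ℂ =>
        borderedArray 0 p.2.2.1 p.2.1 p.1 :=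
      measurable_borderedArray measurable_const (by fun_prop) (by fun_prop) (by fun_prop)
    have hl : Measurable fun p : (Fin n → Fin n → ℂ) × (Fin n → ℂ) × (Fin n → ℂ) × ℂ => p.2.2.2 := by
      fun_prop
    have hQ := measurable_eval_charpoly measurable_fst hl
    have hP := measurable_eval_charpoly hA hl
    refine (((((measurable_eval_derivative_charpoly hA hl).mul hQ).sub
      (hP.mul (measurable_eval_derivative_charpoly measurable_fst hl))).div
        (hQ.pow_const 2)).enorm.pow_const 2).mul ?_
    exact hF.comp (measurable_borderedArray (hP.div hQ) (by fun_prop) (by fun_prop) (by fun_prop))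
  -- the integrand after the substitution of `v` for the first column
  set H : ℂ → (Fin n → ℂ) → (Fin n → ℂ) → (Fin n → Fin n → ℂ) → ℝ≥0∞ := fun l v r D =>
    ‖(of (fun i j => D i j - v i * r j)).charpoly.eval l‖ₑ ^ 2 *
      F (borderedArray (l - r ⬝ᵥ v) r (fun i => l * v i - ∑ j, D i j * v j) D) with hH
  have hHm : Measurable fun p : ℂ × (Fin n → ℂ) × (Fin n → ℂ) × (Fin n → Fin n → ℂ) =>
      H p.1 p.2.1 p.2.2.1 p.2.2.2 := by
    refine Measurable.mul ((measurable_eval_charpoly ?_ measurable_fst).enorm.pow_const 2)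
      (hF.comp (measurable_borderedArray ?_ ?_ ?_ ?_))
    all_goals (try simp only [dotProduct]); fun_prop
  have hsub : ∀ D : Fin n → Fin n → ℂ, ∀ l : ℂ, (of D).charpoly.eval l ≠ 0 → ∀ r : Fin n → ℂ,
      ∫⁻ b, K D b r l = ∫⁻ v, H l v r D := by
    intro D l hl r
    have hdet : (scalar (Fin n) l - of D).det ≠ 0 := by rwa [← eval_charpoly]
    rw [lintegral_comp_mulVec (g := fun b => K D b r l) _ hdet (hKm.comp (f := fun b : Fin n → ℂ => (D, b, r, l))
      (by fun_prop)), ← lintegral_const_mul']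
    swap
    · exact ENNReal.pow_ne_top enorm_ne_top
    refine lintegral_congr fun v => ?_
    have hb : (fun i => l * v i - ∑ j, D i j * v j) = (scalar (Fin n) l - of D) *ᵥ v := by
      ext i
      rw [sub_mulVec, scalar_apply, Pi.sub_apply, mulVec_diagonal]
      rfl
    simp only [hH, hK, hb, of_borderedArray]
    -- The Jacobians combine: `Q(l)` from `b = (l - D) v` and `W(l) / Q(l)^2` from the corner, with
    -- `W(l) = χ(l) Q(l)`, leave only `χ(l)` of the deflated matrix.
    rw [← mul_assoc]
    congr 1
    · have := eval_wronskian_deflated l r v (of D) hl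
      rw [eval_sub, eval_mul, eval_mul] at this
      rw [this, ← eval_charpoly, ← mul_pow, ← enorm_mul]
      congr 2
      rw [pow_two, mul_div_mul_right _ _ hl, mul_div_cancel₀ _ hl]
      rfl
    · rw [eval_deflated l r v (of D) hl]
  calc (n + 1 : ℕ) * ∫⁻ M, F M
      = ∫⁻ D, ∫⁻ b, ∫⁻ r, ∫⁻ l, K D b r l := by
        rw [lintegral_matrix_succ hF, ← lintegral_const_mul' _ _ (ENNReal.natCast_ne_top _)]
        refine lintegral_congr_ae ?_
        filter_upwards [ae_separable_charpoly n] with D hD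
        rw [← lintegral_const_mul' _ _ (ENNReal.natCast_ne_top _)]
        refine lintegral_congr_ae ?_
        filter_upwards [ae_isCoprime_charpoly hD] with b hb
        rw [← lintegral_const_mul' _ _ (ENNReal.natCast_ne_top _)]
        refine lintegral_congr_ae ?_
        filter_upwards [hb] with r hr
        rw [card_mul_lintegral_bordered hr hF]
        simp only [hK, of_borderedArray, eval_sub, eval_mul]
    _ = ∫⁻ D, ∫⁻ l, ∫⁻ b, ∫⁻ r, K D b r l := by
        refine lintegral_congr fun D => ?_
        exact lintegral_rotate_three (hKm.comp
          (f := fun p : (Fin n → ℂ) × (Fin n → ℂ) × ℂ => (D, p.1, p.2.1, p.2.2)) (by fun_prop))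
    _ = ∫⁻ D, ∫⁻ l, ∫⁻ r, ∫⁻ b, K D b r l := by
        refine lintegral_congr fun D => lintegral_congr fun l => ?_
        exact lintegral_lintegral_swap (hKm.comp
          (f := fun p : (Fin n → ℂ) × (Fin n → ℂ) => (D, p.1, p.2, l)) (by fun_prop)).aemeasurable
    _ = ∫⁻ D, ∫⁻ l, ∫⁻ r, ∫⁻ v, H l v r D := by
        refine lintegral_congr fun D => lintegral_congr_ae ?_
        filter_upwards [ae_eval_charpoly_ne_zero (of D)] with l hl
        exact lintegral_congr fun r => hsub D l hl r
    _ = ∫⁻ D, ∫⁻ l, ∫⁻ v, ∫⁻ r, H l v r D := by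
        refine lintegral_congr fun D => lintegral_congr fun l => ?_
        exact lintegral_lintegral_swap (hHm.comp
          (f := fun p : (Fin n → ℂ) × (Fin n → ℂ) => (l, p.2, p.1, D)) (by fun_prop)).aemeasurable
    _ = ∫⁻ l, ∫⁻ v, ∫⁻ r, ∫⁻ D, H l v r D := (lintegral_rotate_four hHm).symm
    _ = _ := by
        refine lintegral_congr fun l => lintegral_congr fun v => lintegral_congr fun r => ?_
        -- Translating the block by `v rᵀ` makes the deflated matrix itself the integration
        -- variable.
        rw [← lintegral_add_right_eq_self _ (fun i j => v i * r j)]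
        refine lintegral_congr fun M => ?_
        simp only [hH]
        rw [unipotent_conj, show of M + vecMulVec v r = of (M + fun i j => v i * r j) from rfl,
          ← of_borderedArray, Equiv.symm_apply_apply]
        congr 3
        · simp
        · ext i
          rw [sub_mulVec, scalar_apply, Pi.sub_apply, mulVec_diagonal]
          rfl

end Deflation

/-! ### Gaussian weight in the deflated coordinates. -/

section UnitaryInvariance

open Matrix Polynomial

variable {n : ℕ}

/-- The squared Frobenius norm. -/
noncomputable def frobeniusSq (M : Matrix (Fin n) (Fin n) ℂ) : ℝ := ∑ i, ∑ j, ‖M i j‖ ^ 2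

lemma frobeniusSq_eq_trace (M : Matrix (Fin n) (Fin n) ℂ) :
    (frobeniusSq M : ℂ) = (Mᴴ * M).trace := by
  rw [frobeniusSq, Finset.sum_comm]
  push_cast
  rw [Matrix.trace]
  refine Finset.sum_congr rfl fun j _ => ?_
  rw [diag_apply, Matrix.mul_apply]
  refine Finset.sum_congr rfl fun i _ => ?_
  rw [conjTranspose_apply, RCLike.star_def, Complex.conj_mul']

lemma frobeniusSq_unitary_conj {U : Matrix (Fin n) (Fin n) ℂ} (hU : U ∈ unitaryGroup (Fin n) ℂ)
    (M : Matrix (Fin n) (Fin n) ℂ) : frobeniusSq (U * M * Uᴴ) = frobeniusSq M := by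
  have h1 : Uᴴ * U = 1 := mem_unitaryGroup_iff'.1 hU
  have : (frobeniusSq (U * M * Uᴴ) : ℂ) = frobeniusSq M := by
    rw [frobeniusSq_eq_trace, frobeniusSq_eq_trace, conjTranspose_mul, conjTranspose_mul,
      conjTranspose_conjTranspose,
      show U * (Mᴴ * Uᴴ) * (U * M * Uᴴ) = (U * Mᴴ * (Uᴴ * U) * M) * Uᴴ by
        simp only [Matrix.mul_assoc], h1, Matrix.mul_one, trace_mul_comm, ← Matrix.mul_assoc,
      ← Matrix.mul_assoc, h1, Matrix.one_mul]
  exact_mod_cast this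

lemma exists_unitary_first_column {x : Fin (n + 1) → ℂ} (hx : ∑ i, ‖x i‖ ^ 2 = 1) :
    ∃ U ∈ unitaryGroup (Fin (n + 1)) ℂ, ∀ i, U i 0 = x i := by
  have hnorm : ‖WithLp.toLp 2 x‖ = 1 := by
    rw [EuclideanSpace.norm_eq, Real.sqrt_eq_one]; exact hx
  have ho : Orthonormal ℂ (({0} : Set (Fin (n + 1))).domRestrict
      (fun _ => (WithLp.toLp 2 x : EuclideanSpace ℂ (Fin (n + 1))))) := by
    refine ⟨fun _ => hnorm, fun i j hij => ?_⟩
    exact (hij (Subsingleton.elim _ _)).elim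
  obtain ⟨b, hb⟩ := ho.exists_orthonormalBasis_extension_of_card_eq (by simp)
  refine ⟨(EuclideanSpace.basisFun (Fin (n + 1)) ℂ).toBasis.toMatrix b,
    OrthonormalBasis.toMatrix_orthonormalBasis_mem_unitary _ _, fun i => ?_⟩
  simp [Module.Basis.toMatrix_apply, hb 0 rfl]

/-- Right multiplication by a matrix as an endomorphism of the space of arrays. -/
def mulRightArray (B : Matrix (Fin n) (Fin n) ℂ) : (Fin n → Fin n → ℂ) →ₗ[ℂ] (Fin n → Fin n → ℂ) :=
  LinearMap.pi fun i => (toLin' Bᵀ).comp (LinearMap.proj i)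

lemma mulRightArray_apply (B : Matrix (Fin n) (Fin n) ℂ) (M : Fin n → Fin n → ℂ) :
    mulRightArray B M = of.symm (of M * B) := by
  ext i j
  simp [mulRightArray, Matrix.mul_apply, mulVec, dotProduct, mul_comm]

lemma det_mulRightArray (B : Matrix (Fin n) (Fin n) ℂ) :
    LinearMap.det (mulRightArray B) = B.det ^ n := by
  rw [mulRightArray, LinearMap.det_pi]; simp

/-- Transposition as an automorphism of the space of arrays. -/
def transposeArray (n : ℕ) : (Fin n → Fin n → ℂ) ≃ₗ[ℂ] (Fin n → Fin n → ℂ) where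
  toFun M i j := M j i
  invFun M i j := M j i
  map_add' _ _ := rfl
  map_smul' _ _ := rfl
  left_inv _ := rfl
  right_inv _ := rfl

/-- Left and right multiplication act on columns and rows separately, so the complex Jacobian is
`(det T * det S)^n = 1`. -/
lemma lintegral_comp_conj {T S : Matrix (Fin n) (Fin n) ℂ} (hTS : T * S = 1)
    {g : (Fin n → Fin n → ℂ) → ℝ≥0∞} (hg : Measurable g) :
    ∫⁻ M, g (of.symm (T * of M * S)) = ∫⁻ M, g M := by
  set L : (Fin n → Fin n → ℂ) →ₗ[ℂ] (Fin n → Fin n → ℂ) :=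
    ((transposeArray n).toLinearMap ∘ₗ mulRightArray Tᵀ ∘ₗ (transposeArray n).symm.toLinearMap) ∘ₗ
      mulRightArray S with hL
  have hLa : ∀ M, L M = of.symm (T * of M * S) := by
    intro M
    rw [Matrix.mul_assoc]
    ext i j
    simp only [hL, LinearMap.comp_apply, mulRightArray_apply]
    simp [transposeArray, Matrix.mul_apply, mul_comm]
  have hdet : LinearMap.det L = 1 := by
    rw [hL, LinearMap.det_comp, LinearMap.det_conj, det_mulRightArray, det_mulRightArray,
      det_transpose, ← mul_pow, ← det_mul, hTS, det_one, one_pow]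
  have hdet' : LinearMap.det (L.restrictScalars ℝ) = 1 := by
    rw [LinearMap.det_restrictScalars, hdet, map_one]
  have : (volume : Measure (Fin n → Fin n → ℂ)).IsAddHaarMeasure :=
    Measure.pi.isAddHaarMeasure fun _ => (volume : Measure (Fin n → ℂ))
  have hmap := Measure.map_linearMap_addHaar_eq_smul_addHaar
    (volume : Measure (Fin n → Fin n → ℂ)) (f := L.restrictScalars ℝ) (by rw [hdet']; exact one_ne_zero)
  rw [hdet', inv_one, abs_one, ENNReal.ofReal_one, one_smul] at hmap
  simp_rw [← hLa]
  conv_rhs => rw [← hmap]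
  rw [lintegral_map hg (L.restrictScalars ℝ).continuous_of_finiteDimensional.measurable]
  rfl

/-- Triangular factorisation of the unipotent matrix with first column `(1, v)`, up to a unitary
factor. -/
lemma exists_unitary_mul_bordered (v : Fin n → ℂ) :
    ∃ U ∈ unitaryGroup (Fin (n + 1)) ℂ, ∃ (s : Fin n → ℂ) (T : Matrix (Fin n) (Fin n) ℂ),
      (unipotentUnit v).val = U * bordered ((√(1 + ∑ i, ‖v i‖ ^ 2) : ℝ) : ℂ) s 0 T ∧
      √(1 + ∑ i, ‖v i‖ ^ 2) * ‖T.det‖ = 1 := by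
  set ρ : ℝ := √(1 + ∑ i, ‖v i‖ ^ 2) with hρ
  have hsum : 0 < 1 + ∑ i, ‖v i‖ ^ 2 := by positivity
  have hρ0 : 0 < ρ := Real.sqrt_pos.2 hsum
  have hρ2 : ρ ^ 2 = 1 + ∑ i, ‖v i‖ ^ 2 := Real.sq_sqrt hsum.le
  have hρc : (ρ : ℂ) ≠ 0 := by exact_mod_cast hρ0.ne'
  -- As in the QR factorisation, the first column of `U` is the normalised `(1, v)`, so `Uᴴ` sends
  -- `(1, v)` to `ρ` times the first basis vector.
  obtain ⟨U, hU, hcol⟩ := exists_unitary_first_column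
    (x := fun i => (Fin.cons (α := fun _ => ℂ) 1 v i : ℂ) / ρ) (by
      simp only [norm_div, Complex.norm_real, Real.norm_of_nonneg hρ0.le, div_pow, hρ2]
      rw [← Finset.sum_div, Fin.sum_univ_succ]
      simp [hsum.ne'])
  have hUU : U * Uᴴ = 1 := mem_unitaryGroup_iff.1 hU
  have hUU' : Uᴴ * U = 1 := mem_unitaryGroup_iff'.1 hU
  set R := Uᴴ * (unipotentUnit v).val with hR
  have hcol' : ∀ i, R i 0 = if i = 0 then (ρ : ℂ) else 0 := by
    intro i
    have h1 : ∀ k, (unipotentUnit v).val k 0 = ρ * U k 0 := by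
      intro k
      rw [hcol, mul_div_cancel₀ _ hρc]
      change bordered 1 0 v 1 k 0 = _
      cases k using Fin.cases <;> rfl
    rw [hR, Matrix.mul_apply]
    simp_rw [h1]
    have h2 := congrFun₂ hUU' i 0
    rw [Matrix.mul_apply, Matrix.one_apply] at h2
    calc _ = ρ * ∑ k, Uᴴ i k * U k 0 := by
            rw [Finset.mul_sum]; exact Finset.sum_congr rfl fun _ _ => by ring
      _ = _ := by rw [h2]; split_ifs <;> simp
  have hRb : R = bordered (ρ : ℂ) (fun j => R 0 j.succ) 0 (of fun i j => R i.succ j.succ) := by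
    refine Matrix.ext fun i j => ?_
    cases i using Fin.cases <;> cases j using Fin.cases
    · exact (hcol' 0).trans (if_pos rfl)
    · rfl
    · exact (hcol' _).trans (if_neg (Fin.succ_ne_zero _))
    · rfl
  refine ⟨U, hU, fun j => R 0 j.succ, of fun i j => R (Fin.succ i) (Fin.succ j), ?_, ?_⟩
  · rw [← hRb, hR, ← Matrix.mul_assoc, hUU, Matrix.one_mul]
  · have h1 : ‖U.det‖ = 1 := by
      have := congrArg (fun A => ‖A.det‖) hUU
      simp only [det_mul, det_conjTranspose, norm_mul, norm_star, det_one, norm_one] at this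
      nlinarith [norm_nonneg U.det]
    have h2 : ‖R.det‖ = 1 := by
      have h3 : (unipotentUnit v).val.det = 1 := by
        change (bordered 1 0 v 1).det = 1
        rw [det_bordered _ _ _ _ (by simp)]; simp
      rw [hR, det_mul, h3, mul_one, det_conjTranspose, norm_star, h1]
    have h4 : R.det = ρ * (of fun i j => R (Fin.succ i) (Fin.succ j)).det := by
      conv_lhs => rw [hRb]
      rw [bordered, det_submatrix_equiv_self,
        show replicateCol Unit (0 : Fin n → ℂ) = 0 from rfl, det_fromBlocks_zero₂₁]
      simp
    rw [h4, norm_mul, Complex.norm_real, Real.norm_of_nonneg hρ0.le] at h2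
    exact h2

/-- The unnormalised Gaussian weight on matrices. -/
noncomputable def gaussianWeight (M : Matrix (Fin n) (Fin n) ℂ) : ℝ≥0∞ :=
  ENNReal.ofReal (rexp (-frobeniusSq M))

lemma measurable_gaussianWeight :
    Measurable fun M : Fin n → Fin n → ℂ => gaussianWeight (of M) := by
  unfold gaussianWeight frobeniusSq
  simp only [of_apply]
  fun_prop

lemma gaussianWeight_unitary_conj {U : Matrix (Fin n) (Fin n) ℂ} (hU : U ∈ unitaryGroup (Fin n) ℂ)
    (M : Matrix (Fin n) (Fin n) ℂ) : gaussianWeight (U * M * Uᴴ) = gaussianWeight M := by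
  rw [gaussianWeight, frobeniusSq_unitary_conj hU, gaussianWeight]

lemma frobeniusSq_bordered (l : ℂ) (r : Fin n → ℂ) (M : Matrix (Fin n) (Fin n) ℂ) :
    frobeniusSq (bordered l r 0 M) = ‖l‖ ^ 2 + ∑ i, ‖r i‖ ^ 2 + frobeniusSq M := by
  simp only [frobeniusSq, Fin.sum_univ_succ]
  simp [bordered, finSuccSumEquiv]

lemma gaussianWeight_bordered (l : ℂ) (r : Fin n → ℂ) (M : Matrix (Fin n) (Fin n) ℂ) :
    gaussianWeight (bordered l r 0 M) = ENNReal.ofReal (rexp (-‖l‖ ^ 2)) *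
      (ENNReal.ofReal (rexp (-∑ i, ‖r i‖ ^ 2)) * gaussianWeight M) := by
  rw [gaussianWeight, gaussianWeight, frobeniusSq_bordered, ← ENNReal.ofReal_mul (by positivity),
    ← ENNReal.ofReal_mul (by positivity), ← Real.exp_add, ← Real.exp_add]
  congr 2; ring

/-- Write the unipotent matrix as unitary times block triangular. The unitary factor leaves the
Gaussian weight unchanged. Conjugation by the triangular factor keeps `l`, conjugates `M`, and acts
on `r` by an affine map whose linear part does not depend on `M`. Thus the dependence on `v` is a
pure Jacobian and factors out. -/
lemma lintegral_unipotent_conj {f : Matrix (Fin (n + 1)) (Fin (n + 1)) ℂ → ℝ≥0∞}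
    (hfm : Measurable fun M : Fin (n + 1) → Fin (n + 1) → ℂ => f (of M))
    (hf : ∀ (P : (Matrix (Fin (n + 1)) (Fin (n + 1)) ℂ)ˣ) M, f (P.val * M * P⁻¹.val) = f M)
    (l : ℂ) (v : Fin n → ℂ) :
    ∫⁻ r : Fin n → ℂ, ∫⁻ M : Fin n → Fin n → ℂ, ‖(of M).charpoly.eval l‖ₑ ^ 2 *
        (f (bordered l r 0 (of M)) * gaussianWeight
          ((unipotentUnit v).val * bordered l r 0 (of M) * (unipotentUnit v)⁻¹.val)) =
      (ENNReal.ofReal (1 + ∑ i, ‖v i‖ ^ 2) ^ (n + 1))⁻¹ *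
        ∫⁻ M : Fin n → Fin n → ℂ, ∫⁻ r : Fin n → ℂ, ‖(of M).charpoly.eval l‖ₑ ^ 2 *
          (f (bordered l r 0 (of M)) * gaussianWeight (bordered l r 0 (of M))) := by
  obtain ⟨U, hU, s, T, hUR, hdet⟩ := exists_unitary_mul_bordered v
  set ρ : ℝ := √(1 + ∑ i, ‖v i‖ ^ 2) with hρ
  have hsum : 0 < 1 + ∑ i, ‖v i‖ ^ 2 := by positivity
  have hρ0 : 0 < ρ := Real.sqrt_pos.2 hsum
  have hρ2 : ρ ^ 2 = 1 + ∑ i, ‖v i‖ ^ 2 := Real.sq_sqrt hsum.le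
  have hρc : (ρ : ℂ) ≠ 0 := by exact_mod_cast hρ0.ne'
  have hUU' : Uᴴ * U = 1 := mem_unitaryGroup_iff'.1 hU
  have hUU : U * Uᴴ = 1 := mem_unitaryGroup_iff.1 hU
  have hT0 : T.det ≠ 0 := by
    intro h; rw [h] at hdet; simp at hdet
  have hTu : IsUnit T.det := isUnit_iff_ne_zero.2 hT0
  have hTT : T * T⁻¹ = 1 := mul_nonsing_inv T hTu
  -- the integrand in the new coordinates
  set Φ : (Fin n → ℂ) → (Fin n → Fin n → ℂ) → ℝ≥0∞ := fun r M => ‖(of M).charpoly.eval l‖ₑ ^ 2 *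
          (f (bordered l r 0 (of M)) * gaussianWeight (bordered l r 0 (of M))) with hΦ
  have hΦm : Measurable fun p : (Fin n → ℂ) × (Fin n → Fin n → ℂ) => Φ p.1 p.2 := by
    have hb : Measurable fun p : (Fin n → ℂ) × (Fin n → Fin n → ℂ) => borderedArray l p.1 0 p.2 :=
      measurable_borderedArray measurable_const measurable_fst measurable_const measurable_snd
    have h1 := hfm.comp hb
    have h2 := measurable_gaussianWeight.comp hb
    simp only [Function.comp_def, of_borderedArray] at h1 h2
    exact ((measurable_eval_charpoly measurable_snd measurable_const).enorm.pow_const 2).mul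
      (h1.mul h2)
  have hconj : ∀ r (M : Matrix (Fin n) (Fin n) ℂ),
      bordered (ρ : ℂ) s 0 T * bordered l r 0 M = bordered l
        ((((ρ : ℂ) • (T⁻¹)ᵀ) *ᵥ r) + ((s ᵥ* M - l • s) ᵥ* T⁻¹)) 0 (T * M * T⁻¹) *
          bordered (ρ : ℂ) s 0 T := by
    intro r M
    rw [bordered_mul, bordered_mul]
    have hTT' : T⁻¹ * T = 1 := nonsing_inv_mul T hTu
    congr 1
    · simp [mul_comm]
    · rw [smul_mulVec, mulVec_transpose, add_vecMul, smul_vecMul, vecMul_vecMul, vecMul_vecMul,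
        hTT', vecMul_one, vecMul_one]
      abel
    · simp
    · simp [Matrix.mul_assoc, hTT']
  have hR : (unipotentUnit v).val * (unipotentUnit v)⁻¹.val = 1 := (unipotentUnit v).mul_inv
  have hint : ∀ r (M : Fin n → Fin n → ℂ), ‖(of M).charpoly.eval l‖ₑ ^ 2 *
        (f (bordered l r 0 (of M)) * gaussianWeight
          ((unipotentUnit v).val * bordered l r 0 (of M) * (unipotentUnit v)⁻¹.val)) =
      Φ ((((ρ : ℂ) • (T⁻¹)ᵀ) *ᵥ r) + ((s ᵥ* of M - l • s) ᵥ* T⁻¹))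
        (of.symm (T * of M * T⁻¹)) := by
    intro r M
    set B := bordered l ((((ρ : ℂ) • (T⁻¹)ᵀ) *ᵥ r) + ((s ᵥ* of M - l • s) ᵥ* T⁻¹)) 0
      (T * of M * T⁻¹) with hB
    have h1 : (unipotentUnit v).val * bordered l r 0 (of M) * (unipotentUnit v)⁻¹.val
        = U * B * Uᴴ := by
      have h2 : (unipotentUnit v).val * bordered l r 0 (of M) = U * B * Uᴴ * (unipotentUnit v).val := by
        rw [hUR, Matrix.mul_assoc U, hconj, ← hB]
        calc _ = U * B * (Uᴴ * U) * bordered (ρ : ℂ) s 0 T := by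
              rw [hUU', Matrix.mul_one, Matrix.mul_assoc]
          _ = _ := by simp only [Matrix.mul_assoc]
      rw [h2, Matrix.mul_assoc _ _ (unipotentUnit v)⁻¹.val, hR, Matrix.mul_one]
    have h3 : f (bordered l r 0 (of M)) = f B := by
      rw [← hf (unipotentUnit v), h1, ← hf ⟨U, Uᴴ, hUU, hUU'⟩ B]
      rfl
    have h4 : (of M).charpoly = (T * of M * T⁻¹).charpoly :=
      (charpoly_units_conj (nonsingInvUnit T hTu) (of M)).symm
    simp only [hΦ]
    rw [h1, gaussianWeight_unitary_conj hU, h3, h4]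
    rfl
  -- The scalar gives `ρ^n` and `|det T|⁻¹ = ρ` gives one more power.
  have hAdet : ‖((ρ : ℂ) • (T⁻¹)ᵀ).det‖ₑ ^ 2 = ENNReal.ofReal (1 + ∑ i, ‖v i‖ ^ 2) ^ (n + 1) := by
    have h1 : ‖((ρ : ℂ) • (T⁻¹)ᵀ).det‖ = ρ ^ (n + 1) := by
      rw [det_smul, det_transpose, det_nonsing_inv, Ring.inverse_eq_inv', norm_mul, norm_pow,
        Complex.norm_real, Real.norm_of_nonneg hρ0.le, norm_inv, Fintype.card_fin,
        ← eq_inv_of_mul_eq_one_left hdet, pow_succ]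
    rw [← ofReal_norm, h1, ← ENNReal.ofReal_pow (by positivity), ← hρ2,
      ← ENNReal.ofReal_pow (by positivity)]
    congr 1; ring
  have hA0 : ((ρ : ℂ) • (T⁻¹)ᵀ).det ≠ 0 := by
    rw [det_smul, det_transpose, det_nonsing_inv, Ring.inverse_eq_inv']
    exact mul_ne_zero (pow_ne_zero _ hρc) (inv_ne_zero hT0)
  set κ := ENNReal.ofReal (1 + ∑ i, ‖v i‖ ^ 2) ^ (n + 1) with hκ
  have hκ0 : κ ≠ 0 := pow_ne_zero _ (by simpa using hsum)
  have hκt : κ ≠ ⊤ := ENNReal.pow_ne_top ENNReal.ofReal_ne_top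
  have hinner : ∀ (c : Fin n → ℂ) (M : Fin n → Fin n → ℂ),
      ∫⁻ r, Φ ((((ρ : ℂ) • (T⁻¹)ᵀ) *ᵥ r) + c) M = κ⁻¹ * ∫⁻ r, Φ r M := by
    intro c M
    have hm : Measurable fun r => Φ (r + c) M :=
      hΦm.comp (f := fun r : Fin n → ℂ => (r + c, M)) (by fun_prop)
    have h1 := lintegral_comp_mulVec _ hA0 hm
    rw [lintegral_add_right_eq_self (fun r => Φ r M) c, hAdet] at h1
    rw [h1, ← mul_assoc, ENNReal.inv_mul_cancel hκ0 hκt, one_mul]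
  simp_rw [hint]
  -- The shift of `r` depends on `M`, so `r` must be integrated first, with `M` fixed.
  rw [lintegral_lintegral_swap]
  · simp_rw [hinner]
    rw [lintegral_const_mul' _ _ (ENNReal.inv_ne_top.2 hκ0)]
    congr 1
    have hm : Measurable fun M => ∫⁻ r, Φ r M := Measurable.lintegral_prod_left' hΦm
    exact lintegral_comp_conj hTT hm
  · refine (hΦm.comp (f := fun p : (Fin n → ℂ) × (Fin n → Fin n → ℂ) =>
      ((((ρ : ℂ) • (T⁻¹)ᵀ) *ᵥ p.1) + ((s ᵥ* of p.2 - l • s) ᵥ* T⁻¹),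
        of.symm (T * of p.2 * T⁻¹))) ?_).aemeasurable
    refine Continuous.measurable (Continuous.prodMk ?_ ?_)
    · refine (continuous_const.matrix_mulVec continuous_fst).add ?_
      have h : Continuous fun p : (Fin n → ℂ) × (Fin n → Fin n → ℂ) => of p.2 := continuous_snd
      exact ((continuous_const.matrix_vecMul h).sub continuous_const).matrix_vecMul continuous_const
    · have h : Continuous fun p : (Fin n → ℂ) × (Fin n → Fin n → ℂ) => of p.2 := continuous_snd
      exact (continuous_const.matrix_mul h).matrix_mul continuous_const

/-- The constant in `lintegral_gaussianWeight_deflation`. -/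
noncomputable def deflationConst (n : ℕ) : ℝ≥0∞ :=
  ((n + 1 : ℕ) : ℝ≥0∞)⁻¹ * (∫⁻ v : Fin n → ℂ, (ENNReal.ofReal (1 + ∑ i, ‖v i‖ ^ 2) ^ (n + 1))⁻¹) *
    ∫⁻ r : Fin n → ℂ, ENNReal.ofReal (rexp (-∑ i, ‖r i‖ ^ 2))

/-- One step of the Schur decomposition for a conjugation-invariant function of a Gaussian matrix
which is multiplicative on block triangular matrices. -/
lemma lintegral_gaussianWeight_deflation {f : Matrix (Fin (n + 1)) (Fin (n + 1)) ℂ → ℝ≥0∞}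
    (hfm : Measurable fun M : Fin (n + 1) → Fin (n + 1) → ℂ => f (of M))
    (hf : ∀ (P : (Matrix (Fin (n + 1)) (Fin (n + 1)) ℂ)ˣ) M, f (P.val * M * P⁻¹.val) = f M)
    {h : ℂ → ℝ≥0∞} {f' : Matrix (Fin n) (Fin n) ℂ → ℝ≥0∞} (hh : Measurable h)
    (hfm' : Measurable fun M : Fin n → Fin n → ℂ => f' (of M))
    (hfb : ∀ l r M, f (bordered l r 0 M) = h l * f' M) :
    ∫⁻ M : Fin (n + 1) → Fin (n + 1) → ℂ, f (of M) * gaussianWeight (of M) =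
      deflationConst n * ∫⁻ l : ℂ, ENNReal.ofReal (rexp (-‖l‖ ^ 2)) * h l *
        ∫⁻ M : Fin n → Fin n → ℂ, ‖(of M).charpoly.eval l‖ₑ ^ 2 * f' (of M) *
          gaussianWeight (of M) := by
  have key := lintegral_deflation (F := fun M => f (of M) * gaussianWeight (of M))
    (hfm.mul measurable_gaussianWeight)
  simp only [Equiv.apply_symm_apply, hf] at key
  have hκ : Measurable fun v : Fin n → ℂ => (ENNReal.ofReal (1 + ∑ i, ‖v i‖ ^ 2) ^ (n + 1))⁻¹ := by
    fun_prop
  have hg : Measurable fun r : Fin n → ℂ => ENNReal.ofReal (rexp (-∑ i, ‖r i‖ ^ 2)) := by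
    fun_prop
  have hp : Measurable fun p : ℂ × (Fin n → Fin n → ℂ) =>
      ‖(of p.2).charpoly.eval p.1‖ₑ ^ 2 * f' (of p.2) * gaussianWeight (of p.2) :=
    (((measurable_eval_charpoly measurable_snd measurable_fst).enorm.pow_const 2).mul
      (hfm'.comp measurable_snd)).mul (measurable_gaussianWeight.comp measurable_snd)
  have hq : Measurable fun l : ℂ => ENNReal.ofReal (rexp (-‖l‖ ^ 2)) * h l *
        ∫⁻ M : Fin n → Fin n → ℂ, ‖(of M).charpoly.eval l‖ₑ ^ 2 * f' (of M) *
          gaussianWeight (of M) := by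
    refine Measurable.mul (Measurable.mul (by fun_prop) hh) (Measurable.lintegral_prod_right' hp)
  have hr : ∀ l : ℂ, ∫⁻ M : Fin n → Fin n → ℂ, ∫⁻ r : Fin n → ℂ, ‖(of M).charpoly.eval l‖ₑ ^ 2 *
          (f (bordered l r 0 (of M)) * gaussianWeight (bordered l r 0 (of M))) =
      (∫⁻ r : Fin n → ℂ, ENNReal.ofReal (rexp (-∑ i, ‖r i‖ ^ 2))) *
        (ENNReal.ofReal (rexp (-‖l‖ ^ 2)) * h l *
        ∫⁻ M : Fin n → Fin n → ℂ, ‖(of M).charpoly.eval l‖ₑ ^ 2 * f' (of M) *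
          gaussianWeight (of M)) := by
    intro l
    have hp' := hp.comp (f := fun M : Fin n → Fin n → ℂ => (l, M)) (by fun_prop)
    simp only [Function.comp_def] at hp'
    rw [← lintegral_const_mul _ hp', ← lintegral_const_mul _ (hp'.const_mul _)]
    refine lintegral_congr fun M => ?_
    rw [← lintegral_mul_const _ hg]
    refine lintegral_congr fun r => ?_
    rw [hfb, gaussianWeight_bordered]
    ring
  simp_rw [lintegral_unipotent_conj hfm hf, lintegral_mul_const _ hκ, hr] at key
  rw [lintegral_const_mul _ (hq.const_mul _), lintegral_const_mul _ hq, ← mul_assoc] at key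
  rw [deflationConst, mul_assoc, mul_assoc, ← mul_assoc (lintegral _ _), ← key, ← mul_assoc,
    ENNReal.inv_mul_cancel (by simp) (ENNReal.natCast_ne_top _), one_mul]

end UnitaryInvariance

/-! ### Joint eigenvalue density by induction on the size. -/

section Schur

open Matrix Polynomial

/-- A function of the spectrum of a matrix of arbitrary size which is the product of the values of
`h` at the eigenvalues. -/
structure IsSpectralProduct (F : ∀ n, Matrix (Fin n) (Fin n) ℂ → ℝ≥0∞) (h : ℂ → ℝ≥0∞) : Prop where
  measurable : ∀ n, Measurable fun M : Fin n → Fin n → ℂ => F n (of M)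
  measurable_eigenvalue : Measurable h
  conj : ∀ n (P : (Matrix (Fin n) (Fin n) ℂ)ˣ) M, F n (P.val * M * P⁻¹.val) = F n M
  zero : ∀ M, F 0 M = 1
  bordered : ∀ n l r M, F (n + 1) (bordered l r 0 M) = h l * F n M

lemma isSpectralProduct_one : IsSpectralProduct (fun _ _ => 1) (fun _ => 1) where
  measurable _ := measurable_const
  measurable_eigenvalue := measurable_const
  conj _ _ _ := rfl
  zero _ := rfl
  bordered _ _ _ _ := (one_mul _).symm

lemma IsSpectralProduct.mul {F G h k} (hF : IsSpectralProduct F h) (hG : IsSpectralProduct G k) :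
    IsSpectralProduct (fun n M => F n M * G n M) (fun x => h x * k x) where
  measurable n := (hF.measurable n).mul (hG.measurable n)
  measurable_eigenvalue := hF.measurable_eigenvalue.mul hG.measurable_eigenvalue
  conj n P M := by rw [hF.conj, hG.conj]
  zero M := by rw [hF.zero, hG.zero, one_mul]
  bordered n l r M := by rw [hF.bordered, hG.bordered]; ring

/-- Power functions are the intended `φ`: a real power for one charge, a natural power for the
other, and the square for the factor created by each deflation. -/
lemma isSpectralProduct_charpoly (z : ℂ) {φ : ℝ≥0∞ → ℝ≥0∞} (hφ : Measurable φ) (h1 : φ 1 = 1)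
    (hm : ∀ a b, φ (a * b) = φ a * φ b) :
    IsSpectralProduct (fun _ M => φ ‖M.charpoly.eval z‖ₑ) (fun x => φ ‖z - x‖ₑ) where
  measurable n := hφ.comp (measurable_eval_charpoly measurable_id measurable_const).enorm
  measurable_eigenvalue := hφ.comp (measurable_const.sub measurable_id).enorm
  conj n P M := by rw [coe_units_inv, charpoly_units_conj]
  zero M := by rw [charpoly_isEmpty, eval_one, enorm_one, h1]
  bordered n l r M := by
    rw [charpoly_bordered_zero, eval_mul, enorm_mul, hm]; simp

lemma measurable_finCons {E : Type*} [MeasurableSpace E] {n : ℕ} :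
    Measurable fun p : E × (Fin n → E) => (Fin.cons p.1 p.2 : Fin (n + 1) → E) := by
  refine measurable_pi_iff.2 fun i => ?_
  refine Fin.cases ?_ (fun i => ?_) i
  · exact measurable_fst
  · exact (measurable_pi_apply i).comp measurable_snd

lemma lintegral_pi_succ {E : Type*} [MeasurableSpace E] {n : ℕ} {μ : Measure E} [SigmaFinite μ]
    {G : (Fin (n + 1) → E) → ℝ≥0∞} (hG : Measurable G) :
    ∫⁻ x, G x ∂(Measure.pi fun _ => μ) =
      ∫⁻ l, ∫⁻ y, G (Fin.cons l y) ∂(Measure.pi fun _ : Fin n => μ) ∂μ := by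
  have h := (measurePreserving_piFinSuccAbove (fun _ : Fin (n + 1) => μ) 0).symm
  rw [← h.lintegral_comp hG]
  have hs : ∀ a : E × (Fin n → E),
      (MeasurableEquiv.piFinSuccAbove (fun _ : Fin (n + 1) => E) 0).symm a = Fin.cons a.1 a.2 :=
    fun a => Fin.insertNth_zero' a.1 a.2
  simp_rw [hs]
  exact lintegral_prod (μ := μ) (ν := Measure.pi fun _ : Fin n => μ)
    (fun a => G (Fin.cons a.1 a.2)) (hG.comp measurable_finCons).aemeasurable

/-- The constant in the Schur decomposition. -/
noncomputable def schurConst (n : ℕ) : ℝ≥0∞ := ∏ i ∈ Finset.range n, deflationConst i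

/-- Deflation multiplies the test function of the smaller matrix by `|χ(l)|^2`, which is again a
spectral product. The induction therefore runs over all `F` at once, and this factor becomes the row
of the squared Vandermonde belonging to `l`. -/
lemma IsSpectralProduct.lintegral_gaussianWeight : ∀ (n : ℕ) {F h}, IsSpectralProduct F h →
    ∫⁻ M : Fin n → Fin n → ℂ, F n (of M) * gaussianWeight (of M) =
      schurConst n * ∫⁻ x : Fin n → ℂ, (∏ i, ENNReal.ofReal (rexp (-‖x i‖ ^ 2)) * h (x i)) *
        ∏ i, ∏ j ∈ Finset.Ioi i, ‖x i - x j‖ₑ ^ 2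
  | 0, F, h, hF => by
    have h1 : ∀ M : Matrix (Fin 0) (Fin 0) ℂ, gaussianWeight M = 1 := fun M => by
      simp [gaussianWeight, frobeniusSq]
    simp [hF.zero, h1, schurConst, volume_pi]
  | n + 1, F, h, hF => by
    have hm := hF.measurable_eigenvalue
    rw [lintegral_gaussianWeight_deflation (hF.measurable _) (hF.conj _) hm
      (hF.measurable n) (hF.bordered n), schurConst, Finset.prod_range_succ, mul_comm (Finset.prod _ _),
      mul_assoc]
    congr 1
    have hG : Measurable fun x : Fin (n + 1) → ℂ =>
        (∏ i, ENNReal.ofReal (rexp (-‖x i‖ ^ 2)) * h (x i)) *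
        ∏ i, ∏ j ∈ Finset.Ioi i, ‖x i - x j‖ₑ ^ 2 := by
      fun_prop
    have hs := lintegral_pi_succ (μ := volume) hG
    rw [← volume_pi, ← volume_pi] at hs
    rw [hs, ← schurConst]
    refine Eq.trans (lintegral_congr fun l => ?_) (lintegral_const_mul (schurConst n)
      (Measurable.lintegral_prod_right' (hG.comp measurable_finCons)))
    have ih := lintegral_gaussianWeight n
      ((isSpectralProduct_charpoly l (φ := fun a => a ^ 2) (by fun_prop) (by simp)
        (fun a b => mul_pow a b 2)).mul hF)
    rw [ih, mul_left_comm]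
    congr 1
    rw [← lintegral_const_mul]
    · refine lintegral_congr fun y => ?_
      simp only [Fin.prod_univ_succ, Fin.cons_zero, Fin.cons_succ, Fin.prod_Ioi_zero,
        Fin.prod_Ioi_succ, Finset.prod_mul_distrib]
      ring
    · fun_prop

end Schur

/-! ### Ginibre's formula for standard complex normal entries. -/

section StdNormal

open Matrix

lemma lintegral_pi_withDensity {E : Type*} [MeasurableSpace E] {μ : Measure E} [SigmaFinite μ]
    {f : E → ℝ≥0∞} [SigmaFinite (μ.withDensity f)] (hf : Measurable f) :
    ∀ (n : ℕ) {G : (Fin n → E) → ℝ≥0∞}, Measurable G →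
      ∫⁻ x, G x ∂(Measure.pi fun _ => μ.withDensity f) =
        ∫⁻ x, (∏ i, f (x i)) * G x ∂(Measure.pi fun _ => μ)
  | 0, G, _ => by
    simp only [Finset.univ_eq_empty, Finset.prod_empty, one_mul]
    rw [Measure.pi_of_empty _ Fin.elim0, Measure.pi_of_empty _ Fin.elim0]
  | n + 1, G, hG => by
    have hm : Measurable fun x : Fin (n + 1) → E => (∏ i, f (x i)) * G x := by fun_prop
    have hr : Measurable fun l => ∫⁻ y, G (Fin.cons l y)
        ∂(Measure.pi fun _ : Fin n => μ.withDensity f) :=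
      Measurable.lintegral_prod_right' (f := fun p : E × (Fin n → E) => G (Fin.cons p.1 p.2))
        (hG.comp measurable_finCons)
    rw [lintegral_pi_succ hG, lintegral_pi_succ hm, lintegral_withDensity_eq_lintegral_mul _ hf hr]
    refine lintegral_congr fun l => ?_
    have hl : Measurable fun y : Fin n → E => G (Fin.cons l y) :=
      hG.comp (measurable_finCons.comp measurable_prodMk_left)
    simp only [Pi.mul_apply]
    rw [lintegral_pi_withDensity hf n hl, ← lintegral_const_mul _
      (Measurable.fun_mul (by fun_prop) hl)]
    refine lintegral_congr fun y => ?_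
    simp only [Fin.prod_univ_succ, Fin.cons_zero, Fin.cons_succ]
    ring

lemma pi_withDensity {E : Type*} [MeasurableSpace E] {μ : Measure E} [SigmaFinite μ]
    {f : E → ℝ≥0∞} [SigmaFinite (μ.withDensity f)] (hf : Measurable f) (n : ℕ) :
    (Measure.pi fun _ : Fin n => μ.withDensity f) =
      (Measure.pi fun _ => μ).withDensity fun x => ∏ i, f (x i) := by
  refine Measure.ext_of_lintegral _ fun G hG => ?_
  rw [lintegral_pi_withDensity hf n hG,
    lintegral_withDensity_eq_lintegral_mul _ (by fun_prop) hG]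
  rfl

lemma integral_exp_neg_norm_sq_complex : ∫ z : ℂ, rexp (-‖z‖ ^ 2) = π := by
  have h := Complex.integral_rpow_mul_exp_neg_rpow (p := 2) (q := 0) (by norm_num) (by norm_num)
  simpa using h

/-- A non-integrable function has Bochner integral `0` by convention, so a nonzero value of the
integral already proves integrability. The same device is used for
`integrable_norm_rpow_stdComplexNormal`. -/
lemma integrable_exp_neg_norm_sq_complex : Integrable fun z : ℂ => rexp (-‖z‖ ^ 2) := by
  by_contra h
  have := integral_undef h
  rw [integral_exp_neg_norm_sq_complex] at this
  exact pi_ne_zero this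

instance isProbabilityMeasure_stdComplexNormal : IsProbabilityMeasure stdComplexNormal := by
  constructor
  rw [stdComplexNormal, withDensity_apply _ MeasurableSet.univ, Measure.restrict_univ,
    ← ofReal_integral_eq_lintegral_ofReal (integrable_exp_neg_norm_sq_complex.const_mul _)
      (ae_of_all _ fun z => by positivity), integral_const_mul, integral_exp_neg_norm_sq_complex,
    inv_mul_cancel₀ pi_ne_zero, ENNReal.ofReal_one]

lemma lintegral_pi_stdComplexNormal (n : ℕ) {G : (Fin n → ℂ) → ℝ≥0∞} (hG : Measurable G) :
    ∫⁻ x, G x ∂(Measure.pi fun _ => stdComplexNormal) =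
      ENNReal.ofReal π⁻¹ ^ n * ∫⁻ x, (∏ i, ENNReal.ofReal (rexp (-‖x i‖ ^ 2))) * G x := by
  have hp := isProbabilityMeasure_stdComplexNormal
  unfold stdComplexNormal at hp ⊢
  rw [lintegral_pi_withDensity (by fun_prop) n hG, ← lintegral_const_mul _ (by fun_prop), volume_pi]
  refine lintegral_congr fun x => ?_
  simp only [ENNReal.ofReal_mul (inv_nonneg.2 pi_nonneg), Finset.prod_mul_distrib,
    Finset.prod_const, Finset.card_univ, Fintype.card_fin]
  ring

lemma lintegral_pi_pi_stdComplexNormal (n : ℕ) {G : (Fin n → Fin n → ℂ) → ℝ≥0∞}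
    (hG : Measurable G) :
    ∫⁻ x, G x ∂(Measure.pi fun _ => Measure.pi fun _ => stdComplexNormal) =
      ENNReal.ofReal π⁻¹ ^ (n * n) * ∫⁻ M, G M * gaussianWeight (of M) := by
  have hp := isProbabilityMeasure_stdComplexNormal
  have hp' : IsProbabilityMeasure (Measure.pi fun _ : Fin n => stdComplexNormal) := inferInstance
  unfold stdComplexNormal at hp hp' ⊢
  rw [pi_withDensity (by fun_prop)] at hp' ⊢
  have hw : Measurable fun M : Fin n → Fin n → ℂ => G M * gaussianWeight (of M) :=
    hG.mul measurable_gaussianWeight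
  rw [lintegral_pi_withDensity (by fun_prop) n hG,
    ← lintegral_const_mul (ENNReal.ofReal π⁻¹ ^ (n * n)) hw, volume_pi,
    volume_pi]
  refine lintegral_congr fun x => ?_
  have : gaussianWeight (of x) = ∏ i, ∏ j, ENNReal.ofReal (rexp (-‖x i j‖ ^ 2)) := by
    simp only [gaussianWeight, frobeniusSq, of_apply, ← Finset.sum_neg_distrib, Real.exp_sum]
    rw [ENNReal.ofReal_prod_of_nonneg fun _ _ => Finset.prod_nonneg fun _ _ => (exp_pos _).le]
    exact Finset.prod_congr rfl fun _ _ =>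
      ENNReal.ofReal_prod_of_nonneg fun _ _ => (exp_pos _).le
  rw [this]
  simp only [ENNReal.ofReal_mul (inv_nonneg.2 pi_nonneg), Finset.prod_mul_distrib,
    Finset.prod_const, Finset.card_univ, Fintype.card_fin, pow_mul]
  ring

/-- The unnormalised partition function of the eigenvalues of a Ginibre matrix. -/
noncomputable def ginibrePartition (n : ℕ) : ℝ≥0∞ :=
  ∫⁻ x : Fin n → ℂ, ∏ i, ∏ j ∈ Finset.Ioi i, ‖x i - x j‖ₑ ^ 2
    ∂(Measure.pi fun _ => stdComplexNormal)

/-- Ginibre's formula for the joint density of the eigenvalues. -/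
theorem IsSpectralProduct.lintegral_stdComplexNormal {F h} (hF : IsSpectralProduct F h) (n : ℕ) :
    ∫⁻ M : Fin n → Fin n → ℂ, F n (of M)
        ∂(Measure.pi fun _ => Measure.pi fun _ => stdComplexNormal) =
      (ginibrePartition n)⁻¹ * ∫⁻ x : Fin n → ℂ,
        (∏ i, h (x i)) * ∏ i, ∏ j ∈ Finset.Ioi i, ‖x i - x j‖ₑ ^ 2
          ∂(Measure.pi fun _ => stdComplexNormal) := by
  obtain ⟨c, hc⟩ : ∃ c : ℝ≥0∞, ∀ {F h}, IsSpectralProduct F h →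
      ∫⁻ M : Fin n → Fin n → ℂ, F n (of M)
        ∂(Measure.pi fun _ => Measure.pi fun _ => stdComplexNormal) =
      c * ∫⁻ x : Fin n → ℂ,
        (∏ i, h (x i)) * ∏ i, ∏ j ∈ Finset.Ioi i, ‖x i - x j‖ₑ ^ 2
          ∂(Measure.pi fun _ => stdComplexNormal) := by
    refine ⟨ENNReal.ofReal π⁻¹ ^ (n * n) * schurConst n * ENNReal.ofReal π ^ n, fun {F h} hF => ?_⟩
    have hm := hF.measurable_eigenvalue
    rw [lintegral_pi_pi_stdComplexNormal n (hF.measurable n), hF.lintegral_gaussianWeight,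
      lintegral_pi_stdComplexNormal n (by fun_prop)]
    have h1 : ENNReal.ofReal π ^ n * ENNReal.ofReal π⁻¹ ^ n = 1 := by
      rw [← mul_pow, ← ENNReal.ofReal_mul pi_nonneg, mul_inv_cancel₀ pi_ne_zero,
        ENNReal.ofReal_one, one_pow]
    rw [mul_assoc (_ * _), ← mul_assoc (ENNReal.ofReal π ^ n), h1, one_mul, mul_assoc]
    simp only [Finset.prod_mul_distrib, mul_assoc]
  -- The total mass is `1`, so the test function `1` identifies the constant `c` without evaluating
  -- `deflationConst`.
  have h1 := hc isSpectralProduct_one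
  simp only [lintegral_const, measure_univ, mul_one, Finset.prod_const_one, one_mul] at h1
  rw [hc hF, ginibrePartition, ENNReal.eq_inv_of_mul_eq_one_left h1.symm]

end StdNormal

/-! ### Andréief's identity. -/

section Andreief

open Matrix Equiv

variable {𝕜 E : Type*} {n : ℕ}

lemma det_mul_det_eq_sum {R : Type*} [CommRing R] (f g : Fin n → E → R) (x : Fin n → E) :
    (of fun a i => f a (x i)).det * (of fun a i => g a (x i)).det =
      ∑ σ : Perm (Fin n), ∑ τ : Perm (Fin n),
        ((Perm.sign σ : ℤ) : R) * ((Perm.sign τ : ℤ) : R) *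
          ∏ i, (f (σ i) (x i) * g (τ i) (x i)) := by
  rw [det_apply', det_apply', Finset.sum_mul_sum]
  refine Finset.sum_congr rfl fun σ _ => Finset.sum_congr rfl fun τ _ => ?_
  simp only [of_apply, Finset.prod_mul_distrib]
  ring

variable [RCLike 𝕜] [MeasurableSpace E] {μ : Measure E} [SigmaFinite μ]

lemma integrable_det_mul_det {f g : Fin n → E → 𝕜}
    (h : ∀ a b, Integrable (fun x => f a x * g b x) μ) :
    Integrable (fun x : Fin n → E => (of fun a i => f a (x i)).det * (of fun a i => g a (x i)).det)
      (Measure.pi fun _ => μ) := by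
  simp only [det_mul_det_eq_sum]
  exact integrable_finsetSum _ fun σ _ => integrable_finsetSum _ fun τ _ =>
    (Integrable.fintype_prod fun i => h (σ i) (τ i)).const_mul _

/-- Andréief's identity. -/
theorem integral_det_mul_det {f g : Fin n → E → 𝕜}
    (h : ∀ a b, Integrable (fun x => f a x * g b x) μ) :
    ∫ x : Fin n → E, (of fun a i => f a (x i)).det * (of fun a i => g a (x i)).det
      ∂(Measure.pi fun _ => μ) =
      (n.factorial : 𝕜) * (of fun a b => ∫ x, f a x * g b x ∂μ).det := by
  have hi : ∀ σ τ : Perm (Fin n), Integrable (fun x : Fin n → E =>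
      ((Perm.sign σ : ℤ) : 𝕜) * ((Perm.sign τ : ℤ) : 𝕜) *
          ∏ i, (f (σ i) (x i) * g (τ i) (x i))) (Measure.pi fun _ => μ) := fun σ τ =>
    (Integrable.fintype_prod fun i => h (σ i) (τ i)).const_mul _
  set A : Matrix (Fin n) (Fin n) 𝕜 := of fun a b => ∫ x, f a x * g b x ∂μ with hA
  simp only [det_mul_det_eq_sum]
  rw [integral_finsetSum _ fun σ _ => integrable_finsetSum _ fun τ _ => hi σ τ]
  -- For fixed `σ` the sum over `τ` is the determinant with rows permuted by `σ`, and the sign of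
  -- `σ` undoes the permutation; hence `n!` equal terms.
  have hs : ∀ σ : Perm (Fin n), ∫ x : Fin n → E, ∑ τ : Perm (Fin n),
      ((Perm.sign σ : ℤ) : 𝕜) * ((Perm.sign τ : ℤ) : 𝕜) *
          ∏ i, (f (σ i) (x i) * g (τ i) (x i)) ∂(Measure.pi fun _ => μ) = A.det := fun σ => by
    rw [integral_finsetSum _ fun τ _ => hi σ τ]
    have h1 : ((Perm.sign σ : ℤ) : 𝕜) * (A.submatrix σ id).det = A.det := by
      rw [det_permute, ← mul_assoc, ← Int.cast_mul, Int.units_coe_mul_self, Int.cast_one, one_mul]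
    rw [← h1, ← det_transpose, det_apply', Finset.mul_sum]
    refine Finset.sum_congr rfl fun τ _ => ?_
    rw [integral_const_mul, mul_assoc]
    congr 2
    exact integral_fintype_prod_eq_prod fun i x => f (σ i) x * g (τ i) x
  simp only [hs, Finset.sum_const, Finset.card_univ, Fintype.card_perm, Fintype.card_fin,
    nsmul_eq_mul]

end Andreief

/-! ### Orthogonality of monomials for a radial weight. -/

section Moments

open ComplexConjugate

lemma integral_stdComplexNormal {V : Type*} [NormedAddCommGroup V] [NormedSpace ℝ V] (f : ℂ → V) :
    ∫ z, f z ∂stdComplexNormal = ∫ z, (π⁻¹ * rexp (-‖z‖ ^ 2)) • f z := by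
  rw [stdComplexNormal, integral_withDensity_eq_integral_toReal_smul (by fun_prop)
    (ae_of_all _ fun _ => ENNReal.ofReal_lt_top)]
  refine integral_congr_ae (ae_of_all _ fun z => ?_)
  simp only
  rw [ENNReal.toReal_ofReal (by positivity)]

lemma integral_norm_rpow_stdComplexNormal {q : ℝ} (hq : -2 < q) :
    ∫ z, ‖z‖ ^ q ∂stdComplexNormal = Real.Gamma (q / 2 + 1) := by
  have h := Complex.integral_rpow_mul_exp_neg_rpow (p := 2) (by norm_num) hq
  simp only [rpow_two] at h
  simp_rw [integral_stdComplexNormal, smul_eq_mul, mul_assoc, integral_const_mul,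
    mul_comm (rexp _)]
  rw [h, add_div, div_self two_ne_zero]
  field_simp

lemma integrable_norm_rpow_stdComplexNormal {q : ℝ} (hq : -2 < q) :
    Integrable (fun z : ℂ => ‖z‖ ^ q) stdComplexNormal := by
  by_contra h
  have := integral_undef h
  rw [integral_norm_rpow_stdComplexNormal hq] at this
  exact (Gamma_pos_of_pos (by linarith)).ne' this

/-- The summands of the inner product of two monomials in `L²(|z|^{2γ} dν)`. -/
lemma norm_rpow_mul_pow_mul_conj_pow (γ : ℝ) (i j : ℕ) (hγ : 0 ≤ γ) (z : ℂ) :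
    ‖((‖z‖ ^ (2 * γ) : ℝ) : ℂ) * (z ^ i * conj z ^ j)‖ = ‖z‖ ^ (2 * γ + i + j) := by
  rw [norm_mul, norm_mul, norm_pow, norm_pow, Complex.norm_conj, Complex.norm_real,
    norm_of_nonneg (by positivity), rpow_add_of_nonneg (norm_nonneg _) (by positivity)
      (by positivity), rpow_add_of_nonneg (norm_nonneg _) (by positivity) (by positivity),
    rpow_natCast, rpow_natCast, mul_assoc]

lemma integrable_monomial_mul_conj {γ : ℝ} (hγ : 0 ≤ γ) (i j : ℕ) :
    Integrable (fun z : ℂ => ((‖z‖ ^ (2 * γ) : ℝ) : ℂ) * (z ^ i * conj z ^ j))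
      stdComplexNormal := by
  refine (integrable_norm_rpow_stdComplexNormal (q := 2 * γ + i + j) ?_).mono'
    (Measurable.aestronglyMeasurable (by fun_prop)) (ae_of_all _ fun z => ?_)
  · have : (0 : ℝ) ≤ 2 * γ + i + j := by positivity
    linarith
  · exact (norm_rpow_mul_pow_mul_conj_pow γ i j hγ z).le

lemma integral_monomial_mul_conj {γ : ℝ} (hγ : 0 ≤ γ) (i j : ℕ) :
    ∫ z, ((‖z‖ ^ (2 * γ) : ℝ) : ℂ) * (z ^ i * conj z ^ j) ∂stdComplexNormal =
      if i = j then (Real.Gamma (γ + i + 1) : ℂ) else 0 := by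
  split_ifs with h
  · subst h
    have h1 : ∀ z : ℂ, ((‖z‖ ^ (2 * γ) : ℝ) : ℂ) * (z ^ i * conj z ^ i) =
        ((‖z‖ ^ (2 * (γ + i)) : ℝ) : ℂ) := fun z => by
      rw [← mul_pow, Complex.mul_conj, Complex.normSq_eq_norm_sq, mul_add,
        rpow_add_of_nonneg (norm_nonneg _) (by positivity) (by positivity), rpow_mul (norm_nonneg z) 2 i,
        rpow_natCast, rpow_two]
      push_cast
      rfl
    simp_rw [h1]
    rw [integral_complex_ofReal, integral_norm_rpow_stdComplexNormal]
    · rw [mul_div_cancel_left₀ _ two_ne_zero]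
    · have : (0 : ℝ) ≤ 2 * (γ + i) := by positivity
      linarith
  · set f : ℂ → ℂ := fun z => ((‖z‖ ^ (2 * γ) : ℝ) : ℂ) * (z ^ i * conj z ^ j) with hf
    have hij : ((i : ℝ) - j) ≠ 0 := sub_ne_zero.2 (by exact_mod_cast h)
    -- A rotation chosen so that `c^(i - j) = -1`: the invariant integral equals its own negative.
    set c : Circle := Circle.exp (π / (i - j)) with hc
    have hcc : (c : ℂ) ^ i * conj (c : ℂ) ^ j = -1 := by
      rw [hc, Circle.coe_exp, ← Complex.exp_conj, ← Complex.exp_nat_mul, ← Complex.exp_nat_mul,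
        ← Complex.exp_add, ← Complex.exp_pi_mul_I]
      congr 1
      have : ((i : ℂ) - j) ≠ 0 := by exact_mod_cast hij
      simp only [map_mul, Complex.conj_I, Complex.conj_ofReal]
      push_cast
      field_simp
      ring
    have hfc : ∀ z, f (rotation c z) = - f z := fun z => by
      simp only [hf, rotation_apply, norm_mul, Circle.norm_coe, one_mul, map_mul, mul_pow]
      linear_combination ((‖z‖ ^ (2 * γ) : ℝ) : ℂ) * (z ^ i * conj z ^ j) * hcc
    have hI := (rotation c).measurePreserving.integral_comp'
      (f := (rotation c).toHomeomorph.toMeasurableEquiv)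
      (g := fun z => (π⁻¹ * rexp (-‖z‖ ^ 2)) • f z)
    have hI' : ∫ z, (π⁻¹ * rexp (-‖rotation c z‖ ^ 2)) • f (rotation c z) =
      ∫ z, (π⁻¹ * rexp (-‖z‖ ^ 2)) • f z := hI
    simp only [hfc, LinearIsometryEquiv.norm_map, smul_neg, integral_neg] at hI'
    rw [integral_stdComplexNormal]
    exact self_eq_neg.1 hI'.symm

end Moments

/-! ### Gram determinants of shifted powers and the duality from size `n` to size `k`. -/

section Gram

open Matrix Polynomial ComplexConjugate

section Pascal

variable {R : Type*} [CommRing R]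

/-- The matrix of the substitution `X ↦ X + u` on polynomials of degree less than `M`. -/
noncomputable def pascal (M : ℕ) (u : R) : Matrix (Fin M) (Fin M) R :=
  of fun m j => ((X + C u) ^ (m : ℕ)).coeff j

lemma pascal_apply (M : ℕ) (u : R) (m j : Fin M) :
    pascal M u m j = u ^ ((m : ℕ) - j) * ((m : ℕ).choose j : R) :=
  coeff_X_add_C_pow u m j

lemma sum_coeff_mul_pow_of_natDegree_lt {S : Type*} [CommRing S] [Algebra R S] {M : ℕ} {p : R[X]}
    (hp : p.natDegree < M) (x : S) :
    ∑ j : Fin M, algebraMap R S (p.coeff j) * x ^ (j : ℕ) = aeval x p := by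
  rw [aeval_def, eval₂_eq_sum_range' _ hp, Finset.sum_range]

lemma natDegree_X_add_C_pow_le (u : R) (m : ℕ) : ((X + C u) ^ m).natDegree ≤ m := by
  refine natDegree_pow_le.trans ?_
  calc m * (X + C u).natDegree ≤ m * 1 := Nat.mul_le_mul_left _
        (natDegree_add_le_of_degree_le natDegree_X_le ((natDegree_C u).le.trans zero_le_one))
    _ = m := mul_one m

lemma sum_pascal_mul_pow {M : ℕ} (u x : R) (m : Fin M) :
    ∑ j, pascal M u m j * x ^ (j : ℕ) = (x + u) ^ (m : ℕ) := by
  have h := sum_coeff_mul_pow_of_natDegree_lt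
    ((natDegree_X_add_C_pow_le u m).trans_lt m.2) x
  simpa [pascal] using h

lemma pascal_mul_pascal (M : ℕ) (u v : R) : pascal M u * pascal M v = pascal M (u + v) := by
  ext m l
  have h := congrArg (fun p => coeff p (l : ℕ)) (sum_coeff_mul_pow_of_natDegree_lt
    ((natDegree_X_add_C_pow_le u m).trans_lt m.2) (X + C v))
  simp only [finsetSum_coeff, algebraMap_eq, coeff_C_mul, map_pow, map_add, aeval_X, aeval_C] at h
  simp only [mul_apply, pascal, of_apply, C_add]
  rw [h, add_assoc, add_comm (C v)]

lemma pascal_zero (M : ℕ) : pascal M (0 : R) = 1 := by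
  ext m j
  simp [pascal, coeff_X_pow, one_apply, Fin.ext_iff, eq_comm]

lemma det_pascal (M : ℕ) (u : R) : (pascal M u).det = 1 := by
  rw [det_of_isLowerTriangular]
  · simp [pascal_apply]
  · intro i j hij
    have : (i : ℕ) < j := hij
    simp [pascal_apply, Nat.choose_eq_zero_of_lt this]

/-- Jacobi's identity for the complementary minors of the inverse matrix. -/
lemma det_mul_det_toBlocks₁₁ {l m : Type*} [Fintype l] [Fintype m] [DecidableEq l] [DecidableEq m]
    {A B : Matrix (l ⊕ m) (l ⊕ m) R} (h : A * B = 1) :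
    A.det * B.toBlocks₁₁.det = A.toBlocks₂₂.det := by
  have hA := fromBlocks_toBlocks A
  have hB := fromBlocks_toBlocks B
  rw [← hA, ← hB, fromBlocks_multiply, ← fromBlocks_one, fromBlocks_inj] at h
  have h2 : A * fromBlocks B.toBlocks₁₁ 0 B.toBlocks₂₁ 1 =
      fromBlocks 1 A.toBlocks₁₂ 0 A.toBlocks₂₂ := by
    conv_lhs => rw [← hA]
    rw [fromBlocks_multiply, h.1, h.2.2.1]
    simp
  have h3 := congrArg det h2
  rwa [det_mul, det_fromBlocks_zero₁₂, det_fromBlocks_zero₂₁, det_one, det_one, mul_one,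
    one_mul] at h3

lemma det_natAdd_of_mul_eq_one {k n : ℕ} {A B : Matrix (Fin (k + n)) (Fin (k + n)) R}
    (h : A * B = 1) :
    (A.submatrix (Fin.natAdd k) (Fin.natAdd k) : Matrix (Fin n) (Fin n) R).det =
      A.det * (B.submatrix (Fin.castAdd n) (Fin.castAdd n)).det := by
  have h' : A.submatrix finSumFinEquiv finSumFinEquiv * B.submatrix finSumFinEquiv finSumFinEquiv =
      (1 : Matrix (Fin k ⊕ Fin n) (Fin k ⊕ Fin n) R) := by
    rw [submatrix_mul_equiv, h, submatrix_one_equiv]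
  have := det_mul_det_toBlocks₁₁ h'
  rw [det_submatrix_equiv_self] at this
  exact this.symm

end Pascal

lemma integrable_shifted_monomial {γ : ℝ} (hγ : 0 ≤ γ) (u : ℂ) (a b : ℕ) :
    Integrable (fun z : ℂ => (((‖z‖ ^ (2 * γ) : ℝ) : ℂ) * (z - u) ^ a) * conj (z - u) ^ b)
      stdComplexNormal := by
  have h : ∀ z : ℂ, (((‖z‖ ^ (2 * γ) : ℝ) : ℂ) * (z - u) ^ a) * conj (z - u) ^ b =
      ∑ i ∈ Finset.range (a + 1), ∑ j ∈ Finset.range (b + 1),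
        ((-u) ^ (a - i) * a.choose i * ((-conj u) ^ (b - j) * b.choose j)) *
          (((‖z‖ ^ (2 * γ) : ℝ) : ℂ) * (z ^ i * conj z ^ j)) := fun z => by
    rw [map_sub, sub_eq_add_neg z, sub_eq_add_neg (conj z), add_pow, add_pow, mul_assoc,
      Finset.sum_mul_sum, Finset.mul_sum]
    refine Finset.sum_congr rfl fun i _ => ?_
    rw [Finset.mul_sum]
    refine Finset.sum_congr rfl fun j _ => ?_
    ring
  simp_rw [h]
  exact integrable_finsetSum _ fun i _ => integrable_finsetSum _ fun j _ =>
    (integrable_monomial_mul_conj hγ i j).const_mul _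

/-- Expanding the shifted powers in orthogonal monomials puts the squared norms `Γ(γ + j + 1)` on
the diagonal and binomial coefficients in unitriangular factors. -/
lemma gram_shifted_monomial {γ : ℝ} (hγ : 0 ≤ γ) (u : ℂ) (M : ℕ) :
    (of fun a b : Fin M => ∫ z : ℂ, (((‖z‖ ^ (2 * γ) : ℝ) : ℂ) * (z - u) ^ (a : ℕ)) *
      conj (z - u) ^ (b : ℕ) ∂stdComplexNormal) =
    pascal M (-u) * diagonal (fun j : Fin M => (Real.Gamma (γ + j + 1) : ℂ)) *
      (pascal M (-u))ᴴ := by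
  ext a b
  have h : ∀ z : ℂ, (((‖z‖ ^ (2 * γ) : ℝ) : ℂ) * (z - u) ^ (a : ℕ)) * conj (z - u) ^ (b : ℕ) =
      ∑ i, ∑ j, (pascal M (-u) a i * conj (pascal M (-u) b j)) *
          (((‖z‖ ^ (2 * γ) : ℝ) : ℂ) * (z ^ (i : ℕ) * conj z ^ (j : ℕ))) := fun z => by
    rw [← map_pow, sub_eq_add_neg, ← sum_pascal_mul_pow, ← sum_pascal_mul_pow, map_sum,
      mul_assoc, Finset.sum_mul_sum, Finset.mul_sum]
    refine Finset.sum_congr rfl fun i _ => ?_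
    rw [Finset.mul_sum]
    refine Finset.sum_congr rfl fun j _ => ?_
    rw [map_mul, map_pow]
    ring
  have hi : ∀ i j : Fin M, Integrable (fun z : ℂ =>
      (pascal M (-u) a i * conj (pascal M (-u) b j)) *
        (((‖z‖ ^ (2 * γ) : ℝ) : ℂ) * (z ^ (i : ℕ) * conj z ^ (j : ℕ)))) stdComplexNormal :=
    fun i j => (integrable_monomial_mul_conj hγ i j).const_mul _
  simp only [of_apply, h]
  rw [integral_finsetSum _ fun i _ => integrable_finsetSum _ fun j _ => hi i j, mul_apply]
  refine Finset.sum_congr rfl fun i _ => ?_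
  rw [integral_finsetSum _ fun j _ => hi i j,
    mul_diagonal, conjTranspose_apply, Finset.sum_eq_single i]
  · rw [integral_const_mul, integral_monomial_mul_conj hγ, if_pos rfl]
    simp only [RCLike.star_def]
    ring
  · intro j _ hj
    rw [integral_const_mul, integral_monomial_mul_conj hγ, if_neg fun h => hj (Fin.ext h.symm),
      mul_zero]
  · simp

/-- The matrix whose determinant is the finite size correlator. -/
noncomputable def dualKernel (γ : ℝ) (k M : ℕ) (u : ℂ) : Matrix (Fin k) (Fin k) ℂ :=
  of fun a b => ∑ j ∈ Finset.range M, conj (u ^ (j - a) * (j.choose a : ℂ)) *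
    (u ^ (j - b) * (j.choose b : ℂ)) / (Real.Gamma (γ + j + 1) : ℂ)

/-- The factor `(z - u)^k` removes the first `k` powers, leaving the lower right minor of the Gram
matrix of size `k + n`. By Jacobi's identity it is the full determinant times the upper left `k × k`
minor of the inverse, which is explicit because shifting by `u` inverts shifting by `-u`. -/
lemma det_gram_shifted_monomial {γ : ℝ} (hγ : 0 ≤ γ) (u : ℂ) (k n : ℕ) :
    (of fun a b : Fin n => ∫ z : ℂ, (((‖z‖ ^ (2 * γ) : ℝ) : ℂ) * (z - u) ^ (k + a : ℕ)) *
      conj (z - u) ^ (k + b : ℕ) ∂stdComplexNormal).det =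
    (∏ j ∈ Finset.range (k + n), (Real.Gamma (γ + j + 1) : ℂ)) *
      (dualKernel γ k (k + n) u).det := by
  have hG : ∀ j : ℕ, (Real.Gamma (γ + j + 1) : ℂ) ≠ 0 := fun j =>
    Complex.ofReal_ne_zero.2 (Gamma_pos_of_pos (by positivity)).ne'
  set D : Fin (k + n) → ℂ := fun j => (Real.Gamma (γ + j + 1) : ℂ) with hD
  have hYX : pascal (k + n) u * pascal (k + n) (-u) = 1 := by
    rw [pascal_mul_pascal, add_neg_cancel, pascal_zero]
  have hXY : pascal (k + n) (-u) * pascal (k + n) u = 1 := by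
    rw [pascal_mul_pascal, neg_add_cancel, pascal_zero]
  have hDD : diagonal D * diagonal D⁻¹ = 1 := by
    rw [diagonal_mul_diagonal, ← diagonal_one]
    congr 1
    ext j
    exact mul_inv_cancel₀ (hG j)
  have hAB : (pascal (k + n) (-u) * diagonal D * (pascal (k + n) (-u))ᴴ) *
      ((pascal (k + n) u)ᴴ * diagonal D⁻¹ * pascal (k + n) u) = 1 := by
    have h1 : (pascal (k + n) (-u))ᴴ * (pascal (k + n) u)ᴴ = 1 := by
      rw [← conjTranspose_mul, hYX, conjTranspose_one]
    calc _ = pascal (k + n) (-u) * (diagonal D * ((pascal (k + n) (-u))ᴴ * (pascal (k + n) u)ᴴ) *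
          diagonal D⁻¹) * pascal (k + n) u := by simp only [Matrix.mul_assoc]
      _ = 1 := by rw [h1, Matrix.mul_one, hDD, Matrix.mul_one, hXY]
  have hJ := det_natAdd_of_mul_eq_one hAB
  rw [← gram_shifted_monomial hγ] at hJ
  refine hJ.trans ?_
  rw [gram_shifted_monomial hγ, det_mul, det_mul, det_conjTranspose, det_pascal, det_diagonal,
    star_one, one_mul, mul_one, Finset.prod_range]
  congr 2
  ext a b
  rw [submatrix_apply, mul_apply, dualKernel, of_apply, Finset.sum_range]
  refine Finset.sum_congr rfl fun j _ => ?_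
  rw [mul_diagonal]
  simp only [conjTranspose_apply, pascal_apply, Fin.val_castAdd, Pi.inv_apply, RCLike.star_def, hD,
    div_eq_mul_inv]
  ring

end Gram

/-! ### The exact finite-size formula for the correlator. -/

section Correlator

open Matrix Polynomial ComplexConjugate

lemma ofReal_norm_rpow {γ : ℝ} (hγ : 0 ≤ γ) (z : ℂ) :
    ENNReal.ofReal (‖z‖ ^ γ) = ‖z‖ₑ ^ γ := by
  rw [← ofReal_norm, ENNReal.ofReal_rpow_of_nonneg (norm_nonneg _) hγ]

/-- The unnormalised eigenvalue density of the Ginibre ensemble weighted by the characteristic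
polynomials. -/
noncomputable def chargedWeight (γ : ℝ) (k : ℕ) (u : ℂ) {n : ℕ} (x : Fin n → ℂ) : ℝ :=
  (∏ i, ‖x i‖ ^ (2 * γ) * ‖x i - u‖ ^ (2 * k)) * ∏ i, ∏ j ∈ Finset.Ioi i, ‖x i - x j‖ ^ 2

/-- Common factors leave each column, and the Vandermonde determinant is invariant under translation
of the nodes. -/
lemma det_mul_vandermonde_shift {n : ℕ} (u : ℂ) (k : ℕ) (c : ℂ → ℂ) (x : Fin n → ℂ) :
    (of fun a i : Fin n => c (x i) * (x i - u) ^ (k + a : ℕ)).det =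
      (∏ i, c (x i) * (x i - u) ^ k) * ∏ i, ∏ j ∈ Finset.Ioi i, (x j - x i) := by
  rw [← det_vandermonde, ← det_vandermonde_sub x u, ← det_transpose (vandermonde _),
    ← det_mul_row]
  congr 1
  ext a i
  simp [pow_add, mul_assoc]

lemma det_mul_det_eq_chargedWeight {n : ℕ} (γ : ℝ) (k : ℕ) (u : ℂ) (x : Fin n → ℂ) :
    (of fun a i : Fin n => ((‖x i‖ ^ (2 * γ) : ℝ) : ℂ) * (x i - u) ^ (k + a : ℕ)).det *
      (of fun a i : Fin n => conj (x i - u) ^ (k + a : ℕ)).det =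
      ((chargedWeight γ k u x : ℝ) : ℂ) := by
  have h1 := det_mul_vandermonde_shift u k (fun z => ((‖z‖ ^ (2 * γ) : ℝ) : ℂ)) x
  have h2 := congrArg conj (det_mul_vandermonde_shift u k (fun _ => 1) x)
  rw [RingHom.map_det] at h2
  have h3 : (of fun a i : Fin n => conj (x i - u) ^ (k + a : ℕ)) =
      (RingHom.mapMatrix (starRingEnd ℂ)) (of fun a i : Fin n => 1 * (x i - u) ^ (k + a : ℕ)) := by
    ext a i
    simp
  rw [h1, h3, h2]
  simp only [map_mul, map_prod, one_mul, map_pow]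
  have h4 : ∀ z : ℂ, z * conj z = ((‖z‖ ^ 2 : ℝ) : ℂ) := fun z => by
    rw [Complex.mul_conj, Complex.normSq_eq_norm_sq]
  rw [mul_mul_mul_comm, ← Finset.prod_mul_distrib, ← Finset.prod_mul_distrib, chargedWeight,
    Complex.ofReal_mul, Complex.ofReal_prod, Complex.ofReal_prod]
  congr 1
  · refine Finset.prod_congr rfl fun i _ => ?_
    rw [mul_assoc, ← mul_pow, h4, Complex.ofReal_mul, ← Complex.ofReal_pow, ← pow_mul]
  · refine Finset.prod_congr rfl fun i _ => ?_
    rw [← Finset.prod_mul_distrib, Complex.ofReal_prod]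
    refine Finset.prod_congr rfl fun j _ => ?_
    rw [h4, norm_sub_rev]

lemma integrable_chargedWeight {γ : ℝ} (hγ : 0 ≤ γ) (k : ℕ) (u : ℂ) (n : ℕ) :
    Integrable (fun x : Fin n → ℂ => chargedWeight γ k u x)
      (Measure.pi fun _ => stdComplexNormal) := by
  have h := integrable_det_mul_det (μ := stdComplexNormal) (n := n)
    (f := fun a z => ((‖z‖ ^ (2 * γ) : ℝ) : ℂ) * (z - u) ^ (k + a : ℕ))
    (g := fun b z => conj (z - u) ^ (k + b : ℕ))
    (fun a b => integrable_shifted_monomial hγ u _ _)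
  simp only [det_mul_det_eq_chargedWeight] at h
  exact h.re

lemma integral_chargedWeight {γ : ℝ} (hγ : 0 ≤ γ) (k : ℕ) (u : ℂ) (n : ℕ) :
    ∫ x : Fin n → ℂ, chargedWeight γ k u x ∂(Measure.pi fun _ => stdComplexNormal) =
      n.factorial * ((∏ j ∈ Finset.range (k + n), Real.Gamma (γ + j + 1)) *
        (dualKernel γ k (k + n) u).det.re) := by
  have h := integral_det_mul_det (μ := stdComplexNormal) (n := n)
    (f := fun a z => ((‖z‖ ^ (2 * γ) : ℝ) : ℂ) * (z - u) ^ (k + a : ℕ))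
    (g := fun b z => conj (z - u) ^ (k + b : ℕ))
    (fun a b => integrable_shifted_monomial hγ u _ _)
  simp only [det_mul_det_eq_chargedWeight] at h
  rw [integral_complex_ofReal, det_gram_shifted_monomial hγ] at h
  have h2 := congrArg Complex.re h
  rw [Complex.ofReal_re, ← Complex.ofReal_natCast, Complex.re_ofReal_mul, ← Complex.ofReal_prod,
    Complex.re_ofReal_mul] at h2
  exact h2

lemma chargedWeight_nonneg (γ : ℝ) (k : ℕ) (u : ℂ) {n : ℕ} (x : Fin n → ℂ) :
    0 ≤ chargedWeight γ k u x :=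
  mul_nonneg (Finset.prod_nonneg fun _ _ => by positivity)
    (Finset.prod_nonneg fun _ _ => Finset.prod_nonneg fun _ _ => by positivity)

lemma ofReal_chargedWeight {γ : ℝ} (hγ : 0 ≤ γ) (k : ℕ) (u : ℂ) {n : ℕ} (x : Fin n → ℂ) :
    ENNReal.ofReal (chargedWeight γ k u x) =
      (∏ i, ‖0 - x i‖ₑ ^ (2 * γ) * ‖u - x i‖ₑ ^ (2 * k)) *
        ∏ i, ∏ j ∈ Finset.Ioi i, ‖x i - x j‖ₑ ^ 2 := by
  rw [chargedWeight, ENNReal.ofReal_mul (Finset.prod_nonneg fun _ _ => by positivity),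
    ENNReal.ofReal_prod_of_nonneg fun _ _ => by positivity,
    ENNReal.ofReal_prod_of_nonneg fun _ _ => Finset.prod_nonneg fun _ _ => by positivity]
  congr 1
  · refine Finset.prod_congr rfl fun i _ => ?_
    rw [ENNReal.ofReal_mul (by positivity), ofReal_norm_rpow (by positivity), zero_sub, enorm_neg,
      ENNReal.ofReal_pow (norm_nonneg _), ofReal_norm, ← enorm_neg (x i - u), neg_sub]
  · refine Finset.prod_congr rfl fun i _ => ?_
    rw [ENNReal.ofReal_prod_of_nonneg fun _ _ => by positivity]
    refine Finset.prod_congr rfl fun j _ => ?_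
    rw [ENNReal.ofReal_pow (norm_nonneg _), ofReal_norm]

lemma lintegral_chargedWeight {γ : ℝ} (hγ : 0 ≤ γ) (k : ℕ) (u : ℂ) (n : ℕ) :
    ∫⁻ x : Fin n → ℂ, (∏ i, ‖0 - x i‖ₑ ^ (2 * γ) * ‖u - x i‖ₑ ^ (2 * k)) *
        ∏ i, ∏ j ∈ Finset.Ioi i, ‖x i - x j‖ₑ ^ 2 ∂(Measure.pi fun _ => stdComplexNormal) =
      ENNReal.ofReal (n.factorial * ((∏ j ∈ Finset.range (k + n), Real.Gamma (γ + j + 1)) *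
        (dualKernel γ k (k + n) u).det.re)) := by
  rw [← integral_chargedWeight hγ, ofReal_integral_eq_lintegral_ofReal
    (integrable_chargedWeight hγ k u n) (ae_of_all _ fun x => chargedWeight_nonneg γ k u x)]
  simp only [ofReal_chargedWeight hγ]

/-- This is the case without charges, where the dual determinant is empty. -/
lemma ginibrePartition_eq (n : ℕ) :
    ginibrePartition n =
      ENNReal.ofReal (n.factorial * ∏ j ∈ Finset.range n, (j.factorial : ℝ)) := by
  have h := lintegral_chargedWeight le_rfl 0 0 n
  simp only [mul_zero, ENNReal.rpow_zero, pow_zero, mul_one, Finset.prod_const_one, one_mul,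
    det_isEmpty, Complex.one_re, zero_add, Real.Gamma_nat_eq_factorial] at h
  exact h

lemma norm_eval_charpoly {n : ℕ} (M : Matrix (Fin n) (Fin n) ℂ) (z : ℂ) :
    ‖M.charpoly.eval z‖ = ‖(M - z • (1 : Matrix (Fin n) (Fin n) ℂ)).det‖ := by
  rw [eval_charpoly, ← neg_sub (M : Matrix (Fin n) (Fin n) ℂ), det_neg, norm_mul, norm_pow,
    norm_neg, norm_one, one_pow, one_mul, smul_one_eq_diagonal, scalar_apply]

lemma lintegral_charPolyProduct {γ : ℝ} (hγ : 0 ≤ γ) (k : ℕ) (u : ℂ) (n : ℕ) :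
    ∫⁻ X : Fin n → Fin n → ℂ, ENNReal.ofReal (charPolyProduct γ k 0 u X)
        ∂(Measure.pi fun _ => Measure.pi fun _ => stdComplexNormal) =
      ENNReal.ofReal ((∏ j ∈ Finset.range (k + n), Real.Gamma (γ + j + 1)) /
        (∏ j ∈ Finset.range n, (j.factorial : ℝ)) * (dualKernel γ k (k + n) u).det.re) := by
  have h2γ : 0 ≤ 2 * γ := by positivity
  have hF := (isSpectralProduct_charpoly 0 (φ := fun a => a ^ (2 * γ)) (by fun_prop) (by simp)
    (fun a b => ENNReal.mul_rpow_of_nonneg a b h2γ)).mul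
    (isSpectralProduct_charpoly u (φ := fun a => a ^ (2 * k)) (by fun_prop) (by simp)
    (fun a b => mul_pow a b _))
  have h := hF.lintegral_stdComplexNormal n
  rw [lintegral_chargedWeight hγ, ginibrePartition_eq] at h
  have hp : 0 < ∏ j ∈ Finset.range n, (j.factorial : ℝ) :=
    Finset.prod_pos fun j _ => by positivity
  rw [← ENNReal.ofReal_inv_of_pos (by positivity), ← ENNReal.ofReal_mul (by positivity)] at h
  have h1 : ∀ X : Fin n → Fin n → ℂ, ENNReal.ofReal (charPolyProduct γ k 0 u X) =
      ‖eval 0 (of X).charpoly‖ₑ ^ (2 * γ) * ‖eval u (of X).charpoly‖ₑ ^ (2 * k) := fun X => by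
    rw [charPolyProduct, ENNReal.ofReal_mul (by positivity), ofReal_norm_rpow h2γ,
      ENNReal.ofReal_pow (norm_nonneg _), ofReal_norm, ← ofReal_norm,
      ← ofReal_norm, ← ofReal_norm, ← ofReal_norm, norm_eval_charpoly,
      norm_eval_charpoly]
  simp only [h1]
  rw [h]
  congr 1
  have : (n.factorial : ℝ) ≠ 0 := by positivity
  field_simp

lemma charPolyProduct_nonneg {n : ℕ} (γ : ℝ) (k : ℕ) (z u : ℂ) (X : Fin n → Fin n → ℂ) :
    0 ≤ charPolyProduct γ k z u X := by
  unfold charPolyProduct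
  positivity

lemma measurable_charPolyProduct {n : ℕ} (γ : ℝ) (k : ℕ) (z u : ℂ) :
    Measurable fun X : Fin n → Fin n → ℂ => charPolyProduct γ k z u X := by
  have h : ∀ w : ℂ, Measurable fun X : Fin n → Fin n → ℂ =>
      ‖(of X - w • (1 : Matrix (Fin n) (Fin n) ℂ)).det‖ := fun w => by
    simp_rw [← norm_eval_charpoly]
    exact (measurable_eval_charpoly measurable_id measurable_const).norm
  unfold charPolyProduct
  exact ((h z).pow_const _).mul ((h u).pow_const _)

lemma integrable_charPolyProduct {γ : ℝ} (hγ : 0 ≤ γ) (k : ℕ) (u : ℂ) (n : ℕ) :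
    Integrable (fun X : Fin n → Fin n → ℂ => charPolyProduct γ k 0 u X)
      (Measure.pi fun _ => Measure.pi fun _ => stdComplexNormal) := by
  refine ⟨(measurable_charPolyProduct γ k 0 u).aestronglyMeasurable, ?_⟩
  rw [hasFiniteIntegral_iff_ofReal (ae_of_all _ fun X => charPolyProduct_nonneg γ k 0 u X),
    lintegral_charPolyProduct hγ]
  exact ENNReal.ofReal_lt_top

lemma charPolyProduct_smul {n : ℕ} (γ : ℝ) (k : ℕ) (u : ℂ) {c : ℝ} (hc : 0 < c)
    (X : Fin n → Fin n → ℂ) :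
    charPolyProduct γ k 0 (c * u) ((c : ℂ) • X) =
      c ^ (2 * (γ + k) * n) * charPolyProduct γ k 0 u X := by
  have h : ∀ w : ℂ, ‖(of ((c : ℂ) • X) - ((c : ℂ) * w) • (1 : Matrix (Fin n) (Fin n) ℂ)).det‖ =
      c ^ n * ‖(of X - w • (1 : Matrix (Fin n) (Fin n) ℂ)).det‖ := fun w => by
    have : of ((c : ℂ) • X) - ((c : ℂ) * w) • (1 : Matrix (Fin n) (Fin n) ℂ) =
        (c : ℂ) • (of X - w • (1 : Matrix (Fin n) (Fin n) ℂ)) := by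
      rw [smul_sub, smul_smul]; rfl
    rw [this, det_smul, norm_mul, norm_pow, Complex.norm_real, norm_of_nonneg hc.le,
      Fintype.card_fin]
  have h0 := h 0
  rw [mul_zero] at h0
  rw [charPolyProduct, charPolyProduct, h0, h u, mul_rpow (by positivity) (norm_nonneg _), mul_pow,
    ← rpow_natCast c n, ← rpow_mul hc.le, ← rpow_natCast (c ^ (n : ℝ)), ← rpow_mul hc.le,
    mul_mul_mul_comm, ← rpow_add hc]
  congr 2
  push_cast
  ring

lemma integrable_charPolyProduct_ginibre {γ : ℝ} (hγ : 0 ≤ γ) (k : ℕ) {N : ℕ} (hN : 1 ≤ N)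
    (u : ℂ) : Integrable (charPolyProduct γ k 0 (u / (√(N : ℝ) : ℂ))) (ginibre N) := by
  have hc : 0 < (√(N : ℝ))⁻¹ := by positivity
  rw [ginibre, integrable_map_measure
    (measurable_charPolyProduct γ k 0 _).aestronglyMeasurable (by fun_prop)]
  have h : (charPolyProduct γ k 0 (u / (√(N : ℝ) : ℂ)) ∘
      fun X : Fin N → Fin N → ℂ => (((√(N : ℝ))⁻¹ : ℝ) : ℂ) • X) = fun X =>
      (√(N : ℝ))⁻¹ ^ (2 * (γ + k) * N) * charPolyProduct γ k 0 u X := by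
    funext X
    rw [← charPolyProduct_smul γ k u hc X, Function.comp_apply, div_eq_inv_mul,
      Complex.ofReal_inv]
  rw [h]
  exact (integrable_charPolyProduct hγ k u N).const_mul _

/-- The finite size formula for the correlator. -/
lemma twoChargeCorrelator_eq {γ : ℝ} (hγ : 0 ≤ γ) (k : ℕ) {N : ℕ} (hN : 1 ≤ N) (u : ℂ) :
    twoChargeCorrelator N γ k 0 (u / (√(N : ℝ) : ℂ)) =
      (N : ℝ) ^ (-((γ + k) * N)) * ((∏ j ∈ Finset.range (k + N), Real.Gamma (γ + j + 1)) /
        (∏ j ∈ Finset.range N, (j.factorial : ℝ)) * (dualKernel γ k (k + N) u).det.re) := by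
  have hN0 : (0 : ℝ) < N := by exact_mod_cast hN
  have hc : 0 < (√(N : ℝ))⁻¹ := by positivity
  have h : ∀ X : Fin N → Fin N → ℂ, charPolyProduct γ k 0 (u / (√(N : ℝ) : ℂ))
      ((((√(N : ℝ))⁻¹ : ℝ) : ℂ) • X) =
      (√(N : ℝ))⁻¹ ^ (2 * (γ + k) * N) * charPolyProduct γ k 0 u X := fun X => by
    rw [← charPolyProduct_smul γ k u hc X, div_eq_inv_mul, Complex.ofReal_inv]
  rw [twoChargeCorrelator, ginibre, integral_map (by fun_prop)
    (measurable_charPolyProduct γ k 0 _).aestronglyMeasurable]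
  simp only [h]
  rw [integral_const_mul, integral_eq_lintegral_of_nonneg_ae
    (ae_of_all _ fun X => charPolyProduct_nonneg γ k 0 u X)
    (measurable_charPolyProduct γ k 0 u).aestronglyMeasurable, lintegral_charPolyProduct hγ,
    ENNReal.toReal_ofReal]
  · congr 1
    rw [inv_rpow (by positivity), sqrt_eq_rpow, ← rpow_mul hN0.le, ← rpow_neg hN0.le]
    congr 1
    ring
  · have h1 : 0 ≤ N.factorial * ((∏ j ∈ Finset.range (k + N), Real.Gamma (γ + j + 1)) *
        (dualKernel γ k (k + N) u).det.re) := by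
      rw [← integral_chargedWeight hγ]
      exact integral_nonneg fun x => chargedWeight_nonneg γ k u x
    have h2 : (0 : ℝ) < N.factorial := by positivity
    rw [div_mul_eq_mul_div]
    exact div_nonneg (nonneg_of_mul_nonneg_right h1 h2)
      (Finset.prod_nonneg fun j _ => by positivity)

end Correlator

/-! ### Real form of the dual determinant. -/

section ChargeKernel

open Matrix ComplexConjugate

lemma ring_choose_mul_Gamma (r : ℝ) : ∀ a : ℕ, 0 < r + 1 - a →
    Ring.choose r a * (a.factorial * Real.Gamma (r + 1 - a)) = Real.Gamma (r + 1)
  | 0, _ => by simp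
  | a + 1, h => by
    push_cast at h
    have ih := ring_choose_mul_Gamma r a (by linarith)
    have h1 : Real.Gamma (r + 1 - a) = (r - a) * Real.Gamma (r - a) := by
      rw [← Real.Gamma_add_one (by linarith : 0 < r - a).ne']
      ring_nf
    rw [← ih, h1, Ring.choose_eq_smul, Ring.choose_eq_smul, descPochhammer_succ_right,
      Polynomial.smeval_mul, Polynomial.smeval_sub, Polynomial.smeval_X,
      Polynomial.smeval_natCast, Nat.factorial_succ]
    have h2 : (a.factorial : ℝ) ≠ 0 := by positivity
    have h3 : r + 1 - ((a + 1 : ℕ) : ℝ) = r - a := by push_cast; ring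
    have h4 : ((a : ℝ) + 1) ≠ 0 := by positivity
    rw [h3]
    simp only [smul_eq_mul, pow_one, pow_zero, nsmul_eq_mul, mul_one, Nat.cast_mul, Nat.cast_add,
      Nat.cast_one]
    field_simp

/-- Chu–Vandermonde convolution, written as a row operation: a unitriangular matrix independent of
`j` replaces `j` by `γ + j` in the upper argument of the binomial. -/
lemma sum_ring_choose_mul_choose (γ : ℝ) (j : ℕ) {k : ℕ} (a : Fin k) :
    ∑ q : Fin k, (if (q : ℕ) ≤ a then Ring.choose γ ((a : ℕ) - q) else 0) * (j.choose q : ℝ) =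
      Ring.choose (γ + j) (a : ℕ) := by
  rw [add_comm γ, Ring.add_choose_eq _ (Commute.all _ _),
    Finset.Nat.sum_antidiagonal_eq_sum_range_succ
      (fun p q => Ring.choose (j : ℝ) p * Ring.choose γ q),
    ← Finset.sum_range (fun q => (if q ≤ (a : ℕ) then Ring.choose γ ((a : ℕ) - q) else 0) *
      (j.choose q : ℝ))]
  symm
  refine Finset.sum_subset_zero_on_sdiff (Finset.range_subset_range.2 a.2) (fun q hq => ?_)
    (fun q hq => ?_)
  · rw [if_neg, zero_mul]
    simp only [Finset.mem_sdiff, Finset.mem_range] at hq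
    omega
  · rw [Finset.mem_range] at hq
    rw [if_pos (by omega), Ring.choose_natCast, mul_comm]

/-- The real form of `dualKernel`. -/
noncomputable def chargeKernel (γ : ℝ) (k M : ℕ) (x : ℝ) : Matrix (Fin k) (Fin k) ℝ :=
  of fun a b => ∑ j ∈ Finset.range M,
    (j.choose b : ℝ) * x ^ (j - b) / ((a : ℕ).factorial * Real.Gamma (γ + j + 1 - a))

/-- Conjugation by the diagonal matrix of powers of `conj u` removes all phases. Then unitriangular
row operations turn `choose j a / Γ(γ + j + 1)` into `1 / (a! Γ(γ + j + 1 - a))`, the form produced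
by Beta integrals. The bound `k ≤ γ` keeps the Gamma arguments positive. -/
lemma det_dualKernel_of_ne_zero {γ : ℝ} {k : ℕ} (hγ : (k : ℝ) ≤ γ) (M : ℕ) {u : ℂ} (hu : u ≠ 0) :
    (dualKernel γ k M u).det = (((chargeKernel γ k M (‖u‖ ^ 2)).det : ℝ) : ℂ) := by
  set w : ℂ := conj u with hw
  have hw0 : w ≠ 0 := by simpa [hw] using hu
  set K : Matrix (Fin k) (Fin k) ℝ := of fun a b => ∑ j ∈ Finset.range M,
    (j.choose a : ℝ) * (j.choose b) * (‖u‖ ^ 2) ^ (j - b) / Real.Gamma (γ + j + 1) with hK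
  have h1 : dualKernel γ k M u = of fun a b : Fin k => (w ^ (a : ℕ))⁻¹ * (of fun a b : Fin k =>
      w ^ (b : ℕ) * (K.map Complex.ofReal) a b) a b := by
    ext a b
    simp only [dualKernel, of_apply, map_apply, hK, Complex.ofReal_sum, Finset.mul_sum]
    refine Finset.sum_congr rfl fun j _ => ?_
    push_cast
    rw [← Complex.mul_conj', mul_comm u, ← hw, map_mul, map_pow, ← hw, Complex.conj_natCast]
    by_cases ha : j < a
    · simp [Nat.choose_eq_zero_of_lt ha]
    by_cases hb : j < b
    · simp [Nat.choose_eq_zero_of_lt hb]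
    have h2 : w ^ (j - a) = (w ^ (a : ℕ))⁻¹ * w ^ (b : ℕ) * w ^ (j - b) := by
      rw [mul_assoc, ← pow_add, Nat.add_sub_cancel' (not_lt.1 hb), eq_inv_mul_iff_mul_eq₀
        (pow_ne_zero _ hw0), ← pow_add, Nat.add_sub_cancel' (not_lt.1 ha)]
    rw [h2, mul_pow]
    ring
  have h2 : (dualKernel γ k M u).det = (K.det : ℂ) := by
    rw [h1, det_mul_column, det_mul_row, ← mul_assoc, ← Finset.prod_mul_distrib]
    rw [Finset.prod_congr rfl fun a _ => inv_mul_cancel₀ (pow_ne_zero _ hw0), Finset.prod_const_one,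
      one_mul]
    exact (RingHom.map_det Complex.ofRealHom K).symm
  have h3 : chargeKernel γ k M (‖u‖ ^ 2) =
      (of fun a q : Fin k => if (q : ℕ) ≤ a then Ring.choose γ ((a : ℕ) - q) else 0) * K := by
    ext a b
    simp only [mul_apply, of_apply, hK, chargeKernel, Finset.mul_sum]
    rw [Finset.sum_comm]
    refine Finset.sum_congr rfl fun j _ => ?_
    have ha : (a : ℝ) + 1 ≤ k := by exact_mod_cast a.2
    have hG : 0 < Real.Gamma (γ + j + 1) := Gamma_pos_of_pos (by
      have h0 : (0 : ℝ) ≤ k := by positivity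
      have : 0 ≤ γ := h0.trans hγ
      positivity)
    have hG' : 0 < Real.Gamma (γ + j + 1 - a) := Gamma_pos_of_pos (by
      have : (0 : ℝ) ≤ j := by positivity
      linarith)
    have h4 := ring_choose_mul_Gamma (γ + j) a (by
      have : (0 : ℝ) ≤ j := by positivity
      linarith)
    have h5 : ((a : ℕ).factorial : ℝ) ≠ 0 := by positivity
    have h6 : ∀ q : Fin k, (if (q : ℕ) ≤ a then Ring.choose γ ((a : ℕ) - q) else 0) *
        ((j.choose q : ℝ) * (j.choose b) * (‖u‖ ^ 2) ^ (j - b) / Real.Gamma (γ + j + 1)) =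
        (if (q : ℕ) ≤ a then Ring.choose γ ((a : ℕ) - q) else 0) * (j.choose q : ℝ) *
        ((j.choose b) * (‖u‖ ^ 2) ^ (j - b) / Real.Gamma (γ + j + 1)) := fun q => by ring
    simp only [h6]
    rw [← Finset.sum_mul, sum_ring_choose_mul_choose, ← h4]
    have h7 : Ring.choose (γ + j) (a : ℕ) ≠ 0 := fun h => by
      rw [h, zero_mul] at h4
      exact hG.ne h4
    field_simp
  have hL : (of fun a q : Fin k =>
      if (q : ℕ) ≤ a then Ring.choose γ ((a : ℕ) - q) else 0).det = 1 := by
    rw [det_of_isLowerTriangular, Finset.prod_eq_one]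
    · intro a _
      simp
    · intro a q haq
      have : (a : ℕ) < q := haq
      rw [of_apply, if_neg this.not_ge]
  rw [h2, h3, det_mul, hL, one_mul]

/-- The diagonal conjugation degenerates at `u = 0`; there the identity follows by continuity. -/
lemma det_dualKernel {γ : ℝ} {k : ℕ} (hγ : (k : ℝ) ≤ γ) (M : ℕ) (u : ℂ) :
    (dualKernel γ k M u).det = (((chargeKernel γ k M (‖u‖ ^ 2)).det : ℝ) : ℂ) := by
  have h1 : Continuous fun u : ℂ => (dualKernel γ k M u).det := by
    refine Continuous.matrix_det (continuous_matrix fun a b => ?_)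
    simp only [dualKernel, of_apply]
    fun_prop
  have h2 : Continuous fun u : ℂ => (((chargeKernel γ k M (‖u‖ ^ 2)).det : ℝ) : ℂ) := by
    refine Complex.continuous_ofReal.comp
      (Continuous.matrix_det (continuous_matrix fun a b => ?_))
    simp only [chargeKernel, of_apply]
    fun_prop
  exact congrFun (h1.ext_on (dense_compl_singleton 0) h2
    fun v hv => det_dualKernel_of_ne_zero hγ M hv) u

end ChargeKernel

/-! ### Beta integral representation and limit of the kernel. -/

section BetaIntegral

open Matrix

lemma beta_kernel_aux {c : ℝ} (m : ℕ) : Set.EqOn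
    (fun s : ℝ => (s : ℂ) ^ (((m : ℂ) + 1) - 1) * (1 - (s : ℂ)) ^ ((c : ℂ) - 1))
    (fun s : ℝ => (((1 - s) ^ (c - 1) * s ^ m : ℝ) : ℂ)) (Set.Ioc 0 1) := fun s hs => by
  have h1 : (0 : ℝ) ≤ 1 - s := sub_nonneg.2 hs.2
  simp only [add_sub_cancel_right, Complex.cpow_natCast, Complex.ofReal_mul, Complex.ofReal_pow]
  rw [Complex.ofReal_cpow h1]
  push_cast
  ring

lemma integrableOn_beta_kernel {c : ℝ} (hc : 0 < c) (m : ℕ) :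
    IntegrableOn (fun s : ℝ => (1 - s) ^ (c - 1) * s ^ m) (Set.Ioc 0 1) := by
  have h := Complex.betaIntegral_convergent (u := (m : ℂ) + 1) (v := (c : ℂ))
    (by simp; positivity) (by simpa using hc)
  rw [intervalIntegrable_iff_integrableOn_Ioc_of_le zero_le_one,
    integrableOn_congr_fun (beta_kernel_aux m) measurableSet_Ioc] at h
  exact h.re

lemma integral_beta_kernel {c : ℝ} (hc : 0 < c) (m : ℕ) :
    ∫ s in Set.Ioc (0 : ℝ) 1, (1 - s) ^ (c - 1) * s ^ m =
      Real.Gamma c * m.factorial / Real.Gamma (c + m + 1) := by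
  have h := Complex.betaIntegral_eq_Gamma_mul_div ((m : ℂ) + 1) (c : ℂ)
    (by simp; positivity) (by simpa using hc)
  rw [Complex.betaIntegral, intervalIntegral.integral_of_le zero_le_one,
    setIntegral_congr_fun measurableSet_Ioc (beta_kernel_aux m), integral_complex_ofReal] at h
  have h1 : ((m : ℂ) + 1) + c = ((c + m + 1 : ℝ) : ℂ) := by push_cast; ring
  rw [h1, Complex.Gamma_ofReal, Complex.Gamma_ofReal, Complex.Gamma_nat_eq_factorial] at h
  have h2 : ((∫ s in Set.Ioc (0 : ℝ) 1, (1 - s) ^ (c - 1) * s ^ m : ℝ) : ℂ) =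
      ((Real.Gamma c * m.factorial / Real.Gamma (c + m + 1) : ℝ) : ℂ) := by
    rw [h]
    push_cast
    ring
  exact_mod_cast h2

lemma tendsto_sum_pow_div_factorial (y : ℝ) :
    Tendsto (fun p : ℕ × ℝ => ∑ m ∈ Finset.range p.1, p.2 ^ m / m.factorial)
      (atTop ×ˢ 𝓝 y) (𝓝 (rexp y)) := by
  have hu := tendstoUniformlyOn_tsum_nat (f := fun (m : ℕ) (x : ℝ) => x ^ m / m.factorial)
    (Real.summable_pow_div_factorial (|y| + 1)) (s := Set.Icc (y - 1) (y + 1)) (fun m x hx => by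
      rw [norm_div, norm_pow, Real.norm_natCast, Real.norm_eq_abs]
      gcongr
      rw [abs_le]
      constructor <;> linarith [hx.1, hx.2, neg_abs_le y, le_abs_self y])
  have he : ∀ x : ℝ, ∑' m : ℕ, x ^ m / m.factorial = rexp x := fun x => by
    rw [Real.exp_eq_exp_ℝ, NormedSpace.exp_eq_tsum_div]
  simp only [he] at hu
  refine tendsto_comp_of_locally_uniform_limit (F := fun (p : ℕ × ℝ) (x : ℝ) =>
    ∑ m ∈ Finset.range p.1, x ^ m / (m.factorial : ℝ)) (f := rexp) (g := fun p : ℕ × ℝ => p.2)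
    continuous_exp.continuousAt tendsto_snd fun v hv => ⟨Set.Icc (y - 1) (y + 1),
      Icc_mem_nhds (by linarith) (by linarith), ?_⟩
  exact (hu v hv).prod_inl _

/-- Entries of the limiting kernel, as functions of the first index. -/
noncomputable def betaRow (γ : ℝ) (a : ℕ) (s : ℝ) : ℝ :=
  (1 - s) ^ (γ - a - 1) / (a.factorial * Real.Gamma (γ - a))

/-- Entries of the limiting kernel, as functions of the second index. -/
noncomputable def expColumn (x : ℝ) (b : ℕ) (s : ℝ) : ℝ := s ^ b * rexp (x * s) / b.factorial

/-- For `j = b + m` the quotient `(b + m)! / Γ(γ - a + b + m + 1)` is a Beta integral of `s^(b +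
m)`. Summing over `m` under the integral leaves a truncated exponential of `x s`; the terms `j < b`
vanish. -/
lemma sum_choose_mul_pow_div_Gamma {γ : ℝ} {a : ℕ} (ha : (a : ℝ) < γ) (b M : ℕ) (x : ℝ) :
    ∑ j ∈ Finset.range (b + M), (j.choose b : ℝ) * x ^ (j - b) /
        (a.factorial * Real.Gamma (γ + j + 1 - a)) =
      ∫ s in Set.Ioc (0 : ℝ) 1, betaRow γ a s *
        (s ^ b * (∑ m ∈ Finset.range M, (x * s) ^ m / m.factorial) / b.factorial) := by
  have hc : 0 < γ - a := sub_pos.2 ha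
  have hG : 0 < Real.Gamma (γ - a) := Gamma_pos_of_pos hc
  rw [Finset.sum_range_add, Finset.sum_eq_zero, zero_add]
  swap
  · intro j hj
    rw [Nat.choose_eq_zero_of_lt (Finset.mem_range.1 hj)]
    simp
  have h1 : ∀ s : ℝ, betaRow γ a s *
        (s ^ b * (∑ m ∈ Finset.range M, (x * s) ^ m / m.factorial) / b.factorial) =
      ∑ m ∈ Finset.range M, x ^ m / (a.factorial * Real.Gamma (γ - a) * b.factorial * m.factorial) *
        ((1 - s) ^ (γ - a - 1) * s ^ (b + m)) := fun s => by
    rw [Finset.mul_sum, Finset.sum_div, Finset.mul_sum]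
    refine Finset.sum_congr rfl fun m _ => ?_
    rw [betaRow, mul_pow, pow_add]
    field_simp
  simp only [h1]
  rw [integral_finsetSum _ fun m _ => (integrableOn_beta_kernel hc (b + m)).const_mul _]
  refine Finset.sum_congr rfl fun m _ => ?_
  rw [integral_const_mul, integral_beta_kernel hc, Nat.add_sub_cancel_left]
  have h2 : ((b + m).choose b : ℝ) * (b.factorial * m.factorial) = (b + m).factorial := by
    rw [← mul_assoc, Nat.choose_symm_add]
    exact_mod_cast Nat.add_choose_mul_factorial_mul_factorial b m
  have h3 : γ + ((b + m : ℕ) : ℝ) + 1 - a = γ - a + ((b + m : ℕ) : ℝ) + 1 := by ring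
  have h4 : 0 < Real.Gamma (γ - a + ((b + m : ℕ) : ℝ) + 1) := Gamma_pos_of_pos (by positivity)
  rw [h3, ← h2]
  field_simp

/-- Dominated convergence with a Beta density as majorant. The filter is general so that one
statement gives both continuity of the limiting kernel in `x` and the limit taken jointly in `N` and
`x`. -/
lemma tendsto_integral_betaRow_mul {ι : Type*} {l : Filter ι} [l.IsCountablyGenerated]
    {γ : ℝ} {a : ℕ} (ha : (a : ℝ) < γ) (b : ℕ) {h : ι → ℝ → ℝ} {h₀ : ℝ → ℝ} {C : ℝ}
    (hm : ∀ p, Measurable (h p)) (hC : ∀ᶠ p in l, ∀ s ∈ Set.Ioc (0 : ℝ) 1, |h p s| ≤ C)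
    (hl : ∀ s ∈ Set.Ioc (0 : ℝ) 1, Tendsto (fun p => h p s) l (𝓝 (h₀ s))) :
    Tendsto (fun p => ∫ s in Set.Ioc (0 : ℝ) 1, betaRow γ a s * (s ^ b * h p s / b.factorial)) l
      (𝓝 (∫ s in Set.Ioc (0 : ℝ) 1, betaRow γ a s * (s ^ b * h₀ s / b.factorial))) := by
  have hc : 0 < γ - a := sub_pos.2 ha
  have hG : 0 < Real.Gamma (γ - a) := Gamma_pos_of_pos hc
  refine tendsto_integral_filter_of_dominated_convergence
    (fun s => C / (a.factorial * Real.Gamma (γ - a) * b.factorial) *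
      ((1 - s) ^ (γ - a - 1) * s ^ b)) (Eventually.of_forall fun p => ?_) ?_
    ((integrableOn_beta_kernel hc b).const_mul _) ?_
  · have := hm p
    exact Measurable.aestronglyMeasurable (by unfold betaRow; fun_prop)
  · filter_upwards [hC] with p hp
    refine (ae_restrict_iff' measurableSet_Ioc).2 (ae_of_all _ fun s hs => ?_)
    have h1 : (0 : ℝ) ≤ 1 - s := sub_nonneg.2 hs.2
    have h0 : 0 ≤ s := hs.1.le
    rw [betaRow, Real.norm_eq_abs, abs_mul, abs_div, abs_div, abs_mul (s ^ b),
      abs_of_nonneg (by positivity : 0 ≤ (1 - s) ^ (γ - a - 1)), abs_of_nonneg (pow_nonneg h0 b),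
      abs_of_pos (by positivity : (0 : ℝ) < b.factorial),
      abs_of_pos (by positivity : (0 : ℝ) < a.factorial * Real.Gamma (γ - a))]
    calc _ ≤ (1 - s) ^ (γ - a - 1) / (a.factorial * Real.Gamma (γ - a)) *
          (s ^ b * C / b.factorial) := by gcongr; exact hp s hs
      _ = _ := by field_simp
  · refine (ae_restrict_iff' measurableSet_Ioc).2 (ae_of_all _ fun s hs => ?_)
    exact (((hl s hs).const_mul _).div_const _).const_mul _

/-- The limit of `chargeKernel`. -/
noncomputable def limitKernel (γ : ℝ) (k : ℕ) (x : ℝ) : Matrix (Fin k) (Fin k) ℝ :=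
  of fun a b => ∫ s in Set.Ioc (0 : ℝ) 1, betaRow γ a s * expColumn x b s

lemma continuous_det_limitKernel {γ : ℝ} {k : ℕ} (hγ : (k : ℝ) ≤ γ) :
    Continuous fun x => (limitKernel γ k x).det := by
  refine Continuous.matrix_det (continuous_matrix fun a b => ?_)
  have ha : ((a : ℕ) : ℝ) < γ := lt_of_lt_of_le (by exact_mod_cast a.2) hγ
  refine continuous_iff_continuousAt.2 fun x => ?_
  simp only [limitKernel, of_apply, expColumn]
  refine tendsto_integral_betaRow_mul ha b (h := fun x s => rexp (x * s)) (C := rexp (|x| + 1))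
    (fun p => by fun_prop) ?_ fun s hs => ?_
  · filter_upwards [Ioo_mem_nhds (sub_one_lt x) (lt_add_one x)] with y hy s hs
    rw [abs_of_pos (exp_pos _)]
    refine exp_le_exp.2 ((le_abs_self _).trans ?_)
    rw [abs_mul, abs_of_pos hs.1]
    have : |y| ≤ |x| + 1 := by
      rw [abs_le]
      constructor <;> linarith [hy.1, hy.2, neg_abs_le x, le_abs_self x]
    nlinarith [hs.1, hs.2, abs_nonneg y]
  · exact (Continuous.tendsto (by fun_prop) x)

lemma tendsto_det_chargeKernel {γ : ℝ} {k : ℕ} (hγ : (k : ℝ) ≤ γ) (x : ℝ) :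
    Tendsto (fun p : ℕ × ℝ => (chargeKernel γ k (k + p.1) p.2).det) (atTop ×ˢ 𝓝 x)
      (𝓝 (limitKernel γ k x).det) := by
  refine ((continuous_id.matrix_det).tendsto (limitKernel γ k x)).comp
    (tendsto_pi_nhds.2 fun a => tendsto_pi_nhds.2 fun b => ?_)
  have ha : ((a : ℕ) : ℝ) < γ := lt_of_lt_of_le (by exact_mod_cast a.2) hγ
  -- The truncation length depends on the column, and the subtraction is exact because `b < k`.
  have hb : ∀ M, k + M = (b : ℕ) + (k - b + M) := fun M => by
    have := b.2
    omega
  change Tendsto (fun p : ℕ × ℝ => chargeKernel γ k (k + p.1) p.2 a b) _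
    (𝓝 (limitKernel γ k x a b))
  simp only [chargeKernel, limitKernel, of_apply, expColumn]
  have h1 : ∀ p : ℕ × ℝ, ∑ j ∈ Finset.range (k + p.1), (j.choose b : ℝ) * p.2 ^ (j - b) /
        ((a : ℕ).factorial * Real.Gamma (γ + j + 1 - a)) =
      ∫ s in Set.Ioc (0 : ℝ) 1, betaRow γ a s * (s ^ (b : ℕ) *
        (∑ m ∈ Finset.range (k - b + p.1), (p.2 * s) ^ m / m.factorial) /
          (b : ℕ).factorial) := fun p => by
    rw [hb, sum_choose_mul_pow_div_Gamma ha]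
  simp only [h1]
  refine tendsto_integral_betaRow_mul ha b (h := fun (p : ℕ × ℝ) s =>
    ∑ m ∈ Finset.range (k - b + p.1), (p.2 * s) ^ m / m.factorial) (h₀ := fun s => rexp (x * s))
    (C := rexp (|x| + 1)) (fun p => by fun_prop) ?_ fun s hs => ?_
  · filter_upwards [tendsto_snd.eventually (Ioo_mem_nhds (sub_one_lt x) (lt_add_one x))] with p hy s hs
    have h2 : |p.2 * s| ≤ |x| + 1 := by
      have : |p.2| ≤ |x| + 1 := by
        rw [abs_le]
        constructor <;> linarith [hy.1, hy.2, neg_abs_le x, le_abs_self x]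
      rw [abs_mul, abs_of_pos hs.1]
      nlinarith [hs.1, hs.2, abs_nonneg p.2]
    refine (Finset.abs_sum_le_sum_abs _ _).trans ?_
    calc _ = ∑ m ∈ Finset.range (k - b + p.1), |p.2 * s| ^ m / m.factorial :=
          Finset.sum_congr rfl fun m _ => by
            rw [abs_div, abs_pow, abs_of_pos (by positivity : (0 : ℝ) < m.factorial)]
      _ ≤ rexp |p.2 * s| := Real.sum_le_exp_of_nonneg (abs_nonneg _) _
      _ ≤ _ := exp_le_exp.2 h2
  · refine (tendsto_sum_pow_div_factorial (x * s)).comp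
      (f := fun p : ℕ × ℝ => (k - b + p.1, p.2 * s)) (Tendsto.prodMk ?_ ?_)
    · exact tendsto_atTop_mono (fun p => Nat.le_add_left _ _) tendsto_fst
    · exact (tendsto_snd (f := atTop (α := ℕ))).mul_const s

end BetaIntegral

/-! ### The limiting determinant as a multiple integral. -/

section LimitKernel

open Matrix

/-- The weight of the multiple integral representing `(limitKernel γ k x).det`. -/
noncomputable def jacobiWeight (γ : ℝ) (k : ℕ) (x : ℝ) (s : Fin k → ℝ) : ℝ :=
  (∏ i, (1 - s i) ^ (γ - k) * rexp (x * s i)) * (∏ i, ∏ j ∈ Finset.Ioi i, (s j - s i)) ^ 2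

/-- The normalisation of the multiple integral representing `(limitKernel γ k x).det`. -/
noncomputable def limitConst (γ : ℝ) (k : ℕ) : ℝ :=
  ∏ a : Fin k, ((a : ℕ).factorial * Real.Gamma (γ - a) * (a : ℕ).factorial)

variable {γ : ℝ} {k : ℕ}

lemma limitConst_pos (hγ : (k : ℝ) ≤ γ) : 0 < limitConst γ k :=
  Finset.prod_pos fun a _ => by
    have ha : ((a : ℕ) : ℝ) < γ := lt_of_lt_of_le (by exact_mod_cast a.2) hγ
    have := Gamma_pos_of_pos (sub_pos.2 ha)
    positivity

/-- After removing `(1 - s)^(γ - k)` the exponents are `k - 1 - a`: a Vandermonde matrix in `1 - s`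
with reversed order. The reversal and the change of sign of the differences cancel. -/
lemma det_betaRow (hγ : (k : ℝ) ≤ γ) {s : Fin k → ℝ} (hs : ∀ i, s i ≤ 1) :
    (of fun a i : Fin k => betaRow γ a (s i)).det =
      (∏ a : Fin k, ((a : ℕ).factorial * Real.Gamma (γ - a))⁻¹) * ((∏ i, (1 - s i) ^ (γ - k)) *
        ∏ i, ∏ j ∈ Finset.Ioi i, (s j - s i)) := by
  have hV : ∏ i, ∏ j ∈ Finset.Ioi i, (s j - s i) =
      (projVandermonde (fun _ => 1) fun i => 1 - s i)ᵀ.det := by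
    rw [det_transpose, det_projVandermonde]
    refine Finset.prod_congr rfl fun i _ => Finset.prod_congr rfl fun j _ => ?_
    ring
  rw [hV, ← det_mul_row, ← det_mul_column]
  congr 1
  ext a i
  have h1 : (0 : ℝ) ≤ 1 - s i := sub_nonneg.2 (hs i)
  have h2 : γ - (a : ℕ) - 1 = (γ - k) + ((Fin.rev a : ℕ) : ℝ) := by
    have := a.2
    rw [Fin.val_rev, Nat.cast_sub (by omega)]
    push_cast
    ring
  simp only [of_apply, transpose_apply, projVandermonde_apply, one_pow, one_mul, betaRow]
  rw [h2, rpow_add_of_nonneg h1 (sub_nonneg.2 hγ) (by positivity), rpow_natCast, div_eq_inv_mul]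

lemma det_expColumn (x : ℝ) (s : Fin k → ℝ) :
    (of fun b i : Fin k => expColumn x b (s i)).det =
      (∏ b : Fin k, ((b : ℕ).factorial : ℝ)⁻¹) * ((∏ i, rexp (x * s i)) *
        ∏ i, ∏ j ∈ Finset.Ioi i, (s j - s i)) := by
  rw [← det_vandermonde, ← det_transpose (vandermonde s), ← det_mul_row, ← det_mul_column]
  congr 1
  ext b i
  simp only [of_apply, transpose_apply, vandermonde_apply, expColumn]
  ring

lemma det_betaRow_mul_det_expColumn (hγ : (k : ℝ) ≤ γ) (x : ℝ) {s : Fin k → ℝ}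
    (hs : ∀ i, s i ≤ 1) :
    (of fun a i : Fin k => betaRow γ a (s i)).det * (of fun b i : Fin k => expColumn x b (s i)).det =
      (limitConst γ k)⁻¹ * jacobiWeight γ k x s := by
  rw [det_betaRow hγ hs, det_expColumn, limitConst, jacobiWeight, ← Finset.prod_inv_distrib,
    mul_mul_mul_comm, ← Finset.prod_mul_distrib, mul_mul_mul_comm, ← Finset.prod_mul_distrib, ← sq]
  congr 1
  exact Finset.prod_congr rfl fun a _ => by rw [mul_inv (_ * _)]

lemma integrableOn_betaRow_mul_expColumn (hγ : (k : ℝ) ≤ γ) (x : ℝ) (a b : Fin k) :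
    IntegrableOn (fun s => betaRow γ a s * expColumn x b s) (Set.Ioc 0 1) := by
  have ha : ((a : ℕ) : ℝ) < γ := lt_of_lt_of_le (by exact_mod_cast a.2) hγ
  have hc : 0 < γ - (a : ℕ) := sub_pos.2 ha
  have hG := Gamma_pos_of_pos hc
  refine Integrable.mono' ((integrableOn_beta_kernel hc b).const_mul
    (rexp |x| / ((a : ℕ).factorial * Real.Gamma (γ - (a : ℕ)) * (b : ℕ).factorial)))
    (Measurable.aestronglyMeasurable (by unfold betaRow expColumn; fun_prop)) ?_
  refine (ae_restrict_iff' measurableSet_Ioc).2 (ae_of_all _ fun s hs => ?_)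
  have h1 : (0 : ℝ) ≤ 1 - s := sub_nonneg.2 hs.2
  have h0 : 0 ≤ s := hs.1.le
  have h2 : rexp (x * s) ≤ rexp |x| := exp_le_exp.2 <| by
    nlinarith [le_abs_self x, abs_nonneg x, hs.2]
  rw [Real.norm_of_nonneg (by unfold betaRow expColumn; positivity), betaRow, expColumn]
  calc _ ≤ (1 - s) ^ (γ - (a : ℕ) - 1) / ((a : ℕ).factorial * Real.Gamma (γ - (a : ℕ))) *
        (s ^ (b : ℕ) * rexp |x| / (b : ℕ).factorial) := by gcongr
    _ = _ := by field_simp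

lemma ae_le_one_pi_restrict :
    ∀ᵐ s ∂(Measure.pi fun _ : Fin k => volume.restrict (Set.Ioc (0 : ℝ) 1)),
      ∀ i, s i ∈ Set.Ioc (0 : ℝ) 1 := by
  rw [← Measure.restrict_pi_pi]
  filter_upwards [ae_restrict_mem (MeasurableSet.univ_pi fun _ => measurableSet_Ioc)] with s hs i
  exact hs i (Set.mem_univ i)

lemma integrable_jacobiWeight (hγ : (k : ℝ) ≤ γ) (x : ℝ) :
    Integrable (jacobiWeight γ k x)
      (Measure.pi fun _ : Fin k => volume.restrict (Set.Ioc (0 : ℝ) 1)) := by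
  have h := integrable_det_mul_det (μ := volume.restrict (Set.Ioc (0 : ℝ) 1))
    (f := fun a : Fin k => betaRow γ a) (g := fun b : Fin k => expColumn x b)
    (integrableOn_betaRow_mul_expColumn hγ x)
  refine (h.const_mul (limitConst γ k)).congr ?_
  filter_upwards [ae_le_one_pi_restrict] with s hs
  rw [det_betaRow_mul_det_expColumn hγ x fun i => (hs i).2,
    mul_inv_cancel_left₀ (limitConst_pos hγ).ne']

lemma det_limitKernel (hγ : (k : ℝ) ≤ γ) (x : ℝ) :
    (limitKernel γ k x).det = (k.factorial * limitConst γ k)⁻¹ *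
      ∫ s, jacobiWeight γ k x s
        ∂(Measure.pi fun _ : Fin k => volume.restrict (Set.Ioc (0 : ℝ) 1)) := by
  have h := integral_det_mul_det (μ := volume.restrict (Set.Ioc (0 : ℝ) 1))
    (f := fun a : Fin k => betaRow γ a) (g := fun b : Fin k => expColumn x b)
    (integrableOn_betaRow_mul_expColumn hγ x)
  rw [integral_congr_ae (g := fun s => (limitConst γ k)⁻¹ * jacobiWeight γ k x s)] at h
  · rw [integral_const_mul] at h
    have : (k.factorial : ℝ) ≠ 0 := by positivity
    rw [mul_inv, mul_assoc, h, inv_mul_cancel_left₀ (by exact_mod_cast this)]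
    rfl
  · filter_upwards [ae_le_one_pi_restrict] with s hs
    exact det_betaRow_mul_det_expColumn hγ x fun i => (hs i).2

lemma jacobiWeight_nonneg (x : ℝ) {s : Fin k → ℝ} (hs : ∀ i, s i ∈ Set.Ioc (0 : ℝ) 1) :
    0 ≤ jacobiWeight γ k x s :=
  mul_nonneg (Finset.prod_nonneg fun i _ =>
    mul_nonneg (rpow_nonneg (sub_nonneg.2 (hs i).2) _) (exp_pos _).le) (sq_nonneg _)

/-- Positivity for every `x`, including `0`, is what allows the ratio of determinants to converge to
`1` even at the collision. -/
lemma det_limitKernel_pos (hγ : (k : ℝ) ≤ γ) (x : ℝ) : 0 < (limitKernel γ k x).det := by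
  rw [det_limitKernel hγ]
  refine mul_pos (inv_pos.2 (mul_pos (by positivity) (limitConst_pos hγ))) ?_
  rw [integral_pos_iff_support_of_nonneg_ae ?_ (integrable_jacobiWeight hγ x)]
  swap
  · filter_upwards [ae_le_one_pi_restrict] with s hs
    exact jacobiWeight_nonneg x hs
  -- An open box of successive disjoint intervals: on it the coordinates increase strictly and stay
  -- below `1`, so the weight is positive.
  set U : Set (Fin k → ℝ) :=
    Set.univ.pi fun i => Set.Ioo (((i : ℕ) : ℝ) / k) (((i : ℕ) + 1 : ℝ) / k) with hU
  have hk : ∀ i : Fin k, (0 : ℝ) < k := fun i => by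
    exact_mod_cast (Nat.zero_le _).trans_lt i.2
  have hU1 : U ⊆ Set.univ.pi fun _ : Fin k => Set.Ioc (0 : ℝ) 1 := fun s hs i _ => by
    have h := hs i (Set.mem_univ i)
    refine ⟨lt_of_le_of_lt (by positivity) h.1, h.2.le.trans ?_⟩
    rw [div_le_one (hk i)]
    exact_mod_cast i.2
  have hU2 : U ⊆ Function.support (jacobiWeight γ k x) := fun s hs => by
    have h1 : ∀ i, s i < 1 := fun i => (hs i (Set.mem_univ i)).2.trans_le (by
      rw [div_le_one (hk i)]
      exact_mod_cast i.2)
    refine (mul_pos (Finset.prod_pos fun i _ => mul_pos (rpow_pos_of_pos (sub_pos.2 (h1 i)) _)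
      (exp_pos _)) (pow_pos (Finset.prod_pos fun i _ => Finset.prod_pos fun j hj => ?_) 2)).ne'
    rw [sub_pos]
    refine (hs i (Set.mem_univ i)).2.trans_le (le_trans ?_ (hs j (Set.mem_univ j)).1.le)
    have hij : (i : ℕ) + 1 ≤ j := Finset.mem_Ioi.1 hj
    have := hk i
    gcongr
    exact_mod_cast hij
  have hUo : IsOpen U := isOpen_set_pi Set.finite_univ fun _ _ => isOpen_Ioo
  have hUn : U.Nonempty := Set.univ_pi_nonempty_iff.2 fun i => Set.nonempty_Ioo.2 (by
    have := hk i
    gcongr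
    exact lt_add_one _)
  rw [← Measure.restrict_pi_pi, ← volume_pi]
  refine (hUo.measure_pos volume hUn).trans_le ?_
  calc volume U = volume.restrict (Set.univ.pi fun _ : Fin k => Set.Ioc (0 : ℝ) 1) U := by
        rw [Measure.restrict_apply hUo.measurableSet, Set.inter_eq_left.2 hU1]
    _ ≤ _ := measure_mono hU2

lemma jacobiWeight_one_sub_smul {x : ℝ} (hx : 0 < x) {t : Fin k → ℝ} (ht : ∀ i, 0 ≤ t i) :
    jacobiWeight γ k x (1 - x⁻¹ • t) =
      x ^ (-(γ - k) * k) * rexp (k * x) * ((x⁻¹) ^ (∑ i : Fin k, (Finset.Ioi i).card)) ^ 2 *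
        lueWeight k (γ - k) t := by
  have h1 : ∀ i, (1 - (1 - x⁻¹ • t) i) ^ (γ - k) * rexp (x * (1 - x⁻¹ • t) i) =
      (x ^ (-(γ - k)) * rexp x) * (t i ^ (γ - k) * rexp (-t i)) := fun i => by
    simp only [Pi.sub_apply, Pi.one_apply, Pi.smul_apply, smul_eq_mul, sub_sub_cancel]
    rw [mul_rpow (by positivity) (ht i), inv_rpow hx.le, rpow_neg hx.le, mul_sub, mul_one,
      mul_inv_cancel_left₀ hx.ne', sub_eq_add_neg x, Real.exp_add]
    ring
  have h2 : ∀ i j, (1 - x⁻¹ • t) j - (1 - x⁻¹ • t) i = x⁻¹ * -(t j - t i) := fun i j => by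
    simp only [Pi.sub_apply, Pi.one_apply, Pi.smul_apply, smul_eq_mul]
    ring
  rw [jacobiWeight, lueWeight]
  simp only [h1, h2]
  simp only [Finset.prod_mul_distrib, Finset.prod_const, Finset.card_univ, Fintype.card_fin,
    Finset.prod_neg, Finset.prod_pow_eq_pow_sum, mul_pow]
  rw [← pow_mul (-1 : ℝ), pow_mul' (-1 : ℝ), neg_one_sq, one_pow, one_mul, rpow_mul hx.le,
    rpow_natCast, ← Real.exp_nat_mul]
  ring

lemma sum_card_Ioi_mul_two_add : ∀ n : ℕ, ∑ i : Fin n, (Finset.Ioi i).card * 2 + n = n * n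
  | 0 => rfl
  | n + 1 => by
    have ih := sum_card_Ioi_mul_two_add n
    rw [Fin.sum_univ_succ]
    simp only [Fin.card_Ioi] at ih ⊢
    have : ∀ i : Fin n, n + 1 - 1 - (i.succ : ℕ) = n - 1 - i := fun i => by
      rw [Fin.val_succ]
      omega
    simp only [this, Fin.val_zero]
    simp only [Nat.add_sub_cancel, Nat.sub_zero]
    nlinarith [ih]

/-- The substitution `s = 1 - t / x` maps `[0, x)` to `(0, 1]` and turns `exp (x s)` into `exp x *
exp (-t)`, so the Laguerre weight restricted to `t < x` appears. -/
lemma integral_jacobiWeight {x : ℝ} (hx : 0 < x) :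
    ∫ s, jacobiWeight γ k x s
        ∂(Measure.pi fun _ : Fin k => volume.restrict (Set.Ioc (0 : ℝ) 1)) =
      x ^ (-(γ * k)) * rexp (k * x) *
        ∫ t in Set.univ.pi fun _ : Fin k => Set.Ico 0 x, lueWeight k (γ - k) t := by
  rw [← Measure.restrict_pi_pi, ← volume_pi,
    ← integral_indicator (MeasurableSet.univ_pi fun _ => measurableSet_Ioc),
    ← integral_indicator (MeasurableSet.univ_pi fun _ => measurableSet_Ico)]
  set H := (Set.univ.pi fun _ : Fin k => Set.Ioc (0 : ℝ) 1).indicator (jacobiWeight γ k x) with hH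
  set L := (Set.univ.pi fun _ : Fin k => Set.Ico (0 : ℝ) x).indicator (lueWeight k (γ - k)) with hL
  have hpt : ∀ t, H (1 - x⁻¹ • t) = x ^ (-(γ - k) * k) * rexp (k * x) *
      ((x⁻¹) ^ (∑ i : Fin k, (Finset.Ioi i).card)) ^ 2 * L t := fun t => by
    have hmem : (1 - x⁻¹ • t) ∈ (Set.univ.pi fun _ : Fin k => Set.Ioc (0 : ℝ) 1) ↔
        t ∈ Set.univ.pi fun _ : Fin k => Set.Ico (0 : ℝ) x := by
      refine forall₂_congr fun i _ => ?_
      simp only [Pi.sub_apply, Pi.one_apply, Pi.smul_apply, smul_eq_mul, Set.mem_Ioc, Set.mem_Ico,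
        sub_pos, inv_mul_lt_iff₀ hx, mul_one, sub_le_self_iff]
      rw [and_comm, mul_nonneg_iff_of_pos_left (inv_pos.2 hx)]
    by_cases h : t ∈ Set.univ.pi fun _ : Fin k => Set.Ico (0 : ℝ) x
    · rw [hH, hL, Set.indicator_of_mem h, Set.indicator_of_mem (hmem.2 h),
        jacobiWeight_one_sub_smul hx fun i => (h i (Set.mem_univ i)).1]
    · rw [hH, hL, Set.indicator_of_notMem h, Set.indicator_of_notMem (fun h' => h (hmem.1 h')),
        mul_zero]
  have h1 := integral_sub_left_eq_self H volume (1 : Fin k → ℝ)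
  have h2 := Measure.integral_comp_smul volume (fun t : Fin k → ℝ => H (1 - t)) x⁻¹
  simp only [hpt, integral_const_mul, h1, Module.finrank_fin_fun, smul_eq_mul] at h2
  have habs : |((x⁻¹) ^ k)⁻¹| = x ^ k := by
    rw [inv_pow, inv_inv, abs_of_pos (by positivity)]
  rw [habs] at h2
  have hcard := sum_card_Ioi_mul_two_add k
  have hx0 : x ^ k ≠ 0 := by positivity
  have h3 : ∫ t, H t = (x ^ k)⁻¹ * (x ^ (-(γ - k) * k) * rexp (k * x) *
      ((x⁻¹) ^ (∑ i : Fin k, (Finset.Ioi i).card)) ^ 2 * ∫ t, L t) := by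
    rw [h2, inv_mul_cancel_left₀ hx0]
  rw [h3]
  -- The Jacobian gives `k` powers of `x⁻¹` and the squared Vandermonde `k (k - 1)`, hence `k * k`;
  -- with the exponent `-(γ - k) k` of the weight the total is `-γ k`.
  have h4 : (x ^ k)⁻¹ * ((x⁻¹) ^ (∑ i : Fin k, (Finset.Ioi i).card)) ^ 2 =
      x ^ (-((k : ℝ) * k)) := by
    rw [← pow_mul, Finset.sum_mul, ← inv_pow, ← pow_add, add_comm, hcard, rpow_neg hx.le, inv_pow]
    congr 1
    exact_mod_cast (rpow_natCast x (k * k)).symm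
  calc _ = (x ^ (-(γ - k) * k) * ((x ^ k)⁻¹ * ((x⁻¹) ^ (∑ i : Fin k, (Finset.Ioi i).card)) ^ 2)) *
        rexp (k * x) * ∫ t, L t := by ring
    _ = _ := by
      rw [h4, ← rpow_add hx]
      congr 3
      ring

end LimitKernel

/-! ### Normalisation of the Laguerre unitary ensemble. -/

section Laguerre

open Matrix

variable {k : ℕ} {α : ℝ}

lemma Gamma_add_natCast {z : ℝ} (hz : 0 < z) : ∀ n : ℕ,
    Real.Gamma (z + n) = Real.Gamma z * (ascPochhammer ℝ n).eval z
  | 0 => by simp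
  | n + 1 => by
    rw [ascPochhammer_succ_eval, ← mul_assoc, ← Gamma_add_natCast hz n, Nat.cast_succ, ← add_assoc,
      Real.Gamma_add_one (by positivity), mul_comm]

/-- Dividing row `a` by `Γ(α + a + 1)` leaves rising factorials, monic of degree `b` in the shifted
index `a`. The determinant is then the Vandermonde determinant of consecutive integers, a
superfactorial. -/
lemma det_Gamma_add_add (hα : 0 ≤ α) :
    (of fun a b : Fin k => Real.Gamma (α + a + b + 1)).det =
      ∏ a : Fin k, Real.Gamma (α + a + 1) * (a : ℕ).factorial := by
  have h1 : (of fun a b : Fin k => Real.Gamma (α + a + b + 1)) =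
      of fun a b : Fin k => Real.Gamma (α + a + 1) * (of fun a b : Fin k =>
        (ascPochhammer ℝ b).eval ((a : ℝ) + (α + 1))) a b := by
    ext a b
    have : α + a + b + 1 = (α + a + 1) + b := by ring
    rw [of_apply, of_apply, of_apply, this, Gamma_add_natCast (by positivity)]
    congr 2
    ring
  rw [h1, det_mul_column, ← det_eval_matrixOfPolynomials_eq_det_vandermonde _ _
    (fun i => ascPochhammer_natDegree _ _) (fun i => monic_ascPochhammer _ _),
    det_vandermonde_add, Finset.prod_mul_distrib]
  congr 1
  cases k with
  | zero => simp
  | succ n =>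
    rw [det_vandermonde_id_eq_superFactorial, ← Nat.prod_range_succ_factorial, Finset.prod_range]
    push_cast
    rfl

lemma det_mul_det_eq_lueWeight (t : Fin k → ℝ) :
    (of fun a i : Fin k => (t i ^ α * rexp (-t i)) * t i ^ (a : ℕ)).det *
      (of fun b i : Fin k => t i ^ (b : ℕ)).det = lueWeight k α t := by
  have h : (of fun b i : Fin k => t i ^ (b : ℕ)).det = ∏ i, ∏ j ∈ Finset.Ioi i, (t j - t i) := by
    rw [← det_vandermonde, ← det_transpose (vandermonde t)]
    rfl
  have h1 := det_mul_row (fun i => t i ^ α * rexp (-t i)) (of fun b i : Fin k => t i ^ (b : ℕ))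
  simp only [of_apply] at h1
  rw [h1, h, lueWeight, mul_assoc, sq]

lemma laguerre_moment_aux (a b : ℕ) : Set.EqOn
    (fun t : ℝ => t ^ α * rexp (-t) * t ^ a * t ^ b)
    (fun t : ℝ => rexp (-t) * t ^ ((α + a + b + 1) - 1)) (Set.Ioi 0) := fun t ht => by
  have ht' : (0 : ℝ) < t := ht
  simp only
  rw [add_sub_cancel_right, rpow_add ht', rpow_add ht', rpow_natCast, rpow_natCast]
  ring

lemma integrableOn_laguerre_moment (hα : 0 ≤ α) (a b : ℕ) :
    IntegrableOn (fun t : ℝ => t ^ α * rexp (-t) * t ^ a * t ^ b) (Set.Ici 0) := by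
  rw [integrableOn_Ici_iff_integrableOn_Ioi,
    integrableOn_congr_fun (laguerre_moment_aux a b) measurableSet_Ioi]
  exact Real.GammaIntegral_convergent (by positivity)

lemma integral_laguerre_moment (hα : 0 ≤ α) (a b : ℕ) :
    ∫ t in Set.Ici (0 : ℝ), t ^ α * rexp (-t) * t ^ a * t ^ b = Real.Gamma (α + a + b + 1) := by
  rw [integral_Ici_eq_integral_Ioi,
    setIntegral_congr_fun measurableSet_Ioi (laguerre_moment_aux a b),
    ← Real.Gamma_eq_integral (by positivity)]

lemma setOf_nonneg_eq_pi : {t : Fin k → ℝ | ∀ i, 0 ≤ t i} = Set.univ.pi fun _ => Set.Ici 0 := by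
  ext t
  simp only [Set.mem_univ_pi, Set.mem_Ici]
  rfl

lemma integrableOn_lueWeight (hα : 0 ≤ α) :
    IntegrableOn (lueWeight k α) {t : Fin k → ℝ | ∀ i, 0 ≤ t i} := by
  have h := integrable_det_mul_det (μ := volume.restrict (Set.Ici (0 : ℝ)))
    (f := fun (a : Fin k) t => t ^ α * rexp (-t) * t ^ (a : ℕ)) (g := fun (b : Fin k) t => t ^ (b : ℕ))
    (fun a b => integrableOn_laguerre_moment hα a b)
  simp only [det_mul_det_eq_lueWeight] at h
  rwa [← Measure.restrict_pi_pi, ← volume_pi, ← setOf_nonneg_eq_pi] at h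

lemma integral_lueWeight (hα : 0 ≤ α) :
    ∫ t in {t : Fin k → ℝ | ∀ i, 0 ≤ t i}, lueWeight k α t =
      k.factorial * ∏ a : Fin k, Real.Gamma (α + a + 1) * (a : ℕ).factorial := by
  have h := integral_det_mul_det (μ := volume.restrict (Set.Ici (0 : ℝ)))
    (f := fun (a : Fin k) t => t ^ α * rexp (-t) * t ^ (a : ℕ)) (g := fun (b : Fin k) t => t ^ (b : ℕ))
    (fun a b => integrableOn_laguerre_moment hα a b)
  simp only [det_mul_det_eq_lueWeight, integral_laguerre_moment hα, det_Gamma_add_add hα] at h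
  rwa [← Measure.restrict_pi_pi, ← volume_pi, ← setOf_nonneg_eq_pi] at h

lemma lueWeight_nonneg {t : Fin k → ℝ} (ht : ∀ i, 0 ≤ t i) : 0 ≤ lueWeight k α t :=
  mul_nonneg (Finset.prod_nonneg fun i _ => mul_nonneg (rpow_nonneg (ht i) _) (exp_pos _).le)
    (sq_nonneg _)

lemma measurableSet_setOf_nonneg : MeasurableSet {t : Fin k → ℝ | ∀ i, 0 ≤ t i} := by
  rw [setOf_nonneg_eq_pi]
  exact MeasurableSet.univ_pi fun _ => measurableSet_Ici

lemma lueMeasure_apply (hα : 0 ≤ α) {S : Set (Fin k → ℝ)} (hS : MeasurableSet S) :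
    lueMeasure k α S =
      ENNReal.ofReal (∫ t in S ∩ {t | ∀ i, 0 ≤ t i}, lueWeight k α t) := by
  rw [lueMeasure, withDensity_apply _ hS, Measure.restrict_restrict hS,
    ofReal_integral_eq_lintegral_ofReal
      ((integrableOn_lueWeight hα).mono_set Set.inter_subset_right)]
  refine (ae_restrict_iff' (hS.inter measurableSet_setOf_nonneg)).2 (ae_of_all _ fun t ht => ?_)
  exact lueWeight_nonneg ht.2

lemma lueMaxCDF_eq {γ : ℝ} (hγ : (k : ℝ) ≤ γ) (x : ℝ) :
    lueMaxCDF γ k x =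
      (k.factorial * ∏ a : Fin k, Real.Gamma (γ - k + a + 1) * (a : ℕ).factorial)⁻¹ *
      ∫ t in Set.univ.pi fun _ : Fin k => Set.Ico 0 x, lueWeight k (γ - k) t := by
  have hα : 0 ≤ γ - k := sub_nonneg.2 hγ
  have hS : MeasurableSet {t : Fin k → ℝ | ∀ i, t i < x} := by
    have : {t : Fin k → ℝ | ∀ i, t i < x} = Set.univ.pi fun _ => Set.Iio x := by
      ext t
      simp
    rw [this]
    exact MeasurableSet.univ_pi fun _ => measurableSet_Iio
  have hI : {t : Fin k → ℝ | ∀ i, t i < x} ∩ {t | ∀ i, 0 ≤ t i} =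
      Set.univ.pi fun _ => Set.Ico 0 x := by
    ext t
    simp only [Set.mem_inter_iff, Set.mem_ofPred_eq, Set.mem_univ_pi, Set.mem_Ico, forall_and]
    exact and_comm
  have h0 : 0 ≤ ∫ t in Set.univ.pi fun _ : Fin k => Set.Ico 0 x, lueWeight k (γ - k) t :=
    setIntegral_nonneg (MeasurableSet.univ_pi fun _ => measurableSet_Ico) fun t ht =>
      lueWeight_nonneg fun i => (ht i (Set.mem_univ i)).1
  have hZ : 0 ≤ k.factorial * ∏ a : Fin k, Real.Gamma (γ - k + a + 1) * (a : ℕ).factorial :=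
    mul_nonneg (by positivity) (Finset.prod_nonneg fun a _ =>
      mul_nonneg (Gamma_pos_of_pos (by positivity)).le (by positivity))
  rw [lueMaxCDF, lueLaw, measureReal_def, Measure.smul_apply, smul_eq_mul, ENNReal.toReal_mul,
    ENNReal.toReal_inv, lueMeasure_apply hα hS, lueMeasure_apply hα MeasurableSet.univ,
    Set.univ_inter, integral_lueWeight hα, hI, ENNReal.toReal_ofReal h0, ENNReal.toReal_ofReal hZ]

/-- Reversing the index, `a ↦ k - 1 - a`, matches the Gamma factors with those of the LUE
normalisation, which therefore cancels and leaves only `G(1 + k)`. -/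
lemma limitConst_eq (γ : ℝ) (k : ℕ) : limitConst γ k =
    (∏ a : Fin k, Real.Gamma (γ - k + a + 1) * (a : ℕ).factorial) *
      ∏ a : Fin k, ((a : ℕ).factorial : ℝ) := by
  have h : ∏ a : Fin k, Real.Gamma (γ - a) = ∏ a : Fin k, Real.Gamma (γ - k + a + 1) := by
    rw [← Equiv.prod_comp Fin.revPerm]
    refine Finset.prod_congr rfl fun a _ => ?_
    have := a.2
    rw [Fin.revPerm_apply, Fin.val_rev, Nat.cast_sub (by omega)]
    push_cast
    congr 1
    ring
  rw [limitConst, Finset.prod_mul_distrib, Finset.prod_mul_distrib, h, Finset.prod_mul_distrib]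
  ring

/-- The limiting kernel in terms of the largest eigenvalue of the Laguerre unitary ensemble. -/
lemma det_limitKernel_eq_lueMaxCDF {γ : ℝ} (hγ : (k : ℝ) ≤ γ) {x : ℝ} (hx : 0 < x) :
    (limitKernel γ k x).det =
      x ^ (-(γ * k)) * rexp (k * x) * lueMaxCDF γ k x / ∏ a : Fin k, ((a : ℕ).factorial : ℝ) := by
  rw [det_limitKernel hγ, integral_jacobiWeight hx, lueMaxCDF_eq hγ, limitConst_eq]
  simp only [mul_inv]
  ring

end Laguerre

/-! ### Second-order asymptotics of Gamma quotients. -/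

section GammaAsymptotics

lemma abs_log_one_add_div_sub_le (a : ℝ) {n : ℕ} (hn : 0 < n) (h : 2 * |a| ≤ n) :
    |Real.log (1 + a / n) - a / n + a ^ 2 / (2 * n ^ 2)| ≤ 2 * |a| ^ 3 / n ^ 3 := by
  have hn' : (0 : ℝ) < n := by exact_mod_cast hn
  have hx : |-(a / n)| ≤ 1 / 2 := by
    rw [abs_neg, abs_div, abs_of_pos hn', div_le_iff₀ hn']
    linarith
  have h1 := Real.abs_log_sub_add_sum_range_le (lt_of_le_of_lt hx (by norm_num)) 2
  rw [Finset.sum_range_succ, Finset.sum_range_one, sub_neg_eq_add] at h1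
  calc _ = |(-(a / n : ℝ)) ^ (0 + 1) / ((0 : ℕ) + 1) + (-(a / n : ℝ)) ^ (1 + 1) / ((1 : ℕ) + 1) +
        Real.log (1 + a / n)| := by
        congr 1
        push_cast
        ring
    _ ≤ |-(a / n : ℝ)| ^ (2 + 1) / (1 - |-(a / n : ℝ)|) := h1
    _ ≤ |-(a / n : ℝ)| ^ (2 + 1) / (1 / 2) := by gcongr; linarith
    _ = _ := by
      rw [abs_neg, abs_div, abs_of_pos hn', div_pow]
      ring

lemma tendsto_sq_mul_log_one_add_div (a : ℝ) :
    Tendsto (fun n : ℕ => (n : ℝ) ^ 2 * (Real.log (1 + a / n) - a / n)) atTop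
      (𝓝 (-(a ^ 2 / 2))) := by
  rw [tendsto_iff_norm_sub_tendsto_zero]
  refine squeeze_zero' (g := fun n : ℕ => 2 * |a| ^ 3 * (n : ℝ)⁻¹)
    (Eventually.of_forall fun n => norm_nonneg _) ?_ ?_
  · filter_upwards [eventually_gt_atTop 0, eventually_ge_atTop ⌈2 * |a|⌉₊] with n hn hn2
    have hn' : (0 : ℝ) < n := by exact_mod_cast hn
    have h := abs_log_one_add_div_sub_le a hn (Nat.ceil_le.1 hn2)
    rw [Real.norm_eq_abs]
    calc _ = |(n : ℝ) ^ 2 * (Real.log (1 + a / n) - a / n + a ^ 2 / (2 * n ^ 2))| := by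
          congr 1
          field_simp
          ring
      _ = (n : ℝ) ^ 2 * |Real.log (1 + a / n) - a / n + a ^ 2 / (2 * n ^ 2)| := by
          rw [abs_mul, abs_of_pos (by positivity)]
      _ ≤ (n : ℝ) ^ 2 * (2 * |a| ^ 3 / n ^ 3) := by gcongr
      _ = _ := by field_simp
  · simpa using (tendsto_inv_atTop_nhds_zero_nat (𝕜 := ℝ)).const_mul (2 * |a| ^ 3)

/-- Since `1/n - 1/(n+1) = 1/(n(n+1))`, the sequence `w n - c / n` is eventually nondecreasing; its
limit is `0`, so it is nonpositive. -/
lemma eventually_mul_le_of_tendsto_sub {w : ℕ → ℝ} (hw : Tendsto w atTop (𝓝 0)) {c : ℝ}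
    (h : ∀ᶠ n : ℕ in atTop, (n : ℝ) * (n + 1) * (w n - w (n + 1)) ≤ c) :
    ∀ᶠ n : ℕ in atTop, (n : ℝ) * w n ≤ c := by
  obtain ⟨n₀, hn₀⟩ := eventually_atTop.1 (h.and (eventually_gt_atTop 0))
  filter_upwards [eventually_ge_atTop n₀] with n hn
  have hstep : ∀ m : ℕ, w (m + n) - c / ((m + n : ℕ) : ℝ) ≤
      w (m + 1 + n) - c / ((m + 1 + n : ℕ) : ℝ) := fun m => by
    obtain ⟨h1, h2⟩ := hn₀ (m + n) (by omega)
    have h3 : (0 : ℝ) < ((m + n : ℕ) : ℝ) := by exact_mod_cast h2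
    rw [show m + 1 + n = m + n + 1 by ring]
    set p : ℝ := ((m + n : ℕ) : ℝ) with hp
    have h4 : ((m + n + 1 : ℕ) : ℝ) = p + 1 := by push_cast [hp]; ring
    rw [h4]
    have h5 : w (m + n) - w (m + n + 1) ≤ c / (p * (p + 1)) := by
      rw [le_div_iff₀ (by positivity)]
      linarith
    have h6 : c / p - c / (p + 1) = c / (p * (p + 1)) := by field_simp; ring
    linarith
  have hmono : Monotone fun m : ℕ => w (m + n) - c / ((m + n : ℕ) : ℝ) :=
    monotone_nat_of_le_succ hstep
  have hlim : Tendsto (fun m : ℕ => w (m + n) - c / ((m + n : ℕ) : ℝ)) atTop (𝓝 0) := by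
    have h1 : Tendsto (fun m : ℕ => w m - c / (m : ℝ)) atTop (𝓝 (0 - 0)) :=
      hw.sub (tendsto_const_div_atTop_nhds_zero_nat c)
    rw [sub_zero] at h1
    exact (tendsto_add_atTop_iff_nat n).2 h1
  have h0 := hmono.ge_of_tendsto hlim 0
  simp only [zero_add] at h0
  have hn' : (0 : ℝ) < n := by exact_mod_cast (hn₀ n hn).2
  rw [sub_nonpos, le_div_iff₀ hn'] at h0
  linarith

/-- A form of the Stolz–Cesàro theorem. -/
lemma tendsto_mul_of_tendsto_sub {w : ℕ → ℝ} (hw : Tendsto w atTop (𝓝 0)) {L : ℝ}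
    (h : Tendsto (fun n : ℕ => (n : ℝ) * (n + 1) * (w n - w (n + 1))) atTop (𝓝 L)) :
    Tendsto (fun n : ℕ => (n : ℝ) * w n) atTop (𝓝 L) := by
  rw [tendsto_order] at h ⊢
  refine ⟨fun a ha => ?_, fun a ha => ?_⟩
  · obtain ⟨b, hab, hbL⟩ := exists_between ha
    have hw' : Tendsto (fun n => -w n) atTop (𝓝 0) := by simpa using hw.neg
    filter_upwards [eventually_mul_le_of_tendsto_sub hw' (c := -b)
      ((h.1 b hbL).mono fun n hn => by linarith)] with n hn
    linarith
  · obtain ⟨b, hLb, hba⟩ := exists_between ha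
    filter_upwards [eventually_mul_le_of_tendsto_sub hw ((h.2 b hLb).mono fun n hn => hn.le)]
      with n hn
    linarith

/-- The quotient of `Γ(n + 1 + γ)` by its leading asymptotics. -/
noncomputable def gammaRatio (γ : ℝ) (n : ℕ) : ℝ :=
  Real.Gamma (γ + n + 1) / (n.factorial * (n : ℝ) ^ γ)

variable {γ : ℝ}

lemma gammaRatio_pos (hγ : 0 ≤ γ) {n : ℕ} (hn : 0 < n) : 0 < gammaRatio γ n := by
  have : (0 : ℝ) < n := by exact_mod_cast hn
  have := Gamma_pos_of_pos (by positivity : 0 < γ + n + 1)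
  unfold gammaRatio
  positivity

lemma tendsto_gammaRatio (hγ : 0 ≤ γ) : Tendsto (gammaRatio γ) atTop (𝓝 1) := by
  have hG : 0 < Real.Gamma (γ + 1) := Gamma_pos_of_pos (by positivity)
  have h1 := ((Real.GammaSeq_tendsto_Gamma (γ + 1)).inv₀ hG.ne').const_mul (Real.Gamma (γ + 1))
  rw [mul_inv_cancel₀ hG.ne'] at h1
  have h2 : Tendsto (fun n : ℕ => (n : ℝ) / (n + (γ + 1))) atTop (𝓝 1) :=
    tendsto_natCast_div_add_atTop (γ + 1)
  have h3 := h1.mul h2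
  rw [one_mul] at h3
  refine h3.congr' ?_
  filter_upwards [eventually_gt_atTop 0] with n hn
  have hn' : (0 : ℝ) < n := by exact_mod_cast hn
  have hprod : ∀ m : ℕ, Real.Gamma (γ + 1) * ∏ j ∈ Finset.range m, (γ + 1 + j) =
      Real.Gamma (γ + m + 1) := fun m => by
    induction m with
    | zero => simp
    | succ m ih =>
      rw [Finset.prod_range_succ, ← mul_assoc, ih, mul_comm, Nat.cast_succ, ← add_assoc,
        Real.Gamma_add_one (by positivity : γ + m + 1 ≠ 0)]
      ring
  have hp := hprod (n + 1)
  rw [Nat.cast_succ, ← add_assoc, Real.Gamma_add_one (by positivity : γ + n + 1 ≠ 0)] at hp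
  have hn1 : (0 : ℝ) < n ^ γ := by positivity
  rw [Real.GammaSeq, gammaRatio, inv_div, rpow_add hn', rpow_one,
    ← mul_div_assoc (Real.Gamma (γ + 1)) (Finset.prod _ _), hp]
  have : γ + n + 1 ≠ 0 := by positivity
  field_simp
  ring

lemma log_gammaRatio_sub (hγ : 0 ≤ γ) {n : ℕ} (hn : 0 < n) :
    Real.log (gammaRatio γ n) - Real.log (gammaRatio γ (n + 1)) =
      γ * Real.log (1 + 1 / n) - Real.log (1 + γ / ((n + 1 : ℕ) : ℝ)) := by
  have hn' : (0 : ℝ) < n := by exact_mod_cast hn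
  have hG := Gamma_pos_of_pos (by positivity : 0 < γ + n + 1)
  have h1 : gammaRatio γ (n + 1) * (1 + 1 / (n : ℝ)) ^ γ =
      gammaRatio γ n * (1 + γ / ((n + 1 : ℕ) : ℝ)) := by
    have h2 : (1 + 1 / (n : ℝ)) = ((n + 1 : ℕ) : ℝ) / n := by push_cast; field_simp
    have h3 : (0 : ℝ) < ((n + 1 : ℕ) : ℝ) := by positivity
    have h4 : γ + ((n + 1 : ℕ) : ℝ) + 1 = (γ + n + 1) + 1 := by push_cast; ring
    rw [h2, div_rpow h3.le hn'.le, gammaRatio, gammaRatio, h4, Real.Gamma_add_one (by positivity),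
      Nat.factorial_succ]
    have h5 : 0 < ((n + 1 : ℕ) : ℝ) ^ γ := by positivity
    have h6 : 0 < (n : ℝ) ^ γ := by positivity
    push_cast at h3 h5 ⊢
    field_simp
    ring
  have h7 := congrArg Real.log h1
  rw [Real.log_mul (gammaRatio_pos hγ n.succ_pos).ne' (by positivity),
    Real.log_mul (gammaRatio_pos hγ hn).ne' (by positivity), Real.log_rpow (by positivity)] at h7
  linarith

/-- Convergence of the ratio to `1` is not enough, because it will be raised to the power `n`. The
functional equation gives its logarithmic increments, which are expanded to second order and summed
by Stolz–Cesàro. -/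
lemma tendsto_mul_log_gammaRatio (hγ : 0 ≤ γ) :
    Tendsto (fun n : ℕ => (n : ℝ) * Real.log (gammaRatio γ n)) atTop (𝓝 (γ * (γ + 1) / 2)) := by
  have hw : Tendsto (fun n => Real.log (gammaRatio γ n)) atTop (𝓝 0) := by
    have := (tendsto_gammaRatio hγ).log one_ne_zero
    rwa [Real.log_one] at this
  refine tendsto_mul_of_tendsto_sub hw ?_
  have h1 := tendsto_sq_mul_log_one_add_div 1
  have h2 := (tendsto_add_atTop_iff_nat 1).2 (tendsto_sq_mul_log_one_add_div γ)
  have h3 : Tendsto (fun n : ℕ => (n : ℝ) / (n + 1)) atTop (𝓝 1) :=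
    tendsto_natCast_div_add_atTop 1
  have h4 := h3.inv₀ one_ne_zero
  have h5 := ((h1.const_mul γ).mul h4).sub (h2.mul h3)
  -- The first-order terms do not cancel: `n (n + 1) (γ / n - γ / (n + 1)) = γ`.
  have h6 := h5.const_add γ
  refine (h6.congr' ?_).trans_eq (by congr 1; ring)
  filter_upwards [eventually_gt_atTop 0] with n hn
  have hn' : (0 : ℝ) < n := by exact_mod_cast hn
  rw [log_gammaRatio_sub hγ hn]
  push_cast
  field_simp
  ring

lemma tendsto_gammaRatio_pow (hγ : 0 ≤ γ) :
    Tendsto (fun n : ℕ => gammaRatio γ n ^ n) atTop (𝓝 (rexp (γ * (γ + 1) / 2))) := by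
  refine ((continuous_exp.tendsto _).comp (tendsto_mul_log_gammaRatio hγ)).congr' ?_
  filter_upwards [eventually_gt_atTop 0] with n hn
  rw [Function.comp_apply, Real.exp_nat_mul, Real.exp_log (gammaRatio_pos hγ hn)]

end GammaAsymptotics

/-! ### The Barnes function and the asymptotics of the prefactor. -/

section Barnes

variable {γ : ℝ}

/-- The factors of the Weierstrass product of the Barnes function. -/
noncomputable def barnesFactor (γ : ℝ) (m : ℕ) : ℝ :=
  (1 + γ / (m + 1 : ℝ)) ^ (m + 1) * rexp (-γ + γ ^ 2 / (2 * (m + 1 : ℝ)))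

lemma barnesFactor_pos (hγ : 0 ≤ γ) (m : ℕ) : 0 < barnesFactor γ m := by
  unfold barnesFactor
  positivity

lemma log_barnesFactor (hγ : 0 ≤ γ) (m : ℕ) :
    Real.log (barnesFactor γ m) = ((m + 1 : ℕ) : ℝ) * (Real.log (1 + γ / ((m + 1 : ℕ) : ℝ)) -
      γ / ((m + 1 : ℕ) : ℝ) + γ ^ 2 / (2 * ((m + 1 : ℕ) : ℝ) ^ 2)) := by
  rw [barnesFactor, Real.log_mul (by positivity) (exp_pos _).ne', Real.log_exp, Real.log_pow]
  push_cast
  field_simp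
  ring

/-- The exponential factors cancel the first two Taylor terms of the logarithm; the cubic remainder
times `m + 1` is of order `m⁻²`. -/
lemma summable_log_barnesFactor (hγ : 0 ≤ γ) :
    Summable fun m => Real.log (barnesFactor γ m) := by
  refine Summable.of_norm_bounded_eventually_nat
    (g := fun m : ℕ => 2 * |γ| ^ 3 * (((m + 1 : ℕ) : ℝ) ^ 2)⁻¹) ?_ ?_
  · exact ((summable_nat_add_iff 1).2 (Real.summable_nat_pow_inv.2 one_lt_two)).mul_left _
  · filter_upwards [eventually_ge_atTop ⌈2 * |γ|⌉₊] with m hm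
    have h1 : 2 * |γ| ≤ ((m + 1 : ℕ) : ℝ) :=
      (Nat.ceil_le.1 hm).trans (by exact_mod_cast m.le_succ)
    have h2 := abs_log_one_add_div_sub_le γ m.succ_pos h1
    have h3 : (0 : ℝ) < ((m + 1 : ℕ) : ℝ) := by positivity
    rw [log_barnesFactor hγ, Real.norm_eq_abs, abs_mul, abs_of_pos h3]
    calc _ ≤ ((m + 1 : ℕ) : ℝ) * (2 * |γ| ^ 3 / ((m + 1 : ℕ) : ℝ) ^ 3) := by gcongr
      _ = _ := by field_simp

lemma tprod_barnesFactor_pos (hγ : 0 ≤ γ) : 0 < ∏' m, barnesFactor γ m := by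
  rw [← Real.rexp_tsum_eq_tprod (barnesFactor_pos hγ) (summable_log_barnesFactor hγ)]
  exact exp_pos _

lemma tendsto_prod_barnesFactor (hγ : 0 ≤ γ) :
    Tendsto (fun n => ∏ m ∈ Finset.range n, barnesFactor γ m) atTop
      (𝓝 (∏' m, barnesFactor γ m)) :=
  (Real.multipliable_of_summable_log (barnesFactor_pos hγ)
    (summable_log_barnesFactor hγ)).hasProd.tendsto_prod_nat

lemma barnesG_one_add (γ : ℝ) : barnesG (1 + γ) = (2 * π) ^ (γ / 2) *
    rexp (-(γ * (γ + 1) / 2) - Real.eulerMascheroniConstant * γ ^ 2 / 2) *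
      ∏' m, barnesFactor γ m := by
  unfold barnesG barnesFactor
  rw [add_sub_cancel_left]
  congr 3
  ring

lemma barnesG_one_add_pos (hγ : 0 ≤ γ) : 0 < barnesG (1 + γ) := by
  rw [barnesG_one_add]
  have := tprod_barnesFactor_pos hγ
  positivity

/-- The quotients `∏ Γ(γ + j + 1) / j!` of the normalisation constants. -/
noncomputable def gammaProd (γ : ℝ) (n : ℕ) : ℝ :=
  ∏ j ∈ Finset.range n, Real.Gamma (γ + j + 1) / j.factorial

/-- A finite form of the Weierstrass product of `G`, obtained by induction from the functional
equation of `Γ`. The convergence factors of the product then bring in the harmonic numbers, and in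
the limit Euler's constant. -/
lemma gammaProd_mul_prod (hγ : 0 ≤ γ) (n : ℕ) :
    gammaProd γ n * ∏ m ∈ Finset.range n, (1 + γ / (m + 1 : ℝ)) ^ (m + 1) =
      (Real.Gamma (γ + n + 1) / n.factorial) ^ n := by
  induction n with
  | zero => simp [gammaProd]
  | succ n ih =>
    have h1 : γ + ((n + 1 : ℕ) : ℝ) + 1 = (γ + n + 1) + 1 := by push_cast; ring
    have h2 : γ + n + 1 ≠ 0 := by positivity
    have h3 : (γ + n + 1) * Real.Gamma (γ + n + 1) / (((n + 1) * n.factorial : ℕ) : ℝ) =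
        Real.Gamma (γ + n + 1) / n.factorial * (1 + γ / (n + 1 : ℝ)) := by
      push_cast
      field_simp
      ring
    rw [gammaProd, Finset.prod_range_succ, Finset.prod_range_succ, mul_mul_mul_comm, ← gammaProd,
      ih, h1, Real.Gamma_add_one h2, Nat.factorial_succ, h3, mul_pow]
    ring

lemma gammaProd_mul_prod_barnesFactor (hγ : 0 ≤ γ) (n : ℕ) :
    gammaProd γ n * ∏ m ∈ Finset.range n, barnesFactor γ m =
      (Real.Gamma (γ + n + 1) / n.factorial) ^ n * rexp (-γ * n + γ ^ 2 / 2 * harmonic n) := by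
  unfold barnesFactor
  rw [Finset.prod_mul_distrib, ← mul_assoc, gammaProd_mul_prod hγ, ← Real.exp_sum]
  congr 2
  rw [Finset.sum_add_distrib, Finset.sum_const, Finset.card_range, harmonic, Rat.cast_sum,
    Finset.mul_sum, nsmul_eq_mul]
  congr 1
  · ring
  · refine Finset.sum_congr rfl fun m _ => ?_
    push_cast
    field_simp

/-- The asymptotics of `gammaProd` in terms of the Barnes function. -/
lemma tendsto_gammaProd (hγ : 0 ≤ γ) :
    Tendsto (fun n : ℕ => gammaProd γ n * barnesG (1 + γ) /
      ((n : ℝ) ^ (γ * n + γ ^ 2 / 2) * rexp (-γ * n) * (2 * π) ^ (γ / 2))) atTop (𝓝 1) := by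
  have hP := tprod_barnesFactor_pos hγ
  have h1 := (tendsto_gammaRatio_pow hγ).mul_const (rexp (-(γ * (γ + 1) / 2)))
  rw [← Real.exp_add, add_neg_cancel, Real.exp_zero] at h1
  have h2 := (continuous_exp.tendsto _).comp
    ((Real.tendsto_harmonic_sub_log.sub_const Real.eulerMascheroniConstant).const_mul (γ ^ 2 / 2))
  rw [sub_self, mul_zero, Real.exp_zero] at h2
  have h3 := (tendsto_prod_barnesFactor hγ).inv₀ hP.ne' |>.mul_const (∏' m, barnesFactor γ m)
  rw [inv_mul_cancel₀ hP.ne'] at h3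
  have h4 := (h1.mul h2).mul h3
  rw [one_mul, one_mul] at h4
  refine h4.congr' ?_
  filter_upwards [eventually_gt_atTop 0] with n hn
  have hn' : (0 : ℝ) < n := by exact_mod_cast hn
  have hPn : 0 < ∏ m ∈ Finset.range n, barnesFactor γ m :=
    Finset.prod_pos fun m _ => barnesFactor_pos hγ m
  have h5 := gammaProd_mul_prod_barnesFactor hγ n
  rw [← eq_div_iff hPn.ne'] at h5
  have hnγ : (0 : ℝ) < n ^ γ := by positivity
  have h6 : Real.Gamma (γ + n + 1) / n.factorial = gammaRatio γ n * n ^ γ := by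
    rw [gammaRatio]
    field_simp
  have h7 : (n : ℝ) ^ (γ * n + γ ^ 2 / 2) = (n ^ γ) ^ n * rexp (γ ^ 2 / 2 * Real.log n) := by
    rw [rpow_add hn', rpow_mul hn'.le, rpow_natCast, rpow_def_of_pos hn' (γ ^ 2 / 2)]
    congr 2
    ring
  have h8 : rexp (γ ^ 2 / 2 * (harmonic n - Real.log n - Real.eulerMascheroniConstant)) =
      rexp (γ ^ 2 / 2 * harmonic n) / rexp (γ ^ 2 / 2 * Real.log n) *
        rexp (-(Real.eulerMascheroniConstant * γ ^ 2 / 2)) := by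
    rw [← Real.exp_sub, ← Real.exp_add]
    congr 1
    ring
  rw [Function.comp_apply, h8, h5, barnesG_one_add, h6, h7, mul_pow, Real.exp_add,
    sub_eq_add_neg, Real.exp_add]
  have h9 : (0 : ℝ) < (2 * π) ^ (γ / 2) := by positivity
  field_simp

lemma tendsto_Gamma_stirling (hγ : 0 ≤ γ) :
    Tendsto (fun n : ℕ => Real.Gamma (γ + n + 1) /
      ((n : ℝ) ^ (n + γ + 1 / 2) * rexp (-n) * (2 * π) ^ (1 / 2 : ℝ))) atTop (𝓝 1) := by
  have hs := Stirling.tendsto_stirlingSeq_sqrt_pi.div_const (√π)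
  rw [div_self (by positivity)] at hs
  have h1 := (tendsto_gammaRatio hγ).mul hs
  rw [one_mul] at h1
  refine h1.congr' ?_
  filter_upwards [eventually_gt_atTop 0] with n hn
  have hn' : (0 : ℝ) < n := by exact_mod_cast hn
  have hnγ : (0 : ℝ) < n ^ γ := by positivity
  have h2 : (n : ℝ) ^ (n + γ + 1 / 2) = n ^ n * n ^ γ * √n := by
    rw [rpow_add hn', rpow_add hn', rpow_natCast, sqrt_eq_rpow]
  have h3 : rexp (-n) = (rexp 1 ^ n)⁻¹ := by
    rw [← Real.exp_nat_mul, mul_one, Real.exp_neg]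
  rw [gammaRatio, Stirling.stirlingSeq, h2, h3, ← sqrt_eq_rpow, div_pow, Real.sqrt_mul zero_le_two,
    Real.sqrt_mul zero_le_two]
  have h4 : (0 : ℝ) < √n := by positivity
  have h5 : (0 : ℝ) < √π := by positivity
  field_simp

/-- Stirling's formula at `γ + i` for each `i < k`; the exponents `n + γ + i + 1/2` add up to `k n +
k γ + k²/2`. -/
lemma tendsto_prod_Gamma_stirling (hγ : 0 ≤ γ) (k : ℕ) :
    Tendsto (fun n : ℕ => (∏ i ∈ Finset.range k, Real.Gamma (γ + n + i + 1)) /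
      ((n : ℝ) ^ (k * n + k * γ + (k : ℝ) ^ 2 / 2) * rexp (-k * n) * (2 * π) ^ (k / 2 : ℝ)))
      atTop (𝓝 1) := by
  induction k with
  | zero => simp
  | succ k ih =>
    have h1 := ih.mul (tendsto_Gamma_stirling (γ := γ + k) (by positivity))
    rw [one_mul] at h1
    refine h1.congr' ?_
    filter_upwards [eventually_gt_atTop 0] with n hn
    have hn' : (0 : ℝ) < n := by exact_mod_cast hn
    have h2 : (n : ℝ) ^ (((k + 1 : ℕ) : ℝ) * n + ((k + 1 : ℕ) : ℝ) * γ +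
        ((k + 1 : ℕ) : ℝ) ^ 2 / 2) =
        n ^ (k * n + k * γ + (k : ℝ) ^ 2 / 2) * n ^ (n + (γ + k) + 1 / 2) := by
      rw [← rpow_add hn']
      congr 1
      push_cast
      ring
    have h3 : rexp (-((k + 1 : ℕ) : ℝ) * n) = rexp (-k * n) * rexp (-n) := by
      rw [← Real.exp_add]
      congr 1
      push_cast
      ring
    have h4 : (2 * π) ^ (((k + 1 : ℕ) : ℝ) / 2) = (2 * π) ^ (k / 2 : ℝ) * (2 * π) ^ (1 / 2 : ℝ) := by
      rw [← rpow_add (by positivity)]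
      congr 1
      push_cast
      ring
    rw [Finset.prod_range_succ, h2, h3, h4, div_mul_div_comm]
    congr 1
    · congr 2
      ring
    · ring

lemma gammaProd_natCast_mul (k n : ℕ) :
    gammaProd k n * ∏ j ∈ Finset.range k, (j.factorial : ℝ) =
      ∏ i ∈ Finset.range k, Real.Gamma (0 + n + i + 1) := by
  have h1 : ∀ a b : ℕ, Real.Gamma ((a : ℝ) + b + 1) = ((a + b).factorial : ℝ) := fun a b => by
    rw [← Real.Gamma_nat_eq_factorial]
    push_cast
    rfl
  have h2 : (∏ j ∈ Finset.range n, (j.factorial : ℝ)) ≠ 0 :=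
    Finset.prod_ne_zero_iff.2 fun j _ => by positivity
  simp only [gammaProd, zero_add, h1, Finset.prod_div_distrib]
  have h3 := Finset.prod_range_add (fun j => (j.factorial : ℝ)) k n
  rw [add_comm, Finset.prod_range_add (fun j => (j.factorial : ℝ)) n k] at h3
  rw [div_mul_eq_mul_div, div_eq_iff h2, mul_comm, ← h3, mul_comm]

/-- At `γ = k` the product `gammaProd` telescopes to `k` Gamma values. Its asymptotics are thus
known both from the Weierstrass product and from Stirling, and uniqueness of limits yields the value
of `G` without its functional equation. -/
lemma barnesG_one_add_natCast (k : ℕ) :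
    barnesG (1 + k) = ∏ j ∈ Finset.range k, (j.factorial : ℝ) := by
  have h1 := tendsto_gammaProd (γ := k) (by positivity)
  have h2 := tendsto_prod_Gamma_stirling (γ := 0) le_rfl k
  have hG := barnesG_one_add_pos (γ := k) (by positivity)
  have h3 := (h1.mul_const (barnesG (1 + k))⁻¹).mul_const
    (∏ j ∈ Finset.range k, (j.factorial : ℝ))
  have h4 := tendsto_nhds_unique (h3.congr fun n => ?_) h2
  · rw [one_mul, inv_mul_eq_one₀ hG.ne'] at h4
    exact h4
  · rw [← gammaProd_natCast_mul, mul_zero, add_zero]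
    field_simp

/-- The asymptotics of the normalisation of the correlator. -/
lemma tendsto_correlator_const (hγ : 0 ≤ γ) (k : ℕ) :
    Tendsto (fun n : ℕ => (n : ℝ) ^ (-((γ + k) * n)) *
      ((∏ j ∈ Finset.range (k + n), Real.Gamma (γ + j + 1)) /
        (∏ j ∈ Finset.range n, (j.factorial : ℝ))) /
      (rexp (-(γ + k) * n) * (n : ℝ) ^ ((γ + k) ^ 2 / 2) * (2 * π) ^ ((γ + k) / 2) /
        barnesG (1 + γ))) atTop (𝓝 1) := by
  have h1 := (tendsto_gammaProd hγ).mul (tendsto_prod_Gamma_stirling hγ k)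
  rw [one_mul] at h1
  refine h1.congr' ?_
  filter_upwards [eventually_gt_atTop 0] with n hn
  have hn' : (0 : ℝ) < n := by exact_mod_cast hn
  have hG := barnesG_one_add_pos hγ
  have h2 : (∏ j ∈ Finset.range (k + n), Real.Gamma (γ + j + 1)) /
      (∏ j ∈ Finset.range n, (j.factorial : ℝ)) =
      gammaProd γ n * ∏ i ∈ Finset.range k, Real.Gamma (γ + n + i + 1) := by
    rw [add_comm k, Finset.prod_range_add, gammaProd, Finset.prod_div_distrib,
      div_mul_eq_mul_div]
    push_cast
    simp only [add_assoc]
  have h3 : (n : ℝ) ^ (γ * n + γ ^ 2 / 2) * n ^ (k * n + k * γ + (k : ℝ) ^ 2 / 2) =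
      ((n : ℝ) ^ (-((γ + k) * n)))⁻¹ * n ^ ((γ + k) ^ 2 / 2) := by
    rw [← rpow_neg hn'.le, ← rpow_add hn', ← rpow_add hn']
    congr 1
    ring
  have h4 : rexp (-γ * n) * rexp (-k * n) = rexp (-(γ + k) * n) := by
    rw [← Real.exp_add]
    congr 1
    ring
  have h5 : (2 * π) ^ (γ / 2) * (2 * π) ^ (k / 2 : ℝ) = (2 * π) ^ ((γ + k) / 2) := by
    rw [← rpow_add (by positivity)]
    congr 1
    ring
  have h6 : (n : ℝ) ^ (γ * n + γ ^ 2 / 2) * rexp (-γ * n) * (2 * π) ^ (γ / 2) *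
      (n ^ (k * n + k * γ + (k : ℝ) ^ 2 / 2) * rexp (-k * n) * (2 * π) ^ (k / 2 : ℝ)) =
      ((n : ℝ) ^ (-((γ + k) * n)))⁻¹ * n ^ ((γ + k) ^ 2 / 2) * rexp (-(γ + k) * n) *
        (2 * π) ^ ((γ + k) / 2) := by
    rw [← h3, ← h4, ← h5]
    ring
  have h7 : (0 : ℝ) < (n : ℝ) ^ (-((γ + k) * n)) := by positivity
  rw [div_mul_div_comm, h6, h2]
  field_simp

end Barnes

/-! ### Assembly: continuous extension and convergence of the ratio. -/

section Asymptotics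

variable {γ : ℝ} {k : ℕ}

/-- The continuous extension of the asymptotic expression to the collision of the charges. -/
noncomputable def collisionAsymptotic (γ : ℝ) (k N : ℕ) (u : ℂ) : ℝ :=
  rexp (-(γ + k) * N) * (N : ℝ) ^ ((γ + k) ^ 2 / 2) * (2 * π) ^ ((γ + k) / 2) /
    barnesG (1 + γ) * (limitKernel γ k (‖u‖ ^ 2)).det

lemma continuous_collisionAsymptotic (hγ : (k : ℝ) ≤ γ) (N : ℕ) :
    Continuous (collisionAsymptotic γ k N) := by
  unfold collisionAsymptotic
  exact continuous_const.mul ((continuous_det_limitKernel hγ).comp (by fun_prop))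

/-- With `|z₂| = |u| / √N`, the interaction factor is `N^(γk) |u|^(-2γk)`. Its power of `N`
completes the square to `(γ + k)² / 2`, while the singular power of `|u|` is absorbed with `F` and
`exp (k |u|^2)` into the limiting determinant, which is regular at `0`. -/
lemma collisionAsymptotic_eq (hγ : (k : ℝ) ≤ γ) {N : ℕ} (hN : 1 ≤ N) {u : ℂ} (hu : u ≠ 0) :
    collisionAsymptotic γ k N u = twoChargeAsymptotic N γ k 0 (u / (√(N : ℝ) : ℂ)) := by
  have hN0 : (0 : ℝ) < N := by exact_mod_cast hN
  have hu0 : 0 < ‖u‖ := norm_pos_iff.2 hu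
  have hx : 0 < ‖u‖ ^ 2 := by positivity
  have hnorm : ‖u / (√(N : ℝ) : ℂ)‖ = ‖u‖ / √N := by
    rw [norm_div, Complex.norm_real, norm_of_nonneg (sqrt_nonneg _)]
  have hsq : (‖u‖ / √(N : ℝ)) ^ 2 = ‖u‖ ^ 2 / N := by rw [div_pow, sq_sqrt hN0.le]
  have hlog : Real.log (‖u‖ / √(N : ℝ)) = Real.log (‖u‖ ^ 2) / 2 - Real.log N / 2 := by
    rw [Real.log_div hu0.ne' (by positivity), Real.log_sqrt hN0.le, Real.log_pow]
    push_cast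
    ring
  rw [collisionAsymptotic, twoChargeAsymptotic, det_limitKernel_eq_lueMaxCDF hγ hx,
    barnesG_one_add_natCast, Finset.prod_range, norm_zero, sub_zero, hnorm, hsq, hlog,
    mul_div_cancel₀ _ hN0.ne', rpow_def_of_pos hN0, rpow_def_of_pos hx]
  have h1 : rexp (γ * N * (0 ^ 2 - 1) + k * N * (‖u‖ ^ 2 / N - 1) + γ ^ 2 / 2 * Real.log N +
      (k : ℝ) ^ 2 / 2 * Real.log N) *
      rexp (-2 * γ * k * (Real.log (‖u‖ ^ 2) / 2 - Real.log N / 2)) =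
      rexp (-(γ + k) * N) * rexp (Real.log N * ((γ + k) ^ 2 / 2)) *
        (rexp (Real.log (‖u‖ ^ 2) * -(γ * k)) * rexp (k * ‖u‖ ^ 2)) := by
    simp only [← Real.exp_add]
    congr 1
    field_simp
    ring
  rw [h1]
  simp only [div_eq_mul_inv, mul_inv]
  ring

/-- The limit is taken jointly in `N` and the position, which encodes local uniformity. It splits
into the prefactor and the ratio of the finite to the limiting determinant, both tending to `1`. -/
lemma tendsto_twoChargeCorrelator_div (hγ : (k : ℝ) ≤ γ) (u : ℂ) :
    Tendsto (fun p : ℕ × ℂ => twoChargeCorrelator p.1 γ k 0 (p.2 / (√(p.1 : ℝ) : ℂ)) /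
      collisionAsymptotic γ k p.1 p.2) (atTop ×ˢ 𝓝 u) (𝓝 1) := by
  have hγ0 : 0 ≤ γ := le_trans (by positivity) hγ
  have hn : Tendsto (fun v : ℂ => ‖v‖ ^ 2) (𝓝 u) (𝓝 (‖u‖ ^ 2)) :=
    Continuous.tendsto (by fun_prop) u
  have hmap : Tendsto (fun p : ℕ × ℂ => (p.1, ‖p.2‖ ^ 2)) (atTop ×ˢ 𝓝 u)
      (atTop ×ˢ 𝓝 (‖u‖ ^ 2)) := tendsto_fst.prodMk (hn.comp tendsto_snd)
  have h1 := (tendsto_det_chargeKernel hγ (‖u‖ ^ 2)).comp hmap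
  have h2 : Tendsto (fun p : ℕ × ℂ => (limitKernel γ k (‖p.2‖ ^ 2)).det)
      (atTop ×ˢ 𝓝 u) (𝓝 (limitKernel γ k (‖u‖ ^ 2)).det) :=
    (((continuous_det_limitKernel hγ).tendsto _).comp hn).comp tendsto_snd
  have h3 := h1.div h2 (det_limitKernel_pos hγ _).ne'
  rw [div_self (det_limitKernel_pos hγ _).ne'] at h3
  have h4 := ((tendsto_correlator_const hγ0 k).comp
    (tendsto_fst (f := atTop (α := ℕ)) (g := 𝓝 u))).mul h3
  rw [one_mul] at h4
  refine h4.congr' ?_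
  filter_upwards [tendsto_fst.eventually (eventually_ge_atTop 1)] with p hp
  rw [twoChargeCorrelator_eq hγ0 k hp, det_dualKernel hγ, Complex.ofReal_re, collisionAsymptotic,
    Function.comp_apply, Pi.div_apply, Function.comp_apply, div_mul_div_comm]
  ring

end Asymptotics

theorem mainTheorem7 (k₂ : ℕ) (γ : ℝ) (hγ : (k₂ : ℝ) ≤ γ) :
    (∀ N : ℕ, 1 ≤ N → ∀ u₂ : ℂ,
      Integrable (charPolyProduct γ k₂ 0 (u₂ / (√(N : ℝ) : ℂ))) (ginibre N)) ∧
    -- `A N` is the continuous extension of the asymptotic expression to the collision `u₂ = 0`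
    ∃ A : ℕ → ℂ → ℝ,
      (∀ N : ℕ, 1 ≤ N → Continuous (A N)) ∧
      (∀ N : ℕ, 1 ≤ N → ∀ u₂ : ℂ, u₂ ≠ 0 →
        A N u₂ = twoChargeAsymptotic N γ k₂ 0 (u₂ / (√(N : ℝ) : ℂ))) ∧
      ∀ K : Set ℂ, IsCompact K →
        TendstoUniformlyOn
          (fun (N : ℕ) (u₂ : ℂ) =>
            twoChargeCorrelator N γ k₂ 0 (u₂ / (√(N : ℝ) : ℂ)) / A N u₂)
          (fun _ => 1) atTop K := by
  refine ⟨fun N hN u₂ => integrable_charPolyProduct_ginibre (le_trans (by positivity) hγ) k₂ hN u₂,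
    collisionAsymptotic γ k₂, fun N _ => continuous_collisionAsymptotic hγ N,
    fun N hN u₂ hu => collisionAsymptotic_eq hγ hN hu, fun K hK => ?_⟩
  -- On a compact set uniform convergence is local, and for a constant limit the local statement at
  -- `u` follows from the joint limit along `atTop ×ˢ 𝓝 u`.
  rw [← tendstoLocallyUniformlyOn_iff_tendstoUniformlyOn_of_compact hK,
    tendstoLocallyUniformlyOn_iff_forall_tendsto]
  intro u _
  refine Tendsto.mono_right ?_ (nhds_le_uniformity (1 : ℝ))
  exact tendsto_const_nhds.prodMk_nhds ((tendsto_twoChargeCorrelator_div hγ u).mono_left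
    (prod_mono le_rfl nhdsWithin_le_nhds))
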